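/- Let $q_0,u_0,X>0$ with $u_0\neq 2q_0$, and consider the defocusing NLS equation with small dispersion and two symmetric positive frequency jumps: initial amplitude $|q(x,0)|=q_0$ and initial frequency $u(x,0)=-2u_0$ for $x<-X/2$, $u(x,0)=0$ for $|x|<X/2$, $u(x,0)=2u_0$ for $x>X/2$. In the small-dispersion limit this problem is described by the NLS-Whitham equations $\partial_t r_k=s_k\,\partial_x r_k$ for nondecreasingly ordered Riemann invariants $r_1\le\dots\le r_{2G+2}$. For distinct branch points $b_1<\dots<b_{2g+2}$, with elementary symmetric functions $\sigma_1,\sigma_2$ and $\mu(z)=\prod_j(z-b_j)$, the speeds are $s_k=Q(b_k)/P(b_k)$, where $P=z^{g+1}-\frac12\sigma_1z^g+\alpha_1z^{g-1}+\dots+\alpha_g$ and $Q=z^{g+2}-\frac12\sigma_1z^{g+1}+\frac12(\sigma_2-\frac14\sigma_1^2)z^g+\gamma_1z^{g-1}+\dots+\gamma_g$ are determined by $\int_{b_{2j+1}}^{b_{2j+2}}P/\sqrt{-\mu}\,dz=\int_{b_{2j+1}}^{b_{2j+2}}Q/\sqrt{-\mu}\,dz=0$, $j=1,\dots,g$. Coinciding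 invariants are removed in pairs: the branch points at $(x,t)$ are the values attained an odd number of times by $r_1(x,t),\dots,r_{2G+2}(x,t)$; if there are $2g+2$ of them, the local genus at $(x,t)$ is $g$, and the speed of an invariant that coincides with no other one is computed from these branch points. The regularized initial data are the following step functions (values for $x<-X/2$, for $|x|<X/2$ and for $x>X/2$; a single value means a constant). Put $A_\pm=-2u_0\pm2q_0$, $B_\pm=\pm2q_0$, $C_\pm=2u_0\pm2q_0$. * $u_0>2q_0$: $r_1=A_-$; $r_2=A_+,A_-,A_-$; $r_3=B_+,B_-,B_-$; $r_4=B_+,B_+,B_-$; $r_5=C_+,C_+,C_-$; $r_6=C_+$. * $q_0<u_0<2q_0$: $r_1=A_-$; $r_2=B_-,A_-,A_-$; $r_3=B_-$; $r_4=A_+,A_+,B_-$; $r_5=C_-,A_+,A_+$; $r_6=C_-,C_-,A_+$; $r_7=B_+,C_-,C_-$; $r_8=B_+$; $r_9=C_+,C_+,B_+$; $r_{10}=C_+$. * $0<u_0\le q_0$: $r_1=A_-$; $r_2=B_-,A_-,A_-$; $r_3=B_-$; $r_4=C_-,C_-,B_-$; $r_5=C_-$; $r_6=A_+$; $r_7=B_+,A_+,A_+$;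 $r_8=B_+$; $r_9=C_+,C_+,B_+$; $r_{10}=C_+$. A solution for $0<t<T$ means: ordered functions $r_k(x,t)$, jointly continuous, nonincreasing in $x$, with $r_k(x,t)\to r_k^0(x_0)$ as $(x,t)\to(x_0,0^+)$ at every continuity point $x_0$ of $r^0_k$, and such that through every point there is a continuous curve $x=\chi(t)$, reaching back to $t=0$, along which $r_k$ is constant and on which $\chi'=-s_k$ whenever $r_k$ coincides with no other invariant. Let $$s_{\rm out}=(u_0+q_0)\Big[1+\frac{u_0q_0}{(u_0+q_0)^2}\Big],\qquad s_{\rm in}=q_0-\tfrac12u_0$$ be the single-jump speeds. Then, for every solution and every $0<t<T$ before the interaction, i.e. $t<X/\big(2(s_{\rm out}+u_0)\big)$, the boundaries between genus-0 and genus-1 regions are the following straight lines. 1. If $u_0>2q_0$: $x=-\frac X2+(\pm s_{\rm out}+u_0)t$ for the left jump and $x=\frac X2+(\pm s_{\rm out}-u_0)t$ for the right jump. The local genus is $1$ strictly between the two lines of each jump, and $0$ everywhere else. 2. If $u_0<2q_0$: $x=-\frac X2+(\pm s+u_0)t$ for the left jump and $x=\frac X2+(\pm s-u_0)t$ for the right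 jump, with $s\in\{s_{\rm out},s_{\rm in}\}$. For each jump the local genus is $1$ strictly between the outer and the inner line on either side (that is, for $x=\mp\frac X2+(v\pm u_0)t$ with $s_{\rm in}<|v|<s_{\rm out}$), and $0$ everywhere else. -/

import Mathlib

open Set Filter Topology

noncomputable section

namespace NLSWhitham

/-! ### The NLS-Whitham equations -/

/-- The first elementary symmetric function of the branch points. -/
def sigmaOne {n : ℕ} (b : Fin n → ℝ) : ℝ := ∑ j, b j

/-- The second elementary symmetric function of the branch points. -/
def sigmaTwo {n : ℕ} (b : Fin n → ℝ) : ℝ :=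
  ∑ p ∈ Finset.univ.filter (fun p : Fin n × Fin n => p.1 < p.2), b p.1 * b p.2

/-- The polynomial of the hyperelliptic curve with branch points `b`. -/
def mu {n : ℕ} (b : Fin n → ℝ) (z : ℝ) : ℝ := ∏ j, (z - b j)

/-- The differential with numerator `P` over the square root of `mu` has vanishing period around
each of the spectral gaps number `1, …, g` (gap number `0` is the interval from `b 0` to `b 1`). -/
def VanishingPeriods (g : ℕ) (b : Fin (2 * g + 2) → ℝ) (P : Polynomial ℝ) : Prop :=
  ∀ j : Fin g,
    ∫ z in (b ⟨2 * j + 2, by omega⟩)..(b ⟨2 * j + 3, by omega⟩),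
      P.eval z / Real.sqrt (-mu b z) = 0

/-- `P` is the numerator `z ^ (g + 1) - σ₁ / 2 * z ^ g + α₁ z ^ (g - 1) + ⋯ + α_g` of the
normalized quasi-momentum differential. -/
structure IsMomentumNumerator (g : ℕ) (b : Fin (2 * g + 2) → ℝ) (P : Polynomial ℝ) : Prop where
  monic : P.Monic
  natDegree : P.natDegree = g + 1
  coeff_one : P.coeff g = -(1 / 2) * sigmaOne b
  periods : VanishingPeriods g b P

/-- `Q` is the numerator
`z ^ (g + 2) - σ₁ / 2 * z ^ (g + 1) + (σ₂ - σ₁ ^ 2 / 4) / 2 * z ^ g + γ₁ z ^ (g - 1) + ⋯ + γ_g`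
of the normalized quasi-energy differential. -/
structure IsEnergyNumerator (g : ℕ) (b : Fin (2 * g + 2) → ℝ) (Q : Polynomial ℝ) : Prop where
  monic : Q.Monic
  natDegree : Q.natDegree = g + 2
  coeff_one : Q.coeff (g + 1) = -(1 / 2) * sigmaOne b
  coeff_two : Q.coeff g = 1 / 2 * (sigmaTwo b - 1 / 4 * sigmaOne b ^ 2)
  periods : VanishingPeriods g b Q

/-- `s` is the characteristic speed `s_k(b)` of the genus-`g` NLS-Whitham equations
`∂ r_k / ∂ t = s_k ∂ r_k / ∂ x` at the branch points `b 0 < ⋯ < b (2 g + 1)`. -/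
def IsWhithamSpeed (g : ℕ) (b : Fin (2 * g + 2) → ℝ) (k : Fin (2 * g + 2)) (s : ℝ) : Prop :=
  ∃ P Q : Polynomial ℝ, IsMomentumNumerator g b P ∧ IsEnergyNumerator g b Q ∧
    s = Q.eval (b k) / P.eval (b k)

/-! ### Degenerate gaps and bands, local genus -/

/-- The branch points that remain after all pairs of coinciding Riemann invariants (degenerate
gaps or bands) have been removed: the values that are attained an odd number of times. -/
def branchPoints {n : ℕ} (r : Fin n → ℝ) : Finset ℝ :=
  (Finset.univ.image r).filter fun v => Odd (Finset.univ.filter fun k => r k = v).card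

/-- The local genus of the configuration `r` of Riemann invariants is `g`. -/
def HasGenus {n : ℕ} (r : Fin n → ℝ) (g : ℕ) : Prop := (branchPoints r).card = 2 * g + 2

/-- The invariant `r k` does not coincide with any other invariant. -/
def IsNondegenerate {n : ℕ} (r : Fin n → ℝ) (k : Fin n) : Prop := ∀ l, r l = r k → l = k

/-- `s` is the characteristic speed of the nondegenerate invariant `r k`, computed from the
NLS-Whitham equations that are left after the removal of degenerate gaps and bands. -/
def HasSpeed {n : ℕ} (r : Fin n → ℝ) (k : Fin n) (s : ℝ) : Prop :=
  ∃ (g : ℕ) (b : Fin (2 * g + 2) → ℝ) (m : Fin (2 * g + 2)),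
    StrictMono b ∧ range b = (branchPoints r : Set ℝ) ∧ b m = r k ∧ IsWhithamSpeed g b m s

/-! ### Solutions of the regularized initial value problem -/

/-- The Riemann invariants `r k x t` are a continuous rarefaction solution of the NLS-Whitham
equations for `0 < t < T` with regularized initial data `r0`. The equations
`∂ r_k / ∂ t = s_k ∂ r_k / ∂ x` are read in characteristic form, because the invariants are only
continuous across the boundaries between regions of different genus: through each point there is
a curve, going back to `t = 0`, along which `r k` is constant and which has the slope
`dx / dt = - s_k` wherever `r k` is nondegenerate. -/
structure IsWhithamSolution {n : ℕ} (T : ℝ) (r0 : Fin n → ℝ → ℝ) (r : Fin n → ℝ → ℝ → ℝ) :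
    Prop where
  continuousOn : ∀ k, ContinuousOn (fun p : ℝ × ℝ => r k p.1 p.2) (univ ×ˢ Ioo 0 T)
  ordered : ∀ x, ∀ t ∈ Ioo 0 T, Monotone fun k => r k x t
  nonincreasing : ∀ k, ∀ t ∈ Ioo 0 T, Antitone fun x => r k x t
  initial : ∀ k x, ContinuousAt (r0 k) x →
    Tendsto (fun p : ℝ × ℝ => r k p.1 p.2) (𝓝 x ×ˢ 𝓝[>] 0) (𝓝 (r0 k x))
  characteristic : ∀ k x₁, ∀ t₁ ∈ Ioo 0 T, ∃ χ : ℝ → ℝ,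
    ContinuousOn χ (Icc 0 t₁) ∧ χ t₁ = x₁ ∧
    (∀ t ∈ Ioc 0 t₁, r k (χ t) t = r k x₁ t₁) ∧
    ∀ t ∈ Ioo 0 t₁, IsNondegenerate (fun l => r l (χ t) t) k →
      ∃ s, HasSpeed (fun l => r l (χ t) t) k s ∧ HasDerivAt χ (-s) t

/-- The points `x` at which the solution has local genus `g` at time `t`. -/
def genusRegion {n : ℕ} (r : Fin n → ℝ → ℝ → ℝ) (g : ℕ) (t : ℝ) : Set ℝ :=
  {x | HasGenus (fun k => r k x t) g}

/-- The boundary points at time `t` between the regions of genus `0` and of genus `1`. -/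
def genusBoundary {n : ℕ} (r : Fin n → ℝ → ℝ → ℝ) (t : ℝ) : Set ℝ :=
  closure (genusRegion r 0 t) ∩ closure (genusRegion r 1 t)

/-! ### Two symmetric jumps

The initial amplitude is `|q| = q₀`, and the initial frequency `u` is `-2 u₀` for `x < -X / 2`,
`0` for `|x| < X / 2` and `2 u₀` for `x > X / 2`. At each `x`, the branch points of the
regularized data are the two genus-0 invariants `u - 2 q₀` and `u + 2 q₀`. -/

/-- Step data with the values `L`, `M`, `R` to the left of, between and to the right of the
two jump locations `-X / 2` and `X / 2`. -/
def stepData {n : ℕ} (X : ℝ) (L M R : Fin n → ℝ) (k : Fin n) (x : ℝ) : ℝ :=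
  if x < -X / 2 then L k else if x < X / 2 then M k else R k

/-- Regularized data (genus-2 equations) for two individually super-critical jumps,
`2 q₀ < u₀`. -/
def superData (q₀ u₀ X : ℝ) : Fin 6 → ℝ → ℝ :=
  stepData X
    ![-2*u₀ - 2*q₀, -2*u₀ + 2*q₀,  2*q₀,  2*q₀, 2*u₀ + 2*q₀, 2*u₀ + 2*q₀]
    ![-2*u₀ - 2*q₀, -2*u₀ - 2*q₀, -2*q₀,  2*q₀, 2*u₀ + 2*q₀, 2*u₀ + 2*q₀]
    ![-2*u₀ - 2*q₀, -2*u₀ - 2*q₀, -2*q₀, -2*q₀, 2*u₀ - 2*q₀, 2*u₀ + 2*q₀]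

/-- Regularized data (genus-4 equations) for two individually sub-critical jumps that are
collectively super-critical, `q₀ < u₀ < 2 q₀`. -/
def intermediateData (q₀ u₀ X : ℝ) : Fin 10 → ℝ → ℝ :=
  stepData X
    ![-2*u₀ - 2*q₀,        -2*q₀, -2*q₀, -2*u₀ + 2*q₀,  2*u₀ - 2*q₀,
       2*u₀ - 2*q₀,         2*q₀,  2*q₀,  2*u₀ + 2*q₀,  2*u₀ + 2*q₀]
    ![-2*u₀ - 2*q₀, -2*u₀ - 2*q₀, -2*q₀, -2*u₀ + 2*q₀, -2*u₀ + 2*q₀,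
       2*u₀ - 2*q₀,  2*u₀ - 2*q₀,  2*q₀,  2*u₀ + 2*q₀,  2*u₀ + 2*q₀]
    ![-2*u₀ - 2*q₀, -2*u₀ - 2*q₀, -2*q₀,        -2*q₀, -2*u₀ + 2*q₀,
      -2*u₀ + 2*q₀,  2*u₀ - 2*q₀,  2*q₀,         2*q₀,  2*u₀ + 2*q₀]

/-- Regularized data (genus-4 equations) for two jumps that are collectively sub-critical or
critical, `0 < u₀ ≤ q₀` (in the critical case two of the invariants are a degenerate pair
everywhere). -/
def subData (q₀ u₀ X : ℝ) : Fin 10 → ℝ → ℝ :=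
  stepData X
    ![-2*u₀ - 2*q₀,        -2*q₀, -2*q₀,  2*u₀ - 2*q₀,  2*u₀ - 2*q₀,
      -2*u₀ + 2*q₀,         2*q₀,  2*q₀,  2*u₀ + 2*q₀,  2*u₀ + 2*q₀]
    ![-2*u₀ - 2*q₀, -2*u₀ - 2*q₀, -2*q₀,  2*u₀ - 2*q₀,  2*u₀ - 2*q₀,
      -2*u₀ + 2*q₀, -2*u₀ + 2*q₀,  2*q₀,  2*u₀ + 2*q₀,  2*u₀ + 2*q₀]
    ![-2*u₀ - 2*q₀, -2*u₀ - 2*q₀, -2*q₀,        -2*q₀,  2*u₀ - 2*q₀,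
      -2*u₀ + 2*q₀, -2*u₀ + 2*q₀,  2*q₀,         2*q₀,  2*u₀ + 2*q₀]

/-- Regularized data for two individually sub-critical jumps, `0 < u₀ < 2 q₀`. -/
def subcriticalData (q₀ u₀ X : ℝ) : Fin 10 → ℝ → ℝ :=
  if u₀ ≤ q₀ then subData q₀ u₀ X else intermediateData q₀ u₀ X

/-- The speed of the outer genus-0/genus-1 boundaries of a single jump of size `2 u₀ > 0`. -/
def sOuter (q₀ u₀ : ℝ) : ℝ := (u₀ + q₀) * (1 + u₀ * q₀ / (u₀ + q₀) ^ 2)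

/-- The speed of the inner genus-0/genus-1 boundaries of a single sub-critical jump. -/
def sInner (q₀ u₀ : ℝ) : ℝ := q₀ - 1 / 2 * u₀

/-- The interaction time: the right-most line of the left jump and the left-most line of the
right jump meet. -/
def interactionTime (q₀ u₀ X : ℝ) : ℝ := X / (2 * (sOuter q₀ u₀ + u₀))

/-- The position at time `t` of a line that starts at the left jump and has the velocity of a
single-jump boundary with velocity `s`, shifted by `u₀`. -/
def leftLine (u₀ X s t : ℝ) : ℝ := -X / 2 + (s + u₀) * t

/-- The same for the right jump, with the opposite shift. -/
def rightLine (u₀ X s t : ℝ) : ℝ := X / 2 + (s - u₀) * t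

end NLSWhitham

end

noncomputable section

namespace NLSWhitham

/-! ### Integrals over a gap -/

/-- The trigonometric parametrization of the interval from `a` to `b`. -/
def gapPoint (a b θ : ℝ) : ℝ := (a + b) / 2 + (b - a) / 2 * Real.cos θ

lemma continuous_gapPoint (a b : ℝ) : Continuous (gapPoint a b) := by
  unfold gapPoint; fun_prop

lemma gapPoint_mem_Icc {a b : ℝ} (h : a ≤ b) (θ : ℝ) : gapPoint a b θ ∈ Icc a b := by
  have h1 := Real.neg_one_le_cos θ
  have h2 := Real.cos_le_one θ
  unfold gapPoint
  constructor <;> nlinarith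

lemma gapPoint_image {a b : ℝ} (h : a < b) : gapPoint a b '' Ioo 0 Real.pi = Ioo a b := by
  ext z
  constructor
  · rintro ⟨θ, hθ, rfl⟩
    have h1 : Real.cos θ < 1 := by
      have := Real.cos_lt_cos_of_nonneg_of_le_pi le_rfl hθ.2.le hθ.1
      simpa using this
    have h2 : -1 < Real.cos θ := by
      have := Real.cos_lt_cos_of_nonneg_of_le_pi hθ.1.le le_rfl hθ.2
      simpa using this
    unfold gapPoint
    constructor <;> nlinarith
  · intro hz
    have hpos : 0 < (b - a) / 2 := by linarith
    set c := (z - (a + b) / 2) / ((b - a) / 2) with hc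
    have h1 : c < 1 := by rw [hc, div_lt_one hpos]; linarith [hz.2]
    have h2 : -1 < c := by rw [hc, lt_div_iff₀ hpos]; linarith [hz.1]
    refine ⟨Real.arccos c, ⟨Real.arccos_pos.2 h1, ?_⟩, ?_⟩
    · exact lt_of_le_of_ne (Real.arccos_le_pi c) fun h => by
        rw [Real.arccos_eq_pi] at h; linarith
    · unfold gapPoint
      rw [Real.cos_arccos h2.le h1.le, hc, mul_div_cancel₀ _ hpos.ne']
      ring

lemma gapPoint_sqrt {a b θ : ℝ} (h : a < b) (hθ : θ ∈ Ioo 0 Real.pi) :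
    √((gapPoint a b θ - a) * (b - gapPoint a b θ)) = (b - a) / 2 * Real.sin θ := by
  have hs : 0 < Real.sin θ := Real.sin_pos_of_mem_Ioo hθ
  rw [Real.sqrt_eq_iff_mul_self_eq_of_pos (mul_pos (by linarith) hs)]
  unfold gapPoint
  have := Real.sin_sq_add_cos_sq θ
  linear_combination ((b - a) / 2) ^ 2 * this

lemma gapPoint_hasDerivAt (a b θ : ℝ) :
    HasDerivAt (gapPoint a b) (-((b - a) / 2 * Real.sin θ)) θ := by
  unfold gapPoint
  simpa using ((Real.hasDerivAt_cos θ).const_mul ((b - a) / 2)).const_add ((a + b) / 2)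

lemma gapPoint_injOn {a b : ℝ} (h : a < b) : InjOn (gapPoint a b) (Ioo 0 Real.pi) := by
  intro x hx y hy hxy
  unfold gapPoint at hxy
  refine Real.injOn_cos ⟨hx.1.le, hx.2.le⟩ ⟨hy.1.le, hy.2.le⟩ ?_
  have : (b - a) / 2 ≠ 0 := (half_pos (sub_pos.2 h)).ne'
  exact mul_left_cancel₀ this (by linarith)

lemma gapPoint_weight {a b : ℝ} (h : a < b) (f : ℝ → ℝ) :
    EqOn (fun θ => |(-((b - a) / 2 * Real.sin θ))| •
      (f (gapPoint a b θ) / √((gapPoint a b θ - a) * (b - gapPoint a b θ))))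
      (fun θ => f (gapPoint a b θ)) (Ioo 0 Real.pi) := by
  intro θ hθ
  have hs : 0 < (b - a) / 2 * Real.sin θ :=
    mul_pos (by linarith) (Real.sin_pos_of_mem_Ioo hθ)
  simp only [gapPoint_sqrt h hθ, abs_neg, abs_of_pos hs, smul_eq_mul]
  exact mul_div_cancel₀ _ hs.ne'

/-- Integrals with inverse square root singularities at both ends. -/
lemma integral_div_sqrt {a b : ℝ} (h : a < b) (f : ℝ → ℝ) :
    ∫ z in a..b, f z / √((z - a) * (b - z)) = ∫ θ in 0..Real.pi, f (gapPoint a b θ) := by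
  rw [intervalIntegral.integral_of_le h.le, intervalIntegral.integral_of_le Real.pi_pos.le,
    MeasureTheory.integral_Ioc_eq_integral_Ioo, MeasureTheory.integral_Ioc_eq_integral_Ioo,
    ← gapPoint_image h, MeasureTheory.integral_image_eq_integral_abs_deriv_smul measurableSet_Ioo
      (fun θ _ => (gapPoint_hasDerivAt a b θ).hasDerivWithinAt) (gapPoint_injOn h)]
  exact MeasureTheory.setIntegral_congr_fun measurableSet_Ioo (gapPoint_weight h f)

lemma intervalIntegrable_div_sqrt {a b : ℝ} (h : a < b) {f : ℝ → ℝ}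
    (hf : ContinuousOn f (Icc a b)) :
    IntervalIntegrable (fun z => f z / √((z - a) * (b - z))) MeasureTheory.volume a b := by
  rw [intervalIntegrable_iff_integrableOn_Ioo_of_le h.le, ← gapPoint_image h,
    MeasureTheory.integrableOn_image_iff_integrableOn_abs_deriv_smul measurableSet_Ioo
      (fun θ _ => (gapPoint_hasDerivAt a b θ).hasDerivWithinAt) (gapPoint_injOn h),
    MeasureTheory.integrableOn_congr_fun (gapPoint_weight h f) measurableSet_Ioo]
  have : Continuous fun θ => f (gapPoint a b θ) :=
    hf.comp_continuous (continuous_gapPoint a b) (gapPoint_mem_Icc h.le)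
  exact (this.integrableOn_Icc (a := 0) (b := Real.pi)).mono_set Ioo_subset_Icc_self

lemma integral_cos_sq_zero_pi : ∫ θ in 0..Real.pi, Real.cos θ ^ 2 = Real.pi / 2 := by
  rw [integral_cos_sq]; simp

lemma integral_gapPoint (a b : ℝ) :
    ∫ θ in 0..Real.pi, gapPoint a b θ = Real.pi * ((a + b) / 2) := by
  unfold gapPoint
  rw [intervalIntegral.integral_add (Continuous.intervalIntegrable (by fun_prop) _ _)
    (Continuous.intervalIntegrable (by fun_prop) _ _)]
  simp
  ring

lemma integral_gapPoint_sq (a b : ℝ) :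
    ∫ θ in 0..Real.pi, gapPoint a b θ ^ 2 =
      Real.pi * (((a + b) / 2) ^ 2 + ((b - a) / 2) ^ 2 / 2) := by
  have : ∀ θ, gapPoint a b θ ^ 2 = ((a + b) / 2) ^ 2 + (a + b) * ((b - a) / 2) * Real.cos θ +
      ((b - a) / 2) ^ 2 * Real.cos θ ^ 2 := fun θ => by unfold gapPoint; ring
  simp_rw [this]
  rw [intervalIntegral.integral_add (Continuous.intervalIntegrable (by fun_prop) _ _)
    (Continuous.intervalIntegrable (by fun_prop) _ _),
    intervalIntegral.integral_add (Continuous.intervalIntegrable (by fun_prop) _ _)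
    (Continuous.intervalIntegrable (by fun_prop) _ _), intervalIntegral.integral_const_mul,
    intervalIntegral.integral_const_mul, integral_cos_sq_zero_pi]
  simp
  ring

lemma integral_inv_sub_mul_cos {Y e : ℝ} (h : |e| < Y) :
    ∫ θ in 0..Real.pi, (Y - e * Real.cos θ)⁻¹ = Real.pi / √(Y ^ 2 - e ^ 2) := by
  obtain ⟨h1, h2⟩ := abs_lt.1 h
  have hpos : 0 < Y ^ 2 - e ^ 2 := by nlinarith
  set R := √(Y ^ 2 - e ^ 2) with hR
  have hRpos : 0 < R := Real.sqrt_pos.2 hpos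
  have hR2 : R ^ 2 = Y ^ 2 - e ^ 2 := Real.sq_sqrt hpos.le
  set k := (Y + e) / R with hk
  have hkpos : 0 < k := div_pos (by linarith) hRpos
  have hkR : k * R = Y + e := div_mul_cancel₀ _ hRpos.ne'
  clear_value k
  have hden : ∀ θ, 0 < Y - e * Real.cos θ := fun θ => by
    have := (abs_mul e (Real.cos θ)).le.trans
      (mul_le_of_le_one_right (abs_nonneg e) (Real.abs_cos_le_one θ))
    linarith [le_abs_self (e * Real.cos θ)]
  have key := intervalIntegral.integral_eq_sub_of_hasDerivAt_of_tendsto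
    (f := fun θ => 2 / R * Real.arctan (k * Real.tan (θ / 2)))
    (f' := fun θ => (Y - e * Real.cos θ)⁻¹) (a := 0) (b := Real.pi) (fa := 0)
    (fb := 2 / R * (Real.pi / 2)) Real.pi_pos ?_ ?_ ?_ ?_
  · rw [key]; field_simp; ring
  · intro θ hθ
    have hc : 0 < Real.cos (θ / 2) :=
      Real.cos_pos_of_mem_Ioo ⟨by linarith [hθ.1, Real.pi_pos], by linarith [hθ.2]⟩
    have h3 := ((((Real.hasDerivAt_tan hc.ne').comp θ ((hasDerivAt_id θ).div_const 2)).const_mul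
      k).arctan).const_mul (2 / R)
    refine HasDerivAt.congr_deriv h3 (Eq.symm ?_)
    have hcos : Real.cos θ = 2 * Real.cos (θ / 2) ^ 2 - 1 := by
      rw [← Real.cos_two_mul]; congr 1; ring
    have hs := Real.sin_sq_add_cos_sq (θ / 2)
    simp only [Function.comp, id]
    rw [Real.tan_eq_sin_div_cos, inv_eq_iff_eq_inv]
    have := hden θ
    rw [hcos] at this ⊢
    set C := Real.cos (θ / 2)
    set S := Real.sin (θ / 2)
    have hS : S ^ 2 = 1 - C ^ 2 := by linarith
    have h4 : 1 + (k * (S / C)) ^ 2 = (C ^ 2 + k ^ 2 * (1 - C ^ 2)) / C ^ 2 := by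
      rw [← hS]; field_simp
    have hR3 : R = k * (Y - e) := mul_left_cancel₀ hRpos.ne' (by linear_combination hR2 - (Y - e) * hkR)
    have h5 : R * (C ^ 2 + k ^ 2 * (1 - C ^ 2)) = k * (Y - e * (2 * C ^ 2 - 1)) := by
      linear_combination C ^ 2 * hR3 + k * (1 - C ^ 2) * hkR
    rw [h4]
    field_simp
    linarith
  · exact (Continuous.inv₀ (by fun_prop) fun θ => (hden θ).ne').intervalIntegrable _ _
  · have : ContinuousAt (fun θ => 2 / R * Real.arctan (k * Real.tan (θ / 2))) 0 := by
      have h6 : ContinuousAt (fun θ : ℝ => Real.tan (θ / 2)) 0 :=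
        ContinuousAt.comp (f := fun θ : ℝ => θ / 2) (g := Real.tan)
          (Real.continuousAt_tan.2 (by simp)) (by fun_prop)
      exact continuousAt_const.mul
        (Real.continuous_arctan.continuousAt.comp (continuousAt_const.mul h6))
    have h0 := this.tendsto.mono_left (nhdsWithin_le_nhds (s := Ioi 0))
    simpa using h0
  · refine Tendsto.const_mul _ ((Real.tendsto_arctan_atTop.mono_right nhdsWithin_le_nhds).comp
      (Tendsto.const_mul_atTop hkpos (Real.tendsto_tan_pi_div_two.comp ?_)))
    refine tendsto_nhdsWithin_iff.2 ⟨?_, ?_⟩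
    · exact ((continuous_id.div_const 2).tendsto Real.pi).mono_left nhdsWithin_le_nhds
    · filter_upwards [self_mem_nhdsWithin] with θ hθ
      simp only [mem_Iio] at *
      linarith

lemma integral_inv_sub_gapPoint_of_gt {a b y : ℝ} (h : a < b) (hy : b < y) :
    ∫ θ in 0..Real.pi, (y - gapPoint a b θ)⁻¹ = Real.pi / √((y - a) * (y - b)) := by
  have := integral_inv_sub_mul_cos (Y := y - (a + b) / 2) (e := (b - a) / 2)
    (by rw [abs_of_pos] <;> linarith)
  rw [show (y - a) * (y - b) = (y - (a + b) / 2) ^ 2 - ((b - a) / 2) ^ 2 by ring, ← this]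
  simp only [gapPoint, sub_sub]

lemma integral_inv_sub_gapPoint_of_lt {a b y : ℝ} (h : a < b) (hy : y < a) :
    ∫ θ in 0..Real.pi, (y - gapPoint a b θ)⁻¹ = -(Real.pi / √((y - a) * (y - b))) := by
  have := integral_inv_sub_mul_cos (Y := (a + b) / 2 - y) (e := -((b - a) / 2))
    (by rw [abs_neg, abs_of_pos] <;> linarith)
  rw [show (y - a) * (y - b) = ((a + b) / 2 - y) ^ 2 - (-((b - a) / 2)) ^ 2 by ring, ← this,
    ← intervalIntegral.integral_neg]
  congr 1 with θ
  rw [← inv_neg]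
  congr 1
  simp only [gapPoint]
  ring

end NLSWhitham
end

noncomputable section

namespace NLSWhitham

/-! ### Averages over one point in each gap -/

open Polynomial in
lemma coeff_X_mul_prod_X_sub_C (n : ℕ) (v : Fin (n + 1) → ℝ) :
    (X * ∏ i, (X - C (v i))).coeff n = ((∑ i, v i) ^ 2 - ∑ i, v i ^ 2) / 2 := by
  induction n with
  | zero => simp
  | succ n ih =>
    have h1 : (X * ∏ i, (X - C (v i)) : ℝ[X]) =
        X * (X * ∏ i : Fin (n + 1), (X - C (v i.succ))) -
          C (v 0) * (X * ∏ i : Fin (n + 1), (X - C (v i.succ))) := by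
      rw [Fin.prod_univ_succ]; ring
    have h2 := prod_X_sub_C_coeff_card_pred (R := ℝ) (Finset.univ : Finset (Fin (n + 1)))
      (fun i => v i.succ) (by simp)
    simp only [Finset.card_univ, Fintype.card_fin, Nat.add_sub_cancel] at h2
    rw [h1, coeff_sub, coeff_X_mul, ih, coeff_C_mul, coeff_X_mul, h2, Fin.sum_univ_succ v,
      Fin.sum_univ_succ (fun i => v i ^ 2)]
    ring

open Polynomial in
lemma sum_eval_div_prod (g : ℕ) (v : Fin (g + 1) → ℝ) (hv : Function.Injective v) (F : ℝ[X])
    (hF : F.natDegree ≤ g + 2) :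
    ∑ i, F.eval (v i) * ∏ j : Fin g, (v i - v (i.succAbove j))⁻¹ =
      F.coeff g + F.coeff (g + 1) * ∑ i, v i +
        F.coeff (g + 2) * (((∑ i, v i) ^ 2 + ∑ i, v i ^ 2) / 2) := by
  set q : ℝ[X] := ∏ i, (X - C (v i)) with hq
  have hqd : q.natDegree = g + 1 := by simp [hq, natDegree_prod_of_monic, monic_X_sub_C]
  have hqm : q.Monic := monic_prod_of_monic _ _ fun i _ => monic_X_sub_C _
  have hq0 : q.coeff g = -∑ i, v i := by
    have := prod_X_sub_C_coeff_card_pred (R := ℝ) (Finset.univ : Finset (Fin (g + 1))) v (by simp)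
    simpa using this
  have hq1 : q.coeff (g + 1) = 1 := by rw [← hqd]; exact hqm
  have hq2 : q.coeff (g + 2) = 0 := coeff_eq_zero_of_natDegree_lt (by omega)
  set a := F.coeff (g + 2)
  set e := ∑ i, v i
  set b := F.coeff (g + 1) + a * e
  set G := F - (C a * (X * q) + C b * q) with hG
  have hGd : G.degree < (Finset.univ : Finset (Fin (g + 1))).card := by
    rw [degree_lt_iff_coeff_zero]
    intro m hm
    simp only [Finset.card_univ, Fintype.card_fin] at hm
    simp only [hG, coeff_sub, coeff_add, coeff_C_mul]
    obtain ⟨m, rfl⟩ : ∃ k, m = k + 1 := ⟨m - 1, by omega⟩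
    rw [coeff_X_mul]
    rcases Nat.lt_or_ge (g + 1) m with h | h
    · rw [coeff_eq_zero_of_natDegree_lt (p := F) (by omega),
        coeff_eq_zero_of_natDegree_lt (p := q) (by omega),
        coeff_eq_zero_of_natDegree_lt (p := q) (by omega)]
      ring
    · obtain rfl | rfl : m = g ∨ m = g + 1 := by omega
      · rw [hq0, hq1]; ring
      · rw [hq2, hq1]; ring
  have h1 := Lagrange.coeff_eq_sum (s := Finset.univ) (v := v) hv.injOn hGd
  simp only [Finset.card_univ, Fintype.card_fin, Nat.add_sub_cancel] at h1
  have h2 : ∀ i, G.eval (v i) / ∏ j ∈ Finset.univ.erase i, (v i - v j) =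
      F.eval (v i) * ∏ j : Fin g, (v i - v (i.succAbove j))⁻¹ := by
    intro i
    have hqi : q.eval (v i) = 0 := by
      rw [hq, eval_prod]
      exact Finset.prod_eq_zero (Finset.mem_univ i) (by simp)
    have : Finset.univ.erase i = Finset.univ.map i.succAboveEmb := by
      rw [Fin.univ_succAbove _ i]; simp
    rw [this, Finset.prod_map, Finset.prod_inv_distrib, div_eq_mul_inv]
    simp [hG, hqi]
  rw [Finset.sum_congr rfl fun i _ => (h2 i)] at h1
  rw [← h1, hG]
  simp only [coeff_sub, coeff_add, coeff_C_mul, hq0]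
  rw [hq, coeff_X_mul_prod_X_sub_C]
  ring

/-- The uniform distribution of the angle that parametrizes a gap. -/
def angleMeasure : MeasureTheory.Measure ℝ :=
  (ENNReal.ofReal Real.pi)⁻¹ • MeasureTheory.volume.restrict (Ioc 0 Real.pi)

instance : MeasureTheory.IsProbabilityMeasure angleMeasure := by
  constructor
  simp only [angleMeasure, MeasureTheory.Measure.smul_apply, MeasureTheory.Measure.restrict_apply,
    MeasurableSet.univ, univ_inter, Real.volume_Ioc, sub_zero, smul_eq_mul]
  exact ENNReal.inv_mul_cancel (by simp [Real.pi_pos]) ENNReal.ofReal_ne_top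

lemma integral_angleMeasure (f : ℝ → ℝ) :
    ∫ θ, f θ ∂angleMeasure = Real.pi⁻¹ * ∫ θ in 0..Real.pi, f θ := by
  rw [angleMeasure, MeasureTheory.integral_smul_measure,
    intervalIntegral.integral_of_le Real.pi_pos.le]
  simp [ENNReal.toReal_ofReal Real.pi_pos.le]

/-- Disjoint closed intervals `[lo j, hi j]` in increasing order. -/
structure IsGaps {N : ℕ} (lo hi : Fin N → ℝ) : Prop where
  lt : ∀ i, lo i < hi i
  sep : ∀ i j, i < j → hi i < lo j

/-- One point in each gap. -/
def gapPoints {N : ℕ} (lo hi : Fin N → ℝ) (θ : Fin N → ℝ) (i : Fin N) : ℝ :=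
  gapPoint (lo i) (hi i) (θ i)

lemma gapPoints_mem {N : ℕ} {lo hi : Fin N → ℝ} (h : IsGaps lo hi) (θ : Fin N → ℝ) (i : Fin N) :
    gapPoints lo hi θ i ∈ Icc (lo i) (hi i) := gapPoint_mem_Icc (h.lt i).le _

lemma continuous_gapPoints {N : ℕ} (lo hi : Fin N → ℝ) : Continuous (gapPoints lo hi) :=
  continuous_pi fun i => (continuous_gapPoint _ _).comp (continuous_apply i)

lemma integrable_comp_gapPoints {N : ℕ} {lo hi : Fin N → ℝ} (h : IsGaps lo hi)
    {G : (Fin N → ℝ) → ℝ} (hG : ContinuousOn G (univ.pi fun i => Icc (lo i) (hi i))) :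
    MeasureTheory.Integrable (fun θ => G (gapPoints lo hi θ))
      (MeasureTheory.Measure.pi fun _ => angleMeasure) := by
  have hmem : ∀ θ, gapPoints lo hi θ ∈ univ.pi fun i => Icc (lo i) (hi i) :=
    fun θ i _ => gapPoints_mem h θ i
  obtain ⟨C, hC⟩ := (isCompact_univ_pi fun i => isCompact_Icc
    (a := lo i) (b := hi i)).exists_bound_of_continuousOn hG
  exact MeasureTheory.Integrable.of_bound
    (hG.comp_continuous (continuous_gapPoints lo hi) hmem).aestronglyMeasurable C
    (Eventually.of_forall fun θ => hC _ (hmem θ))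

lemma integral_pi_eval {N : ℕ} (i : Fin N) {f : ℝ → ℝ} (hf : Continuous f) :
    ∫ θ, f (θ i) ∂(MeasureTheory.Measure.pi fun _ : Fin N => angleMeasure) =
      ∫ θ, f θ ∂angleMeasure := by
  have := MeasureTheory.measurePreserving_eval (fun _ : Fin N => angleMeasure) i
  have e := MeasureTheory.integral_map (μ := MeasureTheory.Measure.pi fun _ : Fin N => angleMeasure)
    (f := f) this.measurable.aemeasurable hf.aestronglyMeasurable
  rw [this.map_eq] at e
  exact e.symm

lemma integral_sum_gapPoints {N : ℕ} {lo hi : Fin N → ℝ} (h : IsGaps lo hi) :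
    ∫ θ, (∑ i, gapPoints lo hi θ i) ∂(MeasureTheory.Measure.pi fun _ => angleMeasure) =
      (∑ i, (lo i + hi i)) / 2 := by
  rw [MeasureTheory.integral_finsetSum, Finset.sum_div]
  · refine Finset.sum_congr rfl fun i _ => ?_
    rw [show (fun θ => gapPoints lo hi θ i) = fun θ => gapPoint (lo i) (hi i) (θ i) from rfl,
      integral_pi_eval i (continuous_gapPoint _ _), integral_angleMeasure, integral_gapPoint,
      inv_mul_cancel_left₀ Real.pi_ne_zero]
  · exact fun i _ => integrable_comp_gapPoints h (continuous_apply i).continuousOn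

lemma integral_sum_gapPoints_sq {N : ℕ} {lo hi : Fin N → ℝ} (h : IsGaps lo hi) :
    ∫ θ, (∑ i, gapPoints lo hi θ i ^ 2) ∂(MeasureTheory.Measure.pi fun _ => angleMeasure) =
      ∑ i, (((lo i + hi i) / 2) ^ 2 + ((hi i - lo i) / 2) ^ 2 / 2) := by
  rw [MeasureTheory.integral_finsetSum]
  · refine Finset.sum_congr rfl fun i _ => ?_
    rw [show (fun θ => gapPoints lo hi θ i ^ 2) = fun θ => gapPoint (lo i) (hi i) (θ i) ^ 2 from rfl,
      integral_pi_eval i (f := fun t => gapPoint (lo i) (hi i) t ^ 2)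
        ((continuous_gapPoint _ _).pow 2), integral_angleMeasure,
      integral_gapPoint_sq, inv_mul_cancel_left₀ Real.pi_ne_zero]
  · exact fun i _ => integrable_comp_gapPoints h (G := fun x => x i ^ 2)
      ((continuous_apply i).pow 2).continuousOn

open ProbabilityTheory in
lemma integral_sq_sum_gapPoints {N : ℕ} {lo hi : Fin N → ℝ} (h : IsGaps lo hi) :
    ∫ θ, (∑ i, gapPoints lo hi θ i) ^ 2 ∂(MeasureTheory.Measure.pi fun _ => angleMeasure) =
      ((∑ i, (lo i + hi i)) / 2) ^ 2 + ∑ i, ((hi i - lo i) / 2) ^ 2 / 2 := by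
  have hmem : ∀ i, MeasureTheory.MemLp (gapPoint (lo i) (hi i)) 2 angleMeasure := fun i =>
    MeasureTheory.MemLp.of_bound (continuous_gapPoint _ _).aestronglyMeasurable
      (max |lo i| |hi i|) (Eventually.of_forall fun θ =>
        abs_le_max_abs_abs (gapPoint_mem_Icc (h.lt i).le θ).1 (gapPoint_mem_Icc (h.lt i).le θ).2)
  have h1 := variance_sum_pi (μ := fun _ : Fin N => angleMeasure) hmem
  have hsum : (∑ i, fun ω : Fin N → ℝ => gapPoint (lo i) (hi i) (ω i)) =
      fun θ => ∑ i, gapPoints lo hi θ i := by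
    ext θ; simp [gapPoints]
  have hvar : ∀ i, Var[gapPoint (lo i) (hi i); angleMeasure] = ((hi i - lo i) / 2) ^ 2 / 2 := by
    intro i
    rw [variance_eq_sub (hmem i)]
    simp only [Pi.pow_apply]
    rw [integral_angleMeasure, integral_angleMeasure, integral_gapPoint, integral_gapPoint_sq,
      inv_mul_cancel_left₀ Real.pi_ne_zero, inv_mul_cancel_left₀ Real.pi_ne_zero]
    ring
  have hL : MeasureTheory.MemLp (fun θ => ∑ i, gapPoints lo hi θ i) 2
      (MeasureTheory.Measure.pi fun _ : Fin N => angleMeasure) := by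
    rw [MeasureTheory.memLp_two_iff_integrable_sq]
    · exact integrable_comp_gapPoints h (G := fun x => (∑ i, x i) ^ 2) (by fun_prop)
    · exact (integrable_comp_gapPoints h (G := fun x => (∑ i, x i))
        (by fun_prop)).aestronglyMeasurable
  rw [hsum, variance_eq_sub hL, integral_sum_gapPoints h, Finset.sum_congr rfl fun i _ => hvar i]
    at h1
  simp only [Pi.pow_apply] at h1
  linarith

/-- The other factors of the polynomial of the curve, in the gap number `i`. -/
def restProd {g : ℕ} (lo hi : Fin (g + 1) → ℝ) (i : Fin (g + 1)) (z : ℝ) : ℝ :=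
  ∏ j : Fin g, (z - lo (i.succAbove j)) * (z - hi (i.succAbove j))

/-- The period of a differential around the gap number `i`. -/
def gapPeriod {g : ℕ} (lo hi : Fin (g + 1) → ℝ) (i : Fin (g + 1)) (F : Polynomial ℝ) : ℝ :=
  ∫ θ in 0..Real.pi,
    F.eval (gapPoint (lo i) (hi i) θ) / √(restProd lo hi i (gapPoint (lo i) (hi i) θ))

lemma IsGaps.factor_pos {N : ℕ} {lo hi : Fin N → ℝ} (h : IsGaps lo hi) {i j : Fin N}
    (hij : j ≠ i) {z : ℝ} (hz : z ∈ Icc (lo i) (hi i)) : 0 < (z - lo j) * (z - hi j) := by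
  have := h.lt j
  rcases lt_or_gt_of_ne hij with h1 | h1
  · have := h.sep _ _ h1
    exact mul_pos (by linarith [hz.1]) (by linarith [hz.1])
  · have := h.sep _ _ h1
    exact mul_pos_of_neg_of_neg (by linarith [hz.2]) (by linarith [hz.2])

lemma IsGaps.restProd_pos {g : ℕ} {lo hi : Fin (g + 1) → ℝ} (h : IsGaps lo hi) (i : Fin (g + 1))
    {z : ℝ} (hz : z ∈ Icc (lo i) (hi i)) : 0 < restProd lo hi i z :=
  Finset.prod_pos fun j _ => h.factor_pos (Fin.succAbove_ne i j) hz

lemma IsGaps.integral_inv {N : ℕ} {lo hi : Fin N → ℝ} (h : IsGaps lo hi) {i j : Fin N}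
    (hij : j ≠ i) {z : ℝ} (hz : z ∈ Icc (lo i) (hi i)) :
    ∫ θ, (z - gapPoint (lo j) (hi j) θ)⁻¹ ∂angleMeasure =
      (if j < i then 1 else -1) * (√((z - lo j) * (z - hi j)))⁻¹ := by
  rw [integral_angleMeasure]
  rcases lt_or_gt_of_ne hij with h1 | h1
  · rw [integral_inv_sub_gapPoint_of_gt (h.lt j) (lt_of_lt_of_le (h.sep _ _ h1) hz.1), if_pos h1,
      div_eq_mul_inv, inv_mul_cancel_left₀ Real.pi_ne_zero, one_mul]
  · rw [integral_inv_sub_gapPoint_of_lt (h.lt j) (lt_of_le_of_lt hz.2 (h.sep _ _ h1)),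
      if_neg h1.not_gt, div_eq_mul_inv, mul_neg, inv_mul_cancel_left₀ Real.pi_ne_zero, neg_one_mul]

lemma IsGaps.integral_lagrange {g : ℕ} {lo hi : Fin (g + 1) → ℝ} (h : IsGaps lo hi)
    (i : Fin (g + 1)) (F : Polynomial ℝ) :
    ∫ θ, F.eval (gapPoints lo hi θ i) *
      ∏ j : Fin g, (gapPoints lo hi θ i - gapPoints lo hi θ (i.succAbove j))⁻¹
      ∂(MeasureTheory.Measure.pi fun _ => angleMeasure) =
    (∏ j : Fin g, if i.succAbove j < i then (1 : ℝ) else -1) * (Real.pi⁻¹ * gapPeriod lo hi i F) := by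
  have hint : MeasureTheory.Integrable (fun θ => F.eval (gapPoints lo hi θ i) *
      ∏ j : Fin g, (gapPoints lo hi θ i - gapPoints lo hi θ (i.succAbove j))⁻¹)
      (MeasureTheory.Measure.pi fun _ => angleMeasure) := by
    refine integrable_comp_gapPoints h (G := fun x => F.eval (x i) *
      ∏ j : Fin g, (x i - x (i.succAbove j))⁻¹) ?_
    refine ContinuousOn.mul (F.continuous.comp (continuous_apply i)).continuousOn
      (continuousOn_finsetProd _ fun j _ => ContinuousOn.inv₀ (by fun_prop) fun x hx h0 => ?_)
    have h1 := hx i (mem_univ _)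
    have h2 := hx (i.succAbove j) (mem_univ _)
    have := h.factor_pos (Fin.succAbove_ne i j) h1
    rw [sub_eq_zero] at h0
    rw [h0] at this
    nlinarith [h2.1, h2.2, mul_nonneg (sub_nonneg.2 h2.1) (sub_nonneg.2 h2.2)]
  have hmp := (MeasureTheory.measurePreserving_piFinSuccAbove
    (fun _ : Fin (g + 1) => angleMeasure) i).symm
  rw [← hmp.integral_comp', MeasureTheory.integral_prod]
  · rw [gapPeriod, ← integral_angleMeasure, ← MeasureTheory.integral_const_mul]
    congr 1 with t
    simp only [MeasurableEquiv.piFinSuccAbove_symm_apply, Fin.insertNthEquiv, Equiv.coe_fn_mk,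
      gapPoints, Fin.insertNth_apply_same, Fin.insertNth_apply_succAbove]
    rw [MeasureTheory.integral_const_mul]
    have hz := gapPoint_mem_Icc (h.lt i).le t
    rw [MeasureTheory.integral_fin_nat_prod_eq_prod (μ := fun _ => angleMeasure) (𝕜 := ℝ)
      (fun j s => (gapPoint (lo i) (hi i) t -
        gapPoint (lo (i.succAbove j)) (hi (i.succAbove j)) s)⁻¹),
      Finset.prod_congr rfl fun j _ => h.integral_inv (Fin.succAbove_ne i j) hz,
      Finset.prod_mul_distrib, restProd, Real.sqrt_prod _ fun j _ =>
        (h.factor_pos (Fin.succAbove_ne i j) hz).le, Finset.prod_inv_distrib, div_eq_mul_inv]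
    ring
  · exact (hmp.integrable_comp_emb (MeasurableEquiv.measurableEmbedding _)).2 hint

lemma IsGaps.injective {N : ℕ} {lo hi v : Fin N → ℝ} (h : IsGaps lo hi)
    (hv : ∀ i, v i ∈ Icc (lo i) (hi i)) : Function.Injective v := by
  have : StrictMono v := fun i j hij =>
    ((hv i).2.trans_lt (h.sep i j hij)).trans_le (hv j).1
  exact this.injective

/-- The sum of the branch points. -/
def endSum {N : ℕ} (lo hi : Fin N → ℝ) : ℝ := ∑ i, (lo i + hi i)

/-- The sum of the squares of the branch points. -/
def endSqSum {N : ℕ} (lo hi : Fin N → ℝ) : ℝ := ∑ i, (lo i ^ 2 + hi i ^ 2)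

/-- The weighted sum of all periods is a residue at infinity. -/
theorem IsGaps.sum_gapPeriod {g : ℕ} {lo hi : Fin (g + 1) → ℝ} (h : IsGaps lo hi)
    (F : Polynomial ℝ) (hF : F.natDegree ≤ g + 2) :
    ∑ i, (∏ j : Fin g, if i.succAbove j < i then (1 : ℝ) else -1) *
        (Real.pi⁻¹ * gapPeriod lo hi i F) =
      F.coeff g + F.coeff (g + 1) * (endSum lo hi / 2) +
        F.coeff (g + 2) * (endSum lo hi ^ 2 / 8 + endSqSum lo hi / 4) := by
  simp_rw [← h.integral_lagrange]
  rw [← MeasureTheory.integral_finsetSum]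
  · rw [MeasureTheory.integral_congr_ae (Eventually.of_forall fun θ =>
      sum_eval_div_prod g (gapPoints lo hi θ) (h.injective (gapPoints_mem h θ)) F hF)]
    have i1 : MeasureTheory.Integrable (fun θ => ∑ i, gapPoints lo hi θ i)
        (MeasureTheory.Measure.pi fun _ => angleMeasure) :=
      integrable_comp_gapPoints h (G := fun x => ∑ i, x i) (by fun_prop)
    have i2 : MeasureTheory.Integrable (fun θ => (∑ i, gapPoints lo hi θ i) ^ 2)
        (MeasureTheory.Measure.pi fun _ => angleMeasure) :=
      integrable_comp_gapPoints h (G := fun x => (∑ i, x i) ^ 2) (by fun_prop)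
    have i3 : MeasureTheory.Integrable (fun θ => ∑ i, gapPoints lo hi θ i ^ 2)
        (MeasureTheory.Measure.pi fun _ => angleMeasure) :=
      integrable_comp_gapPoints h (G := fun x => ∑ i, x i ^ 2) (by fun_prop)
    have j1 : MeasureTheory.Integrable (fun θ => F.coeff g + F.coeff (g + 1) *
        ∑ i, gapPoints lo hi θ i) (MeasureTheory.Measure.pi fun _ => angleMeasure) :=
      (MeasureTheory.integrable_const _).add (i1.const_mul _)
    have j2 : MeasureTheory.Integrable (fun θ => F.coeff (g + 2) *
        (((∑ i, gapPoints lo hi θ i) ^ 2 + ∑ i, gapPoints lo hi θ i ^ 2) / 2))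
        (MeasureTheory.Measure.pi fun _ => angleMeasure) :=
      ((i2.add i3).div_const 2).const_mul _
    rw [MeasureTheory.integral_add j1 j2, MeasureTheory.integral_add
      (MeasureTheory.integrable_const _) (i1.const_mul _), MeasureTheory.integral_const_mul,
      MeasureTheory.integral_const_mul, MeasureTheory.integral_div,
      MeasureTheory.integral_add i2 i3, integral_sum_gapPoints h, integral_sq_sum_gapPoints h,
      integral_sum_gapPoints_sq h]
    have : ∑ i, ((hi i - lo i) / 2) ^ 2 / 2 +
        ∑ i, (((lo i + hi i) / 2) ^ 2 + ((hi i - lo i) / 2) ^ 2 / 2) = endSqSum lo hi / 2 := by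
      rw [← Finset.sum_add_distrib, endSqSum, Finset.sum_div]
      exact Finset.sum_congr rfl fun i _ => by ring
    rw [add_assoc (((∑ i, (lo i + hi i)) / 2) ^ 2), this]
    rw [MeasureTheory.integral_const, MeasureTheory.probReal_univ, one_smul, endSum]
    ring
  · intro i _
    refine integrable_comp_gapPoints h (G := fun x => F.eval (x i) *
      ∏ j : Fin g, (x i - x (i.succAbove j))⁻¹) ?_
    refine ContinuousOn.mul (F.continuous.comp (continuous_apply i)).continuousOn
      (continuousOn_finsetProd _ fun j _ => ContinuousOn.inv₀ (by fun_prop) fun x hx h0 => ?_)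
    have h1 := hx i (mem_univ _)
    have h2 := hx (i.succAbove j) (mem_univ _)
    have := h.factor_pos (Fin.succAbove_ne i j) h1
    rw [sub_eq_zero] at h0
    rw [h0] at this
    nlinarith [h2.1, h2.2, mul_nonneg (sub_nonneg.2 h2.1) (sub_nonneg.2 h2.2)]

end NLSWhitham
end

noncomputable section

namespace NLSWhitham

/-! ### Polynomials with vanishing periods -/

lemma exists_zero_of_integral_gapPoint {a b : ℝ} (h : a < b) {f : ℝ → ℝ}
    (hf : ContinuousOn f (Icc a b)) (h0 : ∫ θ in 0..Real.pi, f (gapPoint a b θ) = 0) :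
    ∃ z ∈ Ioo a b, f z = 0 := by
  have hc : Continuous fun θ => f (gapPoint a b θ) :=
    hf.comp_continuous (continuous_gapPoint a b) (gapPoint_mem_Icc h.le)
  obtain ⟨θ, hθ, h1⟩ := exists_deriv_eq_zero (f := fun t => ∫ θ in 0..t, f (gapPoint a b θ))
    Real.pi_pos (continuous_iff_continuousAt.2 fun t =>
      (hc.integral_hasStrictDerivAt 0 t).hasDerivAt.continuousAt).continuousOn (by simpa using h0.symm)
  rw [(hc.integral_hasStrictDerivAt 0 θ).hasDerivAt.deriv] at h1
  exact ⟨_, gapPoint_image h ▸ mem_image_of_mem _ hθ, h1⟩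

variable {g : ℕ} {lo hi : Fin (g + 1) → ℝ}

lemma continuous_restProd (i : Fin (g + 1)) : Continuous (restProd lo hi i) := by
  unfold restProd; fun_prop

lemma IsGaps.continuousOn_div_sqrt (h : IsGaps lo hi) (i : Fin (g + 1)) {f : ℝ → ℝ}
    (hf : ContinuousOn f (Icc (lo i) (hi i))) :
    ContinuousOn (fun z => f z / √(restProd lo hi i z)) (Icc (lo i) (hi i)) :=
  hf.div (continuous_restProd i).sqrt.continuousOn fun _ hz =>
    (Real.sqrt_pos.2 (h.restProd_pos i hz)).ne'

lemma IsGaps.continuous_period (h : IsGaps lo hi) (i : Fin (g + 1)) (F : Polynomial ℝ) :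
    Continuous fun θ => F.eval (gapPoint (lo i) (hi i) θ) /
      √(restProd lo hi i (gapPoint (lo i) (hi i) θ)) :=
  (h.continuousOn_div_sqrt i F.continuous.continuousOn).comp_continuous (continuous_gapPoint _ _)
    (gapPoint_mem_Icc (h.lt i).le)

lemma IsGaps.gapPeriod_add (h : IsGaps lo hi) (i : Fin (g + 1)) (F G : Polynomial ℝ) :
    gapPeriod lo hi i (F + G) = gapPeriod lo hi i F + gapPeriod lo hi i G := by
  rw [gapPeriod, gapPeriod, gapPeriod, ← intervalIntegral.integral_add
    ((h.continuous_period i F).intervalIntegrable _ _)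
    ((h.continuous_period i G).intervalIntegrable _ _)]
  simp only [Polynomial.eval_add, add_div]

lemma gapPeriod_C_mul (i : Fin (g + 1)) (c : ℝ) (F : Polynomial ℝ) :
    gapPeriod lo hi i (Polynomial.C c * F) = c * gapPeriod lo hi i F := by
  rw [gapPeriod, gapPeriod, ← intervalIntegral.integral_const_mul]
  simp only [Polynomial.eval_mul, Polynomial.eval_C, mul_div_assoc]

lemma gapPeriod_smul (i : Fin (g + 1)) (c : ℝ) (F : Polynomial ℝ) :
    gapPeriod lo hi i (c • F) = c * gapPeriod lo hi i F := by
  rw [Polynomial.smul_eq_C_mul, gapPeriod_C_mul]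

lemma IsGaps.gapPeriod_sub (h : IsGaps lo hi) (i : Fin (g + 1)) (F G : Polynomial ℝ) :
    gapPeriod lo hi i (F - G) = gapPeriod lo hi i F - gapPeriod lo hi i G := by
  have := h.gapPeriod_add i (F - G) G
  rw [sub_add_cancel] at this
  linarith

lemma IsGaps.exists_root (h : IsGaps lo hi) {i : Fin (g + 1)} {F : Polynomial ℝ}
    (hF : gapPeriod lo hi i F = 0) : ∃ z ∈ Ioo (lo i) (hi i), F.eval z = 0 := by
  obtain ⟨z, hz, h0⟩ := exists_zero_of_integral_gapPoint (h.lt i)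
    (h.continuousOn_div_sqrt i F.continuous.continuousOn) hF
  refine ⟨z, hz, (div_eq_zero_iff.1 h0).resolve_right ?_⟩
  exact (Real.sqrt_pos.2 (h.restProd_pos i (Ioo_subset_Icc_self hz))).ne'

/-- The residue that has to vanish for all periods to vanish. -/
def residue (lo hi : Fin (g + 1) → ℝ) (F : Polynomial ℝ) : ℝ :=
  F.coeff g + F.coeff (g + 1) * (endSum lo hi / 2) +
    F.coeff (g + 2) * (endSum lo hi ^ 2 / 8 + endSqSum lo hi / 4)

/-- The vanishing of all periods but one implies the vanishing of the last one. -/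
lemma IsGaps.gapPeriod_eq_zero (h : IsGaps lo hi) {F : Polynomial ℝ} (hF : F.natDegree ≤ g + 2)
    (hr : residue lo hi F = 0) (hp : ∀ j : Fin g, gapPeriod lo hi j.succ F = 0) (i : Fin (g + 1)) :
    gapPeriod lo hi i F = 0 := by
  refine Fin.cases ?_ hp i
  have := h.sum_gapPeriod F hF
  rw [← residue, hr, Fin.sum_univ_succ] at this
  simp only [hp, mul_zero, Finset.sum_const_zero, add_zero, mul_eq_zero] at this
  rcases this with h1 | h1 | h1
  · rw [Finset.prod_eq_zero_iff] at h1
    obtain ⟨j, _, hj⟩ := h1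
    split_ifs at hj <;> norm_num at hj
  · exact absurd h1 (inv_ne_zero Real.pi_ne_zero)
  · exact h1

open Polynomial in
lemma exists_eq_mul_prod_of_roots {n k : ℕ} {F : ℝ[X]} (hm : F.Monic) (hd : F.natDegree = n + k)
    {v : Fin n → ℝ} (hv : Function.Injective v) (h0 : ∀ i, F.eval (v i) = 0) :
    ∃ q : ℝ[X], q.Monic ∧ q.natDegree = k ∧ F = q * ∏ i, (X - C (v i)) := by
  have h1 : ∏ i, (X - C (v i)) ∣ F := Finset.prod_dvd_of_coprime
    ((pairwise_coprime_X_sub_C hv).set_pairwise _) fun i _ => dvd_iff_isRoot.2 (h0 i)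
  obtain ⟨q, rfl⟩ := h1
  have hpm : (∏ i, (X - C (v i))).Monic := monic_prod_of_monic _ _ fun i _ => monic_X_sub_C _
  have hq : q.Monic := hpm.of_mul_monic_left hm
  refine ⟨q, hq, ?_, mul_comm _ _⟩
  rw [hpm.natDegree_mul hq] at hd
  simp [natDegree_prod_of_monic, monic_X_sub_C] at hd
  omega

/-- The normalized quasi-momentum numerator. -/
structure IsMomPoly (lo hi : Fin (g + 1) → ℝ) (P : Polynomial ℝ) : Prop where
  monic : P.Monic
  natDegree : P.natDegree = g + 1
  coeff_one : P.coeff g = -(endSum lo hi / 2)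
  period : ∀ i, gapPeriod lo hi i P = 0

/-- The polynomial `Q - s * P`. -/
structure IsSpeedPoly (lo hi : Fin (g + 1) → ℝ) (s : ℝ) (F : Polynomial ℝ) : Prop where
  monic : F.Monic
  natDegree : F.natDegree = g + 2
  coeff_one : F.coeff (g + 1) = -(endSum lo hi / 2 + s)
  coeff_two : F.coeff g = endSum lo hi ^ 2 / 8 - endSqSum lo hi / 4 + s * (endSum lo hi / 2)
  period : ∀ i, gapPeriod lo hi i F = 0

/-- The characteristic speed at the branch point `y`. -/
def GapSpeed (lo hi : Fin (g + 1) → ℝ) (y s : ℝ) : Prop :=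
  ∃ F, IsSpeedPoly lo hi s F ∧ F.eval y = 0

lemma IsGaps.injective_Ioo (h : IsGaps lo hi) {v : Fin (g + 1) → ℝ}
    (hv : ∀ i, v i ∈ Ioo (lo i) (hi i)) : Function.Injective v :=
  h.injective fun i => Ioo_subset_Icc_self (hv i)

open Polynomial in
lemma IsMomPoly.exists_roots (h : IsGaps lo hi) {P : ℝ[X]} (hP : IsMomPoly lo hi P) :
    ∃ ρ : Fin (g + 1) → ℝ, (∀ i, ρ i ∈ Ioo (lo i) (hi i)) ∧ P = ∏ i, (X - C (ρ i)) := by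
  choose ρ hρ h0 using fun i => h.exists_root (hP.period i)
  obtain ⟨q, hq, hqd, e⟩ := exists_eq_mul_prod_of_roots (k := 0) hP.monic hP.natDegree
    (h.injective_Ioo hρ) h0
  rw [hq.natDegree_eq_zero.1 hqd, one_mul] at e
  exact ⟨ρ, hρ, e⟩

/-- The roots of `Q - s * P`: one in each gap and another one. -/
lemma IsSpeedPoly.exists_roots (h : IsGaps lo hi) {F : Polynomial ℝ} {s : ℝ}
    (hF : IsSpeedPoly lo hi s F) :
    ∃ (ζ : Fin (g + 1) → ℝ) (y : ℝ), (∀ i, ζ i ∈ Ioo (lo i) (hi i)) ∧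
      (∀ z, F.eval z = (z - y) * ∏ i, (z - ζ i)) ∧ y + ∑ i, ζ i = endSum lo hi / 2 + s ∧
      y ^ 2 + ∑ i, ζ i ^ 2 = s ^ 2 + endSqSum lo hi / 2 := by
  choose ζ hζ h0 using fun i => h.exists_root (hF.period i)
  obtain ⟨q, hq, hqd, e⟩ := exists_eq_mul_prod_of_roots (n := g + 1) (k := 1) hF.monic
    (by rw [hF.natDegree]) (h.injective_Ioo hζ) h0
  obtain ⟨y, rfl⟩ : ∃ y, q = Polynomial.X - Polynomial.C y := by
    refine ⟨-q.coeff 0, ?_⟩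
    rw [hq.eq_X_add_C hqd]
    simp
  set v : Fin (g + 2) → ℝ := Fin.cons y ζ with hv
  have e2 : F = ∏ i, (Polynomial.X - Polynomial.C (v i)) := by
    rw [Fin.prod_univ_succ]; simpa [hv] using e
  have c1 := Polynomial.prod_X_sub_C_coeff_card_pred (R := ℝ)
    (Finset.univ : Finset (Fin (g + 2))) v (by simp)
  simp only [Finset.card_univ, Fintype.card_fin] at c1
  have c2 := coeff_X_mul_prod_X_sub_C (g + 1) v
  rw [← e2, Polynomial.coeff_X_mul, hF.coeff_two] at c2
  rw [← e2, show g + 2 - 1 = g + 1 from rfl, hF.coeff_one] at c1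
  simp only [hv, Fin.sum_univ_succ, Fin.cons_zero, Fin.cons_succ] at c1 c2
  simp only [← Fin.sum_univ_succ] at c1 c2
  have c3 : y + ∑ i, ζ i = endSum lo hi / 2 + s := by linarith
  refine ⟨ζ, y, hζ, fun z => ?_, c3, ?_⟩
  · rw [e]; simp [Polynomial.eval_prod]
  · rw [c3] at c2
    rw [Fin.sum_univ_succ (fun i => ζ i ^ 2)]
    linarith

lemma IsGaps.eq_zero_of_periods (h : IsGaps lo hi) {F : Polynomial ℝ} (hF : F.natDegree ≤ g)
    (hp : ∀ i, gapPeriod lo hi i F = 0) : F = 0 := by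
  choose v hv h0 using fun i => h.exists_root (hp i)
  exact Polynomial.eq_zero_of_natDegree_lt_card_of_eval_eq_zero F (h.injective_Ioo hv) h0
    (by simpa using Nat.lt_succ_of_le hF)

lemma IsSpeedPoly.unique (h : IsGaps lo hi) {F G : Polynomial ℝ} {s : ℝ}
    (hF : IsSpeedPoly lo hi s F) (hG : IsSpeedPoly lo hi s G) : F = G := by
  rw [← sub_eq_zero]
  refine h.eq_zero_of_periods ?_ fun i => by rw [h.gapPeriod_sub, hF.period, hG.period, sub_zero]
  rw [Polynomial.natDegree_le_iff_coeff_eq_zero]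
  intro m hm
  rw [Polynomial.coeff_sub, sub_eq_zero]
  have hF2 := hF.monic.coeff_natDegree
  have hG2 := hG.monic.coeff_natDegree
  rw [hF.natDegree] at hF2
  rw [hG.natDegree] at hG2
  rcases Nat.lt_or_ge (g + 2) m with h1 | h1
  · rw [Polynomial.coeff_eq_zero_of_natDegree_lt (by rw [hF.natDegree]; exact h1),
      Polynomial.coeff_eq_zero_of_natDegree_lt (by rw [hG.natDegree]; exact h1)]
  · obtain rfl | rfl : m = g + 1 ∨ m = g + 2 := by omega
    · rw [hF.coeff_one, hG.coeff_one]
    · rw [hF2, hG2]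

lemma IsMomPoly.coeff_top {P : Polynomial ℝ} (hP : IsMomPoly lo hi P) : P.coeff (g + 1) = 1 := by
  have := hP.monic.coeff_natDegree
  rwa [hP.natDegree] at this

lemma IsSpeedPoly.coeff_top {F : Polynomial ℝ} {s : ℝ} (hF : IsSpeedPoly lo hi s F) :
    F.coeff (g + 2) = 1 := by
  have := hF.monic.coeff_natDegree
  rwa [hF.natDegree] at this

lemma IsSpeedPoly.change (h : IsGaps lo hi) {F P : Polynomial ℝ} {s : ℝ}
    (hF : IsSpeedPoly lo hi s F) (hP : IsMomPoly lo hi P) (s' : ℝ) :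
    IsSpeedPoly lo hi s' (F + Polynomial.C (s - s') * P) := by
  have hd : (Polynomial.C (s - s') * P).natDegree < F.natDegree := by
    refine (Polynomial.natDegree_C_mul_le _ _).trans_lt ?_
    rw [hP.natDegree, hF.natDegree]; omega
  refine ⟨?_, ?_, ?_, ?_, fun i => ?_⟩
  · exact hF.monic.add_of_left (Polynomial.degree_lt_degree hd)
  · rw [Polynomial.natDegree_add_eq_left_of_natDegree_lt hd, hF.natDegree]
  · rw [Polynomial.coeff_add, Polynomial.coeff_C_mul, hF.coeff_one, hP.coeff_top]; ring
  · rw [Polynomial.coeff_add, Polynomial.coeff_C_mul, hF.coeff_two, hP.coeff_one]; ring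
  · rw [h.gapPeriod_add, gapPeriod_C_mul, hF.period, hP.period]; simp

/-- Corrections of lower degree that make the periods vanish. -/
lemma IsGaps.exists_correction (h : IsGaps lo hi) (F : Polynomial ℝ) :
    ∃ p : Polynomial ℝ, p.degree < g ∧ ∀ j : Fin g, gapPeriod lo hi j.succ (F + p) = 0 := by
  let L : Polynomial.degreeLT ℝ g →ₗ[ℝ] (Fin g → ℝ) :=
    { toFun := fun p j => gapPeriod lo hi j.succ (p : Polynomial ℝ)
      map_add' := fun p q => funext fun j => h.gapPeriod_add j.succ p q
      map_smul' := fun c p => funext fun j => gapPeriod_smul j.succ c p }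
  have hinj : Function.Injective L := by
    rw [injective_iff_map_eq_zero]
    intro p hp
    have h1 : ∀ j : Fin g, gapPeriod lo hi j.succ (p : Polynomial ℝ) = 0 := fun j => congrFun hp j
    choose v hv h0 using fun j => h.exists_root (h1 j)
    have hdeg := Polynomial.mem_degreeLT.1 p.2
    have hvi : Function.Injective v := by
      have : StrictMono v := fun i j hij => ((hv i).2.trans
        (h.sep i.succ j.succ (Fin.succ_lt_succ_iff.2 hij))).trans (hv j).1
      exact this.injective
    refine Subtype.ext ?_
    by_contra hne
    have h2 : (p : Polynomial ℝ).natDegree < g := (Polynomial.natDegree_lt_iff_degree_lt hne).2 hdeg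
    exact hne (Polynomial.eq_zero_of_natDegree_lt_card_of_eval_eq_zero _ hvi h0 (by simpa using h2))
  have hfin : Module.finrank ℝ (Polynomial.degreeLT ℝ g) = Module.finrank ℝ (Fin g → ℝ) :=
    (Polynomial.degreeLTEquiv ℝ g).finrank_eq
  have : FiniteDimensional ℝ (Polynomial.degreeLT ℝ g) :=
    Module.Finite.equiv (Polynomial.degreeLTEquiv ℝ g).symm
  obtain ⟨p, hp⟩ := (LinearMap.injective_iff_surjective_of_finrank_eq_finrank hfin).1 hinj
    fun j => -gapPeriod lo hi j.succ F
  refine ⟨p, Polynomial.mem_degreeLT.1 p.2, fun j => ?_⟩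
  have : gapPeriod lo hi j.succ (p : Polynomial ℝ) = -gapPeriod lo hi j.succ F := congrFun hp j
  rw [h.gapPeriod_add, this, add_neg_cancel]

open Polynomial in
lemma IsGaps.exists_isMomPoly (h : IsGaps lo hi) : ∃ P, IsMomPoly lo hi P := by
  set F : ℝ[X] := X ^ (g + 1) + C (-(endSum lo hi / 2)) * X ^ g with hF
  obtain ⟨p, hpd, hp⟩ := h.exists_correction F
  have hpc : ∀ m, g ≤ m → p.coeff m = 0 := fun m hm =>
    coeff_eq_zero_of_degree_lt (hpd.trans_le (by exact_mod_cast hm))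
  have hc : ∀ m, g ≤ m → (F + p).coeff m =
      (if m = g + 1 then 1 else 0) + (if m = g then -(endSum lo hi / 2) else 0) := fun m hm => by
    rw [coeff_add, hpc m hm, hF, coeff_add, coeff_X_pow, coeff_C_mul, coeff_X_pow]
    simp
  have hd : (F + p).natDegree ≤ g + 1 := natDegree_le_iff_coeff_eq_zero.2 fun m hm => by
    rw [hc m (by omega), if_neg (by omega), if_neg (by omega), add_zero]
  have hc1 : (F + p).coeff (g + 1) = 1 := by rw [hc _ (by omega)]; simp
  have hc0 : (F + p).coeff g = -(endSum lo hi / 2) := by rw [hc _ le_rfl]; simp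
  refine ⟨F + p, monic_of_natDegree_le_of_coeff_eq_one _ hd hc1,
    natDegree_eq_of_le_of_coeff_ne_zero hd (by rw [hc1]; exact one_ne_zero), hc0,
    h.gapPeriod_eq_zero (by omega) ?_ hp⟩
  rw [residue, hc0, hc1, coeff_eq_zero_of_natDegree_lt (by omega)]
  ring

open Polynomial in
lemma IsGaps.exists_isSpeedPoly (h : IsGaps lo hi) (s : ℝ) : ∃ F, IsSpeedPoly lo hi s F := by
  set a := -(endSum lo hi / 2 + s) with ha
  set b := endSum lo hi ^ 2 / 8 - endSqSum lo hi / 4 + s * (endSum lo hi / 2) with hb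
  set F : ℝ[X] := X ^ (g + 2) + C a * X ^ (g + 1) + C b * X ^ g with hF
  obtain ⟨p, hpd, hp⟩ := h.exists_correction F
  have hpc : ∀ m, g ≤ m → p.coeff m = 0 := fun m hm =>
    coeff_eq_zero_of_degree_lt (hpd.trans_le (by exact_mod_cast hm))
  have hc : ∀ m, g ≤ m → (F + p).coeff m =
      (if m = g + 2 then 1 else 0) + (if m = g + 1 then a else 0) + (if m = g then b else 0) :=
    fun m hm => by
      rw [coeff_add, hpc m hm, hF, coeff_add, coeff_add, coeff_X_pow, coeff_C_mul, coeff_X_pow,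
        coeff_C_mul, coeff_X_pow]
      simp
  have hd : (F + p).natDegree ≤ g + 2 := natDegree_le_iff_coeff_eq_zero.2 fun m hm => by
    rw [hc m (by omega), if_neg (by omega), if_neg (by omega), if_neg (by omega)]; ring
  have hc2 : (F + p).coeff (g + 2) = 1 := by rw [hc _ (by omega)]; simp
  have hc1 : (F + p).coeff (g + 1) = a := by rw [hc _ (by omega)]; simp
  have hc0 : (F + p).coeff g = b := by rw [hc _ le_rfl]; simp
  refine ⟨F + p, monic_of_natDegree_le_of_coeff_eq_one _ hd hc2,
    natDegree_eq_of_le_of_coeff_ne_zero hd (by rw [hc2]; exact one_ne_zero), hc1, hc0,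
    h.gapPeriod_eq_zero hd ?_ hp⟩
  rw [residue, hc0, hc1, hc2, ha, hb]
  ring

lemma IsGaps.not_mem_Ioo (h : IsGaps lo hi) {y : ℝ} (hy : ∃ j, y = lo j ∨ y = hi j)
    (i : Fin (g + 1)) : y ∉ Ioo (lo i) (hi i) := by
  obtain ⟨j, hj⟩ := hy
  intro hm
  have := h.lt j
  rcases lt_trichotomy i j with h1 | rfl | h1
  · have := h.sep _ _ h1
    rcases hj with rfl | rfl <;> linarith [hm.1, hm.2]
  · rcases hj with rfl | rfl <;> linarith [hm.1, hm.2]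
  · have := h.sep _ _ h1
    rcases hj with rfl | rfl <;> linarith [hm.1, hm.2]

/-- The basic description of a speed by the roots of `Q - s * P`. -/
lemma IsSpeedPoly.exists_roots_of_eval (h : IsGaps lo hi) {F : Polynomial ℝ} {s y : ℝ}
    (hF : IsSpeedPoly lo hi s F) (h0 : F.eval y = 0) (hy : ∀ i, y ∉ Ioo (lo i) (hi i)) :
    ∃ ζ : Fin (g + 1) → ℝ, (∀ i, ζ i ∈ Ioo (lo i) (hi i)) ∧
      (∀ z, F.eval z = (z - y) * ∏ i, (z - ζ i)) ∧ y + ∑ i, ζ i = endSum lo hi / 2 + s ∧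
      y ^ 2 + ∑ i, ζ i ^ 2 = s ^ 2 + endSqSum lo hi / 2 := by
  obtain ⟨ζ, y', hζ, he, h1, h2⟩ := hF.exists_roots h
  have : y = y' := by
    rw [he, mul_eq_zero, Finset.prod_eq_zero_iff] at h0
    rcases h0 with h0 | ⟨i, _, hi⟩
    · linarith
    · exact absurd (hζ i) (by rw [← sub_eq_zero.1 hi]; exact hy i)
  subst this
  exact ⟨ζ, hζ, he, h1, h2⟩

lemma IsMomPoly.eval_ne_zero (h : IsGaps lo hi) {P : Polynomial ℝ} (hP : IsMomPoly lo hi P)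
    {y : ℝ} (hy : ∀ i, y ∉ Ioo (lo i) (hi i)) : P.eval y ≠ 0 := by
  obtain ⟨ρ, hρ, rfl⟩ := hP.exists_roots h
  rw [Polynomial.eval_prod, Finset.prod_ne_zero_iff]
  intro i _ h0
  simp only [Polynomial.eval_sub, Polynomial.eval_X, Polynomial.eval_C] at h0
  exact hy i (by rw [sub_eq_zero.1 h0]; exact hρ i)

lemma IsGaps.exists_gapSpeed (h : IsGaps lo hi) {y : ℝ} (hy : ∀ i, y ∉ Ioo (lo i) (hi i)) :
    ∃ s, GapSpeed lo hi y s := by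
  obtain ⟨P, hP⟩ := h.exists_isMomPoly
  obtain ⟨F, hF⟩ := h.exists_isSpeedPoly 0
  refine ⟨F.eval y / P.eval y, _, hF.change h hP _, ?_⟩
  have := hP.eval_ne_zero h hy
  simp only [Polynomial.eval_add, Polynomial.eval_mul, Polynomial.eval_C]
  field_simp
  ring

end NLSWhitham
end

noncomputable section

namespace NLSWhitham

/-! ### Branch points as ends of gaps -/

@[to_additive]
lemma prod_fin_two_mul {M : Type*} [CommMonoid M] (n : ℕ) (f : Fin (2 * n) → M) :
    ∏ k, f k = ∏ j : Fin n, f ⟨2 * j, by omega⟩ * f ⟨2 * j + 1, by omega⟩ := by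
  induction n with
  | zero => rfl
  | succ n ih =>
    have h1 : ∏ k, f k = ∏ k : Fin (2 * n + 1 + 1), f k := rfl
    rw [h1, Fin.prod_univ_castSucc, Fin.prod_univ_castSucc, Fin.prod_univ_castSucc, ← mul_assoc]
    congr 1
    congr 1
    exact ih fun k => f ⟨k, by omega⟩

variable {g : ℕ}

/-- The left ends of the gaps. -/
def gapLo (b : Fin (2 * g + 2) → ℝ) (j : Fin (g + 1)) : ℝ := b ⟨2 * j, by omega⟩

/-- The right ends of the gaps. -/
def gapHi (b : Fin (2 * g + 2) → ℝ) (j : Fin (g + 1)) : ℝ := b ⟨2 * j + 1, by omega⟩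

lemma isGaps_of_strictMono {b : Fin (2 * g + 2) → ℝ} (hb : StrictMono b) :
    IsGaps (gapLo b) (gapHi b) where
  lt i := hb (by simp [Fin.lt_def])
  sep i j hij := hb (by rw [Fin.lt_def] at *; simp only; omega)

lemma exists_eq_gapLo_or_gapHi (b : Fin (2 * g + 2) → ℝ) (k : Fin (2 * g + 2)) :
    ∃ j, b k = gapLo b j ∨ b k = gapHi b j := by
  refine ⟨⟨k / 2, by omega⟩, ?_⟩
  rcases Nat.mod_two_eq_zero_or_one k with h | h
  · left; unfold gapLo; congr 1; ext; simp only; omega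
  · right; unfold gapHi; congr 1; ext; simp only; omega

lemma sigmaOne_eq_endSum (b : Fin (2 * g + 2) → ℝ) :
    sigmaOne b = endSum (gapLo b) (gapHi b) :=
  sum_fin_two_add (g + 1) b

lemma sigmaTwo_eq {n : ℕ} (b : Fin n → ℝ) :
    sigmaTwo b = ((∑ j, b j) ^ 2 - ∑ j, b j ^ 2) / 2 := by
  have h1 : (∑ j, b j) ^ 2 = ∑ p : Fin n × Fin n, b p.1 * b p.2 := by
    rw [sq, Finset.sum_mul_sum, Fintype.sum_prod_type]
  have h2 : ∑ p : Fin n × Fin n, b p.1 * b p.2 = sigmaTwo b +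
      ((∑ p ∈ Finset.univ.filter (fun p : Fin n × Fin n => p.2 < p.1), b p.1 * b p.2) +
      ∑ p ∈ Finset.univ.filter (fun p : Fin n × Fin n => p.1 = p.2), b p.1 * b p.2) := by
    simp only [sigmaTwo, Finset.sum_filter, ← Finset.sum_add_distrib]
    refine Finset.sum_congr rfl fun p _ => ?_
    rcases lt_trichotomy p.1 p.2 with h | h | h
    · simp [h, h.not_gt, h.ne]
    · simp [h]
    · simp [h, h.not_gt, h.ne']
  have h3 : ∑ p ∈ Finset.univ.filter (fun p : Fin n × Fin n => p.2 < p.1), b p.1 * b p.2 =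
      sigmaTwo b := by
    refine Finset.sum_equiv (Equiv.prodComm _ _) (fun p => by simp) fun p _ => by
      simp [mul_comm]
  have h4 : ∑ p ∈ Finset.univ.filter (fun p : Fin n × Fin n => p.1 = p.2), b p.1 * b p.2 =
      ∑ j, b j ^ 2 := by
    rw [Finset.sum_filter, Fintype.sum_prod_type]
    simp [sq]
  rw [h1, h2, h3, h4]
  ring

lemma neg_mu_eq (b : Fin (2 * g + 2) → ℝ) (i : Fin (g + 1)) (z : ℝ) :
    -mu b z = (z - gapLo b i) * (gapHi b i - z) * restProd (gapLo b) (gapHi b) i z := by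
  have h1 : mu b z = ∏ j, (z - gapLo b j) * (z - gapHi b j) :=
    prod_fin_two_mul (g + 1) fun k => z - b k
  rw [h1, Fin.prod_univ_succAbove _ i, restProd]
  ring

lemma integral_div_sqrt_mu {b : Fin (2 * g + 2) → ℝ} (hb : StrictMono b) (i : Fin (g + 1))
    (f : ℝ → ℝ) :
    ∫ z in (gapLo b i)..(gapHi b i), f z / √(-mu b z) =
      ∫ θ in 0..Real.pi, f (gapPoint (gapLo b i) (gapHi b i) θ) /
        √(restProd (gapLo b) (gapHi b) i (gapPoint (gapLo b i) (gapHi b i) θ)) := by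
  have h := isGaps_of_strictMono hb
  rw [← integral_div_sqrt (h.lt i) fun z => f z / √(restProd (gapLo b) (gapHi b) i z)]
  refine intervalIntegral.integral_congr fun z hz => ?_
  rw [uIcc_of_le (h.lt i).le] at hz
  rw [neg_mu_eq b i, Real.sqrt_mul (mul_nonneg (by linarith [hz.1]) (by linarith [hz.2])),
    div_div, mul_comm]

lemma VanishingPeriods.gapPeriod {b : Fin (2 * g + 2) → ℝ} (hb : StrictMono b)
    {F : Polynomial ℝ} (hF : VanishingPeriods g b F) (j : Fin g) :
    gapPeriod (gapLo b) (gapHi b) j.succ F = 0 := by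
  rw [NLSWhitham.gapPeriod, ← integral_div_sqrt_mu hb j.succ fun z => F.eval z]
  exact hF j

lemma IsMomentumNumerator.isMomPoly {b : Fin (2 * g + 2) → ℝ} (hb : StrictMono b)
    {P : Polynomial ℝ} (hP : IsMomentumNumerator g b P) : IsMomPoly (gapLo b) (gapHi b) P := by
  have hc : P.coeff g = -(endSum (gapLo b) (gapHi b) / 2) := by
    rw [hP.coeff_one, sigmaOne_eq_endSum]; ring
  have ht := hP.monic.coeff_natDegree
  rw [hP.natDegree] at ht
  have hd := hP.natDegree
  refine ⟨hP.monic, hP.natDegree, hc,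
    (isGaps_of_strictMono hb).gapPeriod_eq_zero (by omega) ?_ (hP.periods.gapPeriod hb)⟩
  rw [residue, hc, ht, Polynomial.coeff_eq_zero_of_natDegree_lt (by omega)]
  ring

lemma IsEnergyNumerator.isSpeedPoly {b : Fin (2 * g + 2) → ℝ} (hb : StrictMono b)
    {Q : Polynomial ℝ} (hQ : IsEnergyNumerator g b Q) :
    IsSpeedPoly (gapLo b) (gapHi b) 0 Q := by
  have h2 : ∑ j, b j ^ 2 = endSqSum (gapLo b) (gapHi b) :=
    sum_fin_two_add (g + 1) fun k => b k ^ 2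
  have hc : Q.coeff g = endSum (gapLo b) (gapHi b) ^ 2 / 8 - endSqSum (gapLo b) (gapHi b) / 4 := by
    rw [hQ.coeff_two, sigmaTwo_eq, h2, sigmaOne_eq_endSum, ← sigmaOne_eq_endSum, sigmaOne]; ring
  have hc1 : Q.coeff (g + 1) = -(endSum (gapLo b) (gapHi b) / 2) := by
    rw [hQ.coeff_one, sigmaOne_eq_endSum]; ring
  have ht := hQ.monic.coeff_natDegree
  rw [hQ.natDegree] at ht
  refine ⟨hQ.monic, hQ.natDegree, by rw [hc1]; ring, by rw [hc]; ring,
    (isGaps_of_strictMono hb).gapPeriod_eq_zero hQ.natDegree.le ?_ (hQ.periods.gapPeriod hb)⟩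
  rw [residue, hc, hc1, ht]
  ring

/-- The speeds of the Whitham equations in terms of gaps. -/
theorem IsWhithamSpeed.gapSpeed {b : Fin (2 * g + 2) → ℝ} (hb : StrictMono b)
    {k : Fin (2 * g + 2)} {s : ℝ} (hs : IsWhithamSpeed g b k s) :
    GapSpeed (gapLo b) (gapHi b) (b k) s := by
  obtain ⟨P, Q, hP, hQ, rfl⟩ := hs
  have h := isGaps_of_strictMono hb
  have hP' := hP.isMomPoly hb
  refine ⟨_, (hQ.isSpeedPoly hb).change h hP' _, ?_⟩
  have := hP'.eval_ne_zero h (h.not_mem_Ioo (exists_eq_gapLo_or_gapHi b k))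
  simp only [Polynomial.eval_add, Polynomial.eval_mul, Polynomial.eval_C]
  field_simp
  ring

/-! ### Bounds, order and reflection of speeds -/

variable {lo hi : Fin (g + 1) → ℝ}

lemma sum_width_le (n : ℕ) {lo hi : Fin (n + 1) → ℝ} (h : IsGaps lo hi) :
    ∑ i, (hi i - lo i) ≤ hi (Fin.last n) - lo 0 := by
  induction n with
  | zero => simp
  | succ n ih =>
    rw [Fin.sum_univ_succ]
    have h1 := ih (lo := fun i => lo i.succ) (hi := fun i => hi i.succ)
      ⟨fun i => h.lt _, fun i j hij => h.sep _ _ (Fin.succ_lt_succ_iff.2 hij)⟩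
    have h2 := h.sep 0 (Fin.succ 0) (Fin.succ_pos 0)
    simp only [Fin.succ_last] at h1
    linarith

/-- Speeds are bounded. -/
lemma GapSpeed.abs_sub_le (h : IsGaps lo hi) {y s : ℝ} (hs : GapSpeed lo hi y s)
    (hy : ∀ i, y ∉ Ioo (lo i) (hi i)) : |s - y| ≤ (hi (Fin.last g) - lo 0) / 2 := by
  obtain ⟨F, hF, h0⟩ := hs
  obtain ⟨ζ, hζ, -, h1, -⟩ := hF.exists_roots_of_eval h h0 hy
  have h2 : s - y = ∑ i, (ζ i - (lo i + hi i) / 2) := by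
    rw [Finset.sum_sub_distrib, ← Finset.sum_div]
    unfold endSum at h1
    linarith
  rw [h2]
  calc _ ≤ ∑ i, |ζ i - (lo i + hi i) / 2| := Finset.abs_sum_le_sum_abs _ _
    _ ≤ ∑ i, (hi i - lo i) / 2 := Finset.sum_le_sum fun i _ => by
        rw [abs_le]; constructor <;> linarith [(hζ i).1, (hζ i).2]
    _ ≤ _ := by
        rw [← Finset.sum_div]
        linarith [sum_width_le g h]

lemma prod_div_pos {n : ℕ} {lo hi ρ ζ : Fin n → ℝ} (hρ : ∀ i, ρ i ∈ Ioo (lo i) (hi i))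
    (hζ : ∀ i, ζ i ∈ Ioo (lo i) (hi i)) {y : ℝ} (hy : ∀ i, y ∉ Ioo (lo i) (hi i)) :
    0 < (∏ i, (y - ζ i)) * ∏ i, (y - ρ i) := by
  rw [← Finset.prod_mul_distrib]
  refine Finset.prod_pos fun i _ => ?_
  by_cases h1 : y ≤ lo i
  · exact mul_pos_of_neg_of_neg (by linarith [(hζ i).1]) (by linarith [(hρ i).1])
  · have : hi i ≤ y := not_lt.1 fun h2 => hy i ⟨not_le.1 h1, h2⟩
    exact mul_pos (by linarith [(hζ i).2]) (by linarith [(hρ i).2])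

/-- Speeds of the same configuration are ordered like the branch points. -/
lemma GapSpeed.lt (h : IsGaps lo hi) {y y' s s' : ℝ} (hs : GapSpeed lo hi y s)
    (hs' : GapSpeed lo hi y' s') (hy : ∀ i, y ∉ Ioo (lo i) (hi i))
    (hy' : ∀ i, y' ∉ Ioo (lo i) (hi i)) (hlt : y < y') : s < s' := by
  obtain ⟨F, hF, h0⟩ := hs
  obtain ⟨G, hG, h1⟩ := hs'
  obtain ⟨P, hP⟩ := h.exists_isMomPoly
  obtain ⟨ρ, hρ, hPe⟩ := hP.exists_roots h
  obtain ⟨ζ, hζ, he, -, -⟩ := hF.exists_roots_of_eval h h0 hy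
  rw [hG.unique h (hF.change h hP s')] at h1
  have hP2 : P.eval y' = ∏ i, (y' - ρ i) := by rw [hPe]; simp [Polynomial.eval_prod]
  simp only [Polynomial.eval_add, Polynomial.eval_mul, Polynomial.eval_C, he, hP2] at h1
  have hpos := prod_div_pos hρ hζ hy'
  by_contra hle
  have h2 : (y' - y) * ((∏ i, (y' - ζ i)) * ∏ i, (y' - ρ i)) +
      (s - s') * (∏ i, (y' - ρ i)) ^ 2 = 0 := by
    linear_combination (∏ i, (y' - ρ i)) * h1
  linarith [mul_pos (sub_pos.2 hlt) hpos, mul_nonneg (sub_nonneg.2 (not_lt.1 hle))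
    (sq_nonneg (∏ i, (y' - ρ i)))]

lemma IsGaps.reflect (h : IsGaps lo hi) (τ : ℝ) :
    IsGaps (fun i => τ - hi i.rev) (fun i => τ - lo i.rev) :=
  ⟨fun i => by linarith [h.lt i.rev], fun i j hij => by
    linarith [h.sep j.rev i.rev (Fin.rev_lt_rev.2 hij)]⟩

lemma restProd_reflect (τ : ℝ) (i : Fin (g + 1)) (z : ℝ) :
    restProd (fun i => τ - hi i.rev) (fun i => τ - lo i.rev) i z =
      restProd lo hi i.rev (τ - z) := by
  unfold restProd
  rw [← Equiv.prod_comp Fin.revPerm]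
  refine Finset.prod_congr rfl fun j _ => ?_
  simp only [Fin.revPerm_apply, Fin.succAbove_rev_right, Fin.rev_rev]
  ring

lemma gapPeriod_reflect (τ : ℝ) (i : Fin (g + 1)) (F : Polynomial ℝ) :
    gapPeriod (fun i => τ - hi i.rev) (fun i => τ - lo i.rev) i
      (F.comp (Polynomial.C τ - Polynomial.X)) = gapPeriod lo hi i.rev F := by
  unfold gapPeriod
  have := intervalIntegral.integral_comp_sub_left (a := 0) (b := Real.pi) (fun θ =>
    F.eval (gapPoint (lo i.rev) (hi i.rev) θ) /
    √(restProd lo hi i.rev (gapPoint (lo i.rev) (hi i.rev) θ))) Real.pi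
  rw [sub_self, sub_zero] at this
  rw [← this]
  congr 1 with θ
  have e : τ - gapPoint (τ - hi i.rev) (τ - lo i.rev) θ =
      gapPoint (lo i.rev) (hi i.rev) (Real.pi - θ) := by
    simp only [gapPoint, Real.cos_pi_sub]; ring
  simp only [restProd_reflect, Polynomial.eval_comp, Polynomial.eval_sub, Polynomial.eval_C,
    Polynomial.eval_X, e]

lemma endSum_reflect (τ : ℝ) : endSum (fun i => τ - hi i.rev) (fun i => τ - lo i.rev) =
    2 * (g + 1) * τ - endSum lo hi := by
  unfold endSum
  rw [← Equiv.sum_comp Fin.revPerm]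
  simp only [Fin.revPerm_apply, Fin.rev_rev]
  have : ∀ i, (τ - hi i + (τ - lo i)) = 2 * τ - (lo i + hi i) := fun i => by ring
  simp only [this, Finset.sum_sub_distrib, Finset.sum_const, Finset.card_univ, Fintype.card_fin]
  simp; ring

lemma endSqSum_reflect (τ : ℝ) : endSqSum (fun i => τ - hi i.rev) (fun i => τ - lo i.rev) =
    2 * (g + 1) * τ ^ 2 - 2 * τ * endSum lo hi + endSqSum lo hi := by
  unfold endSum endSqSum
  rw [← Equiv.sum_comp Fin.revPerm]
  simp only [Fin.revPerm_apply, Fin.rev_rev]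
  have : ∀ i, ((τ - hi i) ^ 2 + (τ - lo i) ^ 2) =
      2 * τ ^ 2 - 2 * τ * (lo i + hi i) + (lo i ^ 2 + hi i ^ 2) := fun i => by ring
  simp only [this, Finset.sum_add_distrib, Finset.sum_sub_distrib, Finset.sum_const,
    Finset.card_univ, Fintype.card_fin, ← Finset.mul_sum]
  simp; ring

open Polynomial in
lemma isSpeedPoly_of_roots {v : Fin (g + 2) → ℝ} {s : ℝ} (h1 : ∑ i, v i = endSum lo hi / 2 + s)
    (h2 : ∑ i, v i ^ 2 = s ^ 2 + endSqSum lo hi / 2)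
    (hp : ∀ i, gapPeriod lo hi i (∏ i, (X - C (v i))) = 0) :
    IsSpeedPoly lo hi s (∏ i, (X - C (v i))) := by
  have c1 := prod_X_sub_C_coeff_card_pred (R := ℝ) (Finset.univ : Finset (Fin (g + 2))) v (by simp)
  simp only [Finset.card_univ, Fintype.card_fin] at c1
  have c2 := coeff_X_mul_prod_X_sub_C (g + 1) v
  rw [coeff_X_mul, h1, h2] at c2
  rw [show g + 2 - 1 = g + 1 from rfl, h1] at c1
  exact ⟨monic_prod_of_monic _ _ fun i _ => monic_X_sub_C _,
    by simp [natDegree_prod_of_monic, monic_X_sub_C], c1, by rw [c2]; ring, hp⟩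

/-- Reflection of the spectrum reflects the speeds. -/
lemma GapSpeed.reflect (h : IsGaps lo hi) {y s : ℝ} (hs : GapSpeed lo hi y s)
    (hy : ∀ i, y ∉ Ioo (lo i) (hi i)) (τ : ℝ) :
    GapSpeed (fun i => τ - hi i.rev) (fun i => τ - lo i.rev) (τ - y) (τ - s) := by
  obtain ⟨F, hF, h0⟩ := hs
  obtain ⟨ζ, hζ, he, h1, h2⟩ := hF.exists_roots_of_eval h h0 hy
  set v : Fin (g + 2) → ℝ := Fin.cons (τ - y) fun i => τ - ζ i with hv
  have e : ∏ i, (Polynomial.X - Polynomial.C (v i)) =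
      Polynomial.C ((-1) ^ g) * F.comp (Polynomial.C τ - Polynomial.X) := by
    refine Polynomial.funext fun z => ?_
    simp only [Polynomial.eval_prod, Polynomial.eval_sub, Polynomial.eval_X, Polynomial.eval_C,
      Polynomial.eval_mul, Polynomial.eval_comp, he, Fin.prod_univ_succ (n := g + 1), hv,
      Fin.cons_zero, Fin.cons_succ]
    have : ∀ i, z - (τ - ζ i) = (-1) * (τ - z - ζ i) := fun i => by ring
    simp only [this, Finset.prod_mul_distrib, Finset.prod_const, Finset.card_univ,
      Fintype.card_fin]
    ring
  refine ⟨_, isSpeedPoly_of_roots (v := v) ?_ ?_ fun i => ?_, ?_⟩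
  · rw [Fin.sum_univ_succ, endSum_reflect]
    simp only [hv, Fin.cons_zero, Fin.cons_succ, Finset.sum_sub_distrib, Finset.sum_const,
      Finset.card_univ, Fintype.card_fin, nsmul_eq_mul]
    push_cast
    linarith
  · rw [Fin.sum_univ_succ, endSqSum_reflect]
    have : ∀ i, (τ - ζ i) ^ 2 = τ ^ 2 - 2 * τ * ζ i + ζ i ^ 2 := fun i => by ring
    simp only [hv, Fin.cons_zero, Fin.cons_succ, this, Finset.sum_sub_distrib,
      Finset.sum_add_distrib, Finset.sum_const,
      Finset.card_univ, Fintype.card_fin, nsmul_eq_mul, ← Finset.mul_sum]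
    push_cast
    linear_combination h2 - 2 * τ * h1
  · rw [e, gapPeriod_C_mul, gapPeriod_reflect, hF.period, mul_zero]
  · rw [e]
    simp [Polynomial.eval_comp, h0]

end NLSWhitham
end

noncomputable section

namespace NLSWhitham

/-! ### Removal of a band -/

lemma GapSpeed.exists_roots_gt {g : ℕ} {lo hi : Fin (g + 1) → ℝ} (h : IsGaps lo hi)
    {y s s' : ℝ} (hs : GapSpeed lo hi y s) (hy : ∀ i, y ∉ Ioo (lo i) (hi i)) (hlt : s < s')
    {F : Polynomial ℝ} (hF : IsSpeedPoly lo hi s' F) :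
    ∃ (ζ : Fin (g + 1) → ℝ) (y' : ℝ), (∀ i, ζ i ∈ Ioo (lo i) (hi i)) ∧
      (∀ z, F.eval z = (z - y') * ∏ i, (z - ζ i)) ∧ y < y' := by
  obtain ⟨G, hG, h0⟩ := hs
  obtain ⟨P, hP⟩ := h.exists_isMomPoly
  obtain ⟨ρ, hρ, hPe⟩ := hP.exists_roots h
  obtain ⟨ζ, y', hζ, he, -, -⟩ := hF.exists_roots h
  refine ⟨ζ, y', hζ, he, ?_⟩
  have h1 := he y
  have hP2 : P.eval y = ∏ i, (y - ρ i) := by rw [hPe]; simp [Polynomial.eval_prod]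
  rw [hF.unique h (hG.change h hP s')] at h1
  simp only [Polynomial.eval_add, Polynomial.eval_mul, Polynomial.eval_C, h0, hP2] at h1
  have hpos := prod_div_pos hρ hζ hy
  have h2 : (s' - s) * (∏ i, (y - ρ i)) ^ 2 =
      (y' - y) * ((∏ i, (y - ζ i)) * ∏ i, (y - ρ i)) := by
    linear_combination -(∏ i, (y - ρ i)) * h1
  have h3 : 0 < (∏ i, (y - ρ i)) ^ 2 := pow_pos (lt_of_le_of_ne (abs_nonneg _) (Ne.symm
    (abs_ne_zero.2 (right_ne_zero_of_mul hpos.ne')))) 2 |>.trans_eq (sq_abs _)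
  have h4 := mul_pos (sub_pos.2 hlt) h3
  rw [h2] at h4
  exact sub_pos.1 (pos_of_mul_pos_left h4 hpos.le)

/-- A polynomial of degree at most `3` does not change its sign four times. -/
lemma not_four_sign_changes {K : Polynomial ℝ} (hd : K.natDegree ≤ 3) {a b c d e : ℝ}
    (hab : a < b) (hbc : b < c) (hcd : c < d) (hde : d < e) (ha : K.eval a < 0)
    (hb : 0 < K.eval b) (hc : K.eval c < 0) (hd' : 0 < K.eval d) (he : K.eval e < 0) : False := by
  obtain ⟨x₁, hx₁, h₁⟩ := intermediate_value_Ioo hab.le K.continuous.continuousOn ⟨ha, hb⟩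
  obtain ⟨x₂, hx₂, h₂⟩ := intermediate_value_Ioo' hbc.le K.continuous.continuousOn ⟨hc, hb⟩
  obtain ⟨x₃, hx₃, h₃⟩ := intermediate_value_Ioo hcd.le K.continuous.continuousOn ⟨hc, hd'⟩
  obtain ⟨x₄, hx₄, h₄⟩ := intermediate_value_Ioo' hde.le K.continuous.continuousOn ⟨he, hd'⟩
  have l1 := hx₁.2.trans hx₂.1
  have l2 := hx₂.2.trans hx₃.1
  have l3 := hx₃.2.trans hx₄.1
  have hK : K = 0 := by
    refine Polynomial.eq_zero_of_natDegree_lt_card_of_eval_eq_zero K (f := ![x₁, x₂, x₃, x₄])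
      (StrictMono.injective ?_) (fun i => ?_) (by simp; omega)
    · refine Fin.strictMono_iff_lt_succ.2 fun i => ?_
      fin_cases i <;> assumption
    · fin_cases i <;> assumption
  rw [hK] at ha
  simp at ha

/-- The inverse of the Joukowski map onto the complement of the band from `d` to `d'`. -/
def jouk (d d' z : ℝ) : ℝ := (z - (d + d') / 2 + √((z - d) * (z - d'))) / ((d' - d) / 2)

lemma one_lt_jouk {d d' z : ℝ} (h : d < d') (hz : d' < z) : 1 < jouk d d' z := by
  unfold jouk
  rw [one_lt_div (by linarith)]
  linarith [Real.sqrt_nonneg ((z - d) * (z - d'))]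

lemma jouk_lt {d d' z z' : ℝ} (h : d < d') (hz : d' < z) (hzz : z < z') :
    jouk d d' z < jouk d d' z' := by
  unfold jouk
  have : √((z - d) * (z - d')) ≤ √((z' - d) * (z' - d')) := Real.sqrt_le_sqrt
    (mul_le_mul (by linarith) (by linarith) (by linarith) (by linarith))
  exact div_lt_div_of_pos_right (by linarith) (by linarith)

lemma inv_jouk {d d' z : ℝ} (h : d < d') (hz : d' < z) :
    (jouk d d' z)⁻¹ = (z - (d + d') / 2 - √((z - d) * (z - d'))) / ((d' - d) / 2) := by
  have h1 := one_lt_jouk h hz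
  have h2 : √((z - d) * (z - d')) ^ 2 = (z - d) * (z - d') :=
    Real.sq_sqrt (mul_nonneg (by linarith) (by linarith))
  refine inv_eq_of_mul_eq_one_right ?_
  unfold jouk
  have : d' - d ≠ 0 := by linarith
  field_simp
  linear_combination (-4) * h2

lemma jouk_add_inv {d d' z : ℝ} (h : d < d') (hz : d' < z) :
    (d + d') / 2 + (d' - d) / 4 * (jouk d d' z + (jouk d d' z)⁻¹) = z := by
  rw [inv_jouk h hz, jouk]
  have : d' - d ≠ 0 := by linarith
  field_simp
  ring

lemma jouk_sub_inv {d d' z : ℝ} (h : d < d') (hz : d' < z) :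
    (d' - d) / 4 * (jouk d d' z - (jouk d d' z)⁻¹) = √((z - d) * (z - d')) := by
  rw [inv_jouk h hz, jouk]
  have : d' - d ≠ 0 := by linarith
  field_simp
  ring

open Polynomial in
/-- The polynomial `w ^ (g + 3) * (F_A (z) - F_B (z) * R)` in the uniformizing variable. -/
def joukPoly (g : ℕ) (m e : ℝ) (FA FB : ℝ[X]) : ℝ[X] :=
  ∑ i ∈ Finset.range (g + 4), C (FA.coeff i) *
      ((C e * X ^ 2 + C m * X + C e) ^ i * X ^ (g + 3 - i)) -
    (C e * X ^ 2 - C e) * ∑ i ∈ Finset.range (g + 3), C (FB.coeff i) *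
      ((C e * X ^ 2 + C m * X + C e) ^ i * X ^ (g + 2 - i))

open Polynomial in
lemma eval_joukPoly {g : ℕ} {m e : ℝ} {FA FB : ℝ[X]} (hA : FA.natDegree = g + 3)
    (hB : FB.natDegree = g + 2) {w : ℝ} (hw : w ≠ 0) :
    (joukPoly g m e FA FB).eval w = w ^ (g + 3) * (FA.eval (m + e * (w + w⁻¹)) -
      FB.eval (m + e * (w + w⁻¹)) * (e * (w - w⁻¹))) := by
  have hZ : e * w ^ 2 + m * w + e = w * (m + e * (w + w⁻¹)) := by field_simp; ring
  have hR : e * w ^ 2 - e = w * (e * (w - w⁻¹)) := by field_simp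
  have hk : ∀ n i, i ≤ n → w ^ i * w ^ (n - i) = w ^ n := fun n i hi => by
    rw [← pow_add, Nat.add_sub_cancel' hi]
  rw [eval_eq_sum_range (p := FA), eval_eq_sum_range (p := FB), hA, hB, joukPoly]
  simp only [eval_sub, eval_finsetSum, eval_mul, eval_C, eval_add, eval_pow, eval_X]
  rw [hZ, hR, mul_sub (w ^ (g + 3)), Finset.mul_sum, Finset.sum_mul, Finset.mul_sum,
    Finset.mul_sum]
  congr 1
  · refine Finset.sum_congr rfl fun i hi => ?_
    rw [← hk (g + 3) i (by simp at hi; omega), mul_pow]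
    ring
  · refine Finset.sum_congr rfl fun i hi => ?_
    rw [pow_succ w (g + 2), ← hk (g + 2) i (by simp at hi; omega), mul_pow]
    ring

open Polynomial in
lemma eval_zero_joukPoly {g : ℕ} {m e : ℝ} {FA FB : ℝ[X]} (hA : FA.coeff (g + 3) = 1)
    (hB : FB.coeff (g + 2) = 1) :
    (joukPoly g m e FA FB).eval 0 = 2 * e ^ (g + 3) := by
  rw [joukPoly]
  simp only [eval_sub, eval_finsetSum, eval_mul, eval_C, eval_add, eval_pow, eval_X]
  rw [Finset.sum_range_succ _ (g + 3), Finset.sum_range_succ (fun i => FB.coeff i *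
    ((e * 0 ^ 2 + m * 0 + e) ^ i * 0 ^ (g + 2 - i))) (g + 2), Finset.sum_eq_zero,
    Finset.sum_eq_zero, hA, hB]
  · simp; ring
  · intro i hi
    simp only [Finset.mem_range] at hi
    simp [show g + 2 - i ≠ 0 by omega]
  · intro i hi
    simp only [Finset.mem_range] at hi
    simp [show g + 3 - i ≠ 0 by omega]

open Polynomial in
lemma natDegree_joukPoly_le {g : ℕ} {m e a₁ a₂ : ℝ} {FA FB : ℝ[X]} (hA : FA.coeff (g + 3) = 1)
    (hA₁ : FA.coeff (g + 2) = a₁) (hA₂ : FA.coeff (g + 1) = a₂)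
    (hB : FB.coeff (g + 2) = 1) (hB₁ : FB.coeff (g + 1) = a₁ + m)
    (hB₂ : FB.coeff g = a₂ + m ^ 2 + 2 * e ^ 2 + m * a₁) :
    (joukPoly g m e FA FB).natDegree ≤ 2 * g + 3 := by
  set Z : ℝ[X] := C e * X ^ 2 + C m * X + C e with hZ
  have hZd : Z.natDegree ≤ 2 := by rw [hZ]; compute_degree
  have hterm : ∀ (c : ℝ) (n i : ℕ), i ≤ n → (C c * (Z ^ i * X ^ (n - i))).natDegree ≤ n + i := by
    intro c n i hi
    refine (natDegree_C_mul_le _ _).trans (natDegree_mul_le.trans ?_)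
    have h1 : (Z ^ i).natDegree ≤ i * 2 := natDegree_pow_le_of_le i hZd
    rw [natDegree_X_pow]
    omega
  set SA := ∑ i ∈ Finset.range (g + 1), C (FA.coeff i) * (Z ^ i * X ^ (g + 3 - i))
  set SB := ∑ i ∈ Finset.range g, C (FB.coeff i) * (Z ^ i * X ^ (g + 2 - i))
  set k : ℝ[X] := C (m ^ 3 + 6 * e ^ 2 * m + a₁ * (m ^ 2 + 2 * e ^ 2) + a₂ * m) * X ^ 3 +
    C (4 * e * m ^ 2 + 4 * e ^ 3 + 2 * a₁ * e * m + (a₁ + m) * e * m + a₂ * e +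
      (a₂ + m ^ 2 + 2 * e ^ 2 + m * a₁) * e) * X ^ 2 +
    C (5 * e ^ 2 * m + (a₁ + (a₁ + m)) * e ^ 2) * X + C (2 * e ^ 3) with hk
  have e1 : joukPoly g m e FA FB = Z ^ g * k + SA - (C e * X ^ 2 - C e) * SB := by
    rw [joukPoly, ← hZ, Finset.sum_range_succ _ (g + 3), Finset.sum_range_succ _ (g + 2),
      Finset.sum_range_succ _ (g + 1), Finset.sum_range_succ _ (g + 2),
      Finset.sum_range_succ _ (g + 1),
      Finset.sum_range_succ (fun i => C (FB.coeff i) * (Z ^ i * X ^ (g + 2 - i))) g, hA, hA₁, hA₂, hB, hB₁, hB₂]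
    simp only [show g + 3 - (g + 3) = 0 by omega, show g + 3 - (g + 2) = 1 by omega,
      show g + 3 - (g + 1) = 2 by omega, show g + 2 - (g + 2) = 0 by omega,
      show g + 2 - (g + 1) = 1 by omega, show g + 2 - g = 2 by omega]
    change SA + _ + _ + _ - _ * (SB + _ + _ + _) = _
    have e2 : k = Z ^ 3 + C a₁ * (Z ^ 2 * X) + C a₂ * (Z * X ^ 2) -
        (C e * X ^ 2 - C e) * (Z ^ 2 + C (a₁ + m) * (Z * X) +
        C (a₂ + m ^ 2 + 2 * e ^ 2 + m * a₁) * X ^ 2) := by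
      rw [hk, hZ]
      simp only [C_add, C_mul, C_pow, map_ofNat]
      ring
    rw [e2]
    simp only [map_one]
    ring
  have hk3 : k.natDegree ≤ 3 := natDegree_cubic_le
  have d1 : (Z ^ g * k).natDegree ≤ 2 * g + 3 := natDegree_mul_le.trans (by
    have := natDegree_pow_le_of_le g hZd; omega)
  have d2 : SA.natDegree ≤ 2 * g + 3 := natDegree_sum_le_of_forall_le _ _ fun i hi => by
    simp only [Finset.mem_range] at hi
    exact (hterm _ (g + 3) i (by omega)).trans (by omega)
  have d3 : ((C e * X ^ 2 - C e) * SB).natDegree ≤ 2 * g + 3 := by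
    have hr : (C e * X ^ 2 - C e : ℝ[X]).natDegree ≤ 2 := by compute_degree
    rcases Nat.eq_zero_or_pos g with rfl | hg
    · simp [SB]
    · have : SB.natDegree ≤ 2 * g + 1 := natDegree_sum_le_of_forall_le _ _ fun i hi => by
        simp only [Finset.mem_range] at hi
        exact (hterm _ (g + 2) i (by omega)).trans (by omega)
      exact natDegree_mul_le.trans (by omega)
  rw [e1]
  exact (natDegree_sub_le _ _).trans (max_le ((natDegree_add_le _ _).trans (max_le d1 d2)) d3)

/-! The band from `hi 0` to `lo 1` is removed. -/

variable {g : ℕ} {lo hi : Fin (g + 2) → ℝ}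

lemma succAbove_one_succ (j : Fin g) : (1 : Fin (g + 2)).succAbove j.succ = j.succ.succ :=
  Fin.succAbove_of_lt_succ _ _ (by simp [Fin.lt_def])

lemma succAbove_one_zero : (1 : Fin (g + 2)).succAbove 0 = 0 := by
  simp [Fin.succAbove]

lemma IsGaps.removeBand (h : IsGaps lo hi) :
    IsGaps (fun i => lo ((1 : Fin (g + 2)).succAbove i)) (fun i => hi i.succ) where
  lt i := by
    refine Fin.cases ?_ (fun j => ?_) i
    · rw [succAbove_one_zero]
      exact (h.lt 0).trans ((h.sep 0 _ (Fin.succ_pos 0)).trans (h.lt _))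
    · rw [succAbove_one_succ]; exact h.lt _
  sep i j hij := by
    obtain ⟨k, rfl⟩ : ∃ k : Fin g, k.succ = j := Fin.exists_succ_eq.2
      (Fin.pos_iff_ne_zero.1 ((Fin.zero_le _).trans_lt hij))
    rw [succAbove_one_succ]
    exact h.sep _ _ (Fin.succ_lt_succ_iff.2 hij)

lemma restProd_removeBand (j : Fin g) (z : ℝ) :
    restProd lo hi j.succ.succ z = restProd (fun i => lo ((1 : Fin (g + 2)).succAbove i))
      (fun i => hi i.succ) j.succ z * ((z - hi 0) * (z - lo 1)) := by
  have h0 : (0 : Fin (g + 1)) ∈ Finset.univ := Finset.mem_univ _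
  obtain ⟨g, rfl⟩ : ∃ n, g = n + 1 := ⟨g - 1, by have := j.2; omega⟩
  unfold restProd
  rw [Fin.prod_univ_succ, Fin.prod_univ_succ, Fin.prod_univ_succ (n := g)]
  simp only [Fin.succ_succAbove_zero, Fin.succ_succAbove_succ, succAbove_one_zero]
  have : ∀ i : Fin g, (1 : Fin (g + 1 + 2)).succAbove (j.succAbove i).succ =
    (j.succAbove i).succ.succ := fun i => succAbove_one_succ _
  simp only [this]
  have e1 : (Fin.succ 0 : Fin (g + 1 + 2)) = 1 := rfl
  rw [e1]
  ring

lemma endSum_removeBand : endSum lo hi =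
    endSum (fun i => lo ((1 : Fin (g + 2)).succAbove i)) (fun i => hi i.succ) + (hi 0 + lo 1) := by
  unfold endSum
  rw [Finset.sum_add_distrib, Finset.sum_add_distrib, Fin.sum_univ_succAbove lo 1,
    Fin.sum_univ_succ hi]
  ring

lemma endSqSum_removeBand : endSqSum lo hi =
    endSqSum (fun i => lo ((1 : Fin (g + 2)).succAbove i)) (fun i => hi i.succ) +
      (hi 0 ^ 2 + lo 1 ^ 2) := by
  unfold endSqSum
  rw [Finset.sum_add_distrib, Finset.sum_add_distrib, Fin.sum_univ_succAbove _ 1,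
    Fin.sum_univ_succ (fun i => hi i ^ 2)]
  ring

lemma IsGaps.lo_one_lt (h : IsGaps lo hi) (j : Fin g) {z : ℝ} (hz : lo j.succ.succ ≤ z) :
    lo 1 < z :=
  ((h.lt 1).trans (h.sep 1 _ (by simp [Fin.lt_def]))).trans_le hz

/-- Zeros in the other gaps of the combinations of the two differentials. -/
lemma IsGaps.exists_zero_combination (h : IsGaps lo hi) {FA FB : Polynomial ℝ} (j : Fin g)
    (hA : gapPeriod lo hi j.succ.succ FA = 0)
    (hB : gapPeriod (fun i => lo ((1 : Fin (g + 2)).succAbove i)) (fun i => hi i.succ) j.succ FB = 0)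
    (c : ℝ) :
    ∃ z ∈ Ioo (lo j.succ.succ) (hi j.succ.succ),
      FA.eval z + c * (FB.eval z * √((z - hi 0) * (z - lo 1))) = 0 := by
  have hd : hi 0 < lo 1 := h.sep 0 1 (by simp)
  have h2 := h.lt j.succ.succ
  have hB' : ∫ θ in 0..Real.pi, FB.eval (gapPoint (lo j.succ.succ) (hi j.succ.succ) θ) *
      √((gapPoint (lo j.succ.succ) (hi j.succ.succ) θ - hi 0) *
        (gapPoint (lo j.succ.succ) (hi j.succ.succ) θ - lo 1)) /
      √(restProd lo hi j.succ.succ (gapPoint (lo j.succ.succ) (hi j.succ.succ) θ)) = 0 := by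
    rw [gapPeriod, succAbove_one_succ] at hB
    rw [← hB]
    congr 1 with θ
    have hz := gapPoint_mem_Icc h2.le θ
    have h3 := h.lo_one_lt j hz.1
    have h4 : 0 < (gapPoint (lo j.succ.succ) (hi j.succ.succ) θ - hi 0) *
      (gapPoint (lo j.succ.succ) (hi j.succ.succ) θ - lo 1) := mul_pos (by linarith) (by linarith)
    rw [restProd_removeBand, Real.sqrt_mul' _ h4.le]
    exact mul_div_mul_right _ _ (Real.sqrt_pos.2 h4).ne'
  have hcont : ContinuousOn (fun z => FA.eval z + c * (FB.eval z * √((z - hi 0) * (z - lo 1))))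
      (Icc (lo j.succ.succ) (hi j.succ.succ)) := by fun_prop
  obtain ⟨z, hz, h0⟩ := exists_zero_of_integral_gapPoint h2
    (h.continuousOn_div_sqrt j.succ.succ hcont) (by
      have i1 := (h.continuous_period j.succ.succ FA).intervalIntegrable (μ :=
        MeasureTheory.volume) 0 Real.pi
      have i2 := (((h.continuousOn_div_sqrt j.succ.succ (f := fun z => FB.eval z *
        √((z - hi 0) * (z - lo 1))) (by fun_prop)).comp_continuous (continuous_gapPoint _ _)
        (gapPoint_mem_Icc h2.le)).const_mul c).intervalIntegrable (μ :=
        MeasureTheory.volume) 0 Real.pi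
      have e := intervalIntegral.integral_add i1 i2
      simp only [Function.comp_apply] at e
      rw [intervalIntegral.integral_const_mul, hB', mul_zero, add_zero] at e
      rw [gapPeriod] at hA
      rw [hA] at e
      rw [← e]
      congr 1 with θ
      ring)
  refine ⟨z, hz, (div_eq_zero_iff.1 h0).resolve_right ?_⟩
  exact (Real.sqrt_pos.2 (h.restProd_pos _ (Ioo_subset_Icc_self hz))).ne'

end NLSWhitham
end

noncomputable section

namespace NLSWhitham

lemma exists_eq_mul_of_prod {n : ℕ} {A B C : Fin n → ℝ} (h : ∀ j, 0 < A j * B j * C j) {K c : ℝ}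
    (e : (∏ j, A j) * (∏ j, B j) * K = c * ∏ j, C j) : ∃ t, 0 < t ∧ K = c * t := by
  have h1 : 0 < (∏ j, A j) * (∏ j, B j) * ∏ j, C j := by
    rw [← Finset.prod_mul_distrib, ← Finset.prod_mul_distrib]
    exact Finset.prod_pos fun j _ => h j
  have h2 := left_ne_zero_of_mul h1.ne'
  refine ⟨(∏ j, C j) / ((∏ j, A j) * ∏ j, B j), ?_, ?_⟩
  · rw [div_eq_mul_inv, ← mul_pos_iff_of_pos_left (pow_pos (abs_pos.2 h2) 2), sq_abs]
    have : ((∏ j, A j) * ∏ j, B j) ^ 2 * ((∏ j, C j) * ((∏ j, A j) * ∏ j, B j)⁻¹) =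
        (∏ j, A j) * (∏ j, B j) * ∏ j, C j := by field_simp
    rw [this]; exact h1
  · rw [← mul_div_assoc, eq_div_iff h2]
    linarith

variable {g : ℕ} {lo hi : Fin (g + 2) → ℝ}

/-- The removal of the first band does not increase the speeds of the branch points to its
right. -/
theorem GapSpeed.removeBand_le (h : IsGaps lo hi) {y sA sB : ℝ} (hA : GapSpeed lo hi y sA)
    (hB : GapSpeed (fun i => lo ((1 : Fin (g + 2)).succAbove i)) (fun i => hi i.succ) y sB)
    (hy : ∀ i, y ∉ Ioo (lo i) (hi i)) (hy1 : lo 1 < y) : sB ≤ sA := by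
  by_contra! hlt
  obtain ⟨FB, hFB, hB0⟩ := hB
  obtain ⟨FA, hFA⟩ := h.exists_isSpeedPoly sB
  obtain ⟨ζ, yA, hζ, he, hyA⟩ := hA.exists_roots_gt h hy hlt hFA
  choose z hz hz0 using fun j => h.exists_zero_combination j (hFA.period _) (hFB.period _) (-1)
  choose z' hz' hz0' using fun j => h.exists_zero_combination j (hFA.period _) (hFB.period _) 1
  have hS := endSum_removeBand (lo := lo) (hi := hi)
  have hT := endSqSum_removeBand (lo := lo) (hi := hi)
  have hd : hi 0 < lo 1 := h.sep 0 1 (by simp)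
  have h00 := h.lt 0
  have h11 := h.lt 1
  set d := hi 0
  set d' := lo 1
  set N := joukPoly g ((d + d') / 2) ((d' - d) / 4) FA FB with hN
  have hNd : N.natDegree ≤ 2 * g + 3 := by
    refine natDegree_joukPoly_le hFA.coeff_top hFA.coeff_one hFA.coeff_two hFB.coeff_top ?_ ?_
    · rw [hFB.coeff_one, hS]; ring
    · rw [hFB.coeff_two, hS, hT]; ring
  have hNe : ∀ {x}, d' < x → N.eval (jouk d d' x) = jouk d d' x ^ (g + 3) *
      (FA.eval x - FB.eval x * √((x - d) * (x - d'))) := fun {x} hx => by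
    rw [hN, eval_joukPoly hFA.natDegree hFB.natDegree
      (by linarith [one_lt_jouk hd hx] : jouk d d' x ≠ 0), jouk_add_inv hd hx, jouk_sub_inv hd hx]
  have hNe' : ∀ {x}, d' < x → N.eval (jouk d d' x)⁻¹ = (jouk d d' x)⁻¹ ^ (g + 3) *
      (FA.eval x + FB.eval x * √((x - d) * (x - d'))) := fun {x} hx => by
    have h1 := one_lt_jouk hd hx
    rw [hN, eval_joukPoly hFA.natDegree hFB.natDegree (inv_ne_zero (by linarith)), inv_inv,
      add_comm (jouk d d' x)⁻¹, jouk_add_inv hd hx, ← jouk_sub_inv hd hx]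
    ring
  have hzd : ∀ j, d' < z j := fun j => h.lo_one_lt j (hz j).1.le
  have hzd' : ∀ j, d' < z' j := fun j => h.lo_one_lt j (hz' j).1.le
  have hw : ∀ j, 1 < jouk d d' (z j) := fun j => one_lt_jouk hd (hzd j)
  have hw' : ∀ j, 1 < jouk d d' (z' j) := fun j => one_lt_jouk hd (hzd' j)
  have hwi' : ∀ j, 0 < (jouk d d' (z' j))⁻¹ := fun j => inv_pos.2 (by linarith [hw' j])
  have hwi1 : ∀ j, (jouk d d' (z' j))⁻¹ < 1 := fun j => inv_lt_one_of_one_lt₀ (hw' j)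
  have hsep : ∀ i j : Fin g, i < j → hi i.succ.succ < lo j.succ.succ := fun i j hij =>
    h.sep _ _ (Fin.succ_lt_succ_iff.2 (Fin.succ_lt_succ_iff.2 hij))
  have inj1 : Function.Injective fun j => jouk d d' (z j) := by
    refine StrictMono.injective fun i j hij => jouk_lt hd (hzd i) ?_
    linarith [hsep i j hij, (hz i).2, (hz j).1]
  have inj2 : Function.Injective fun j => (jouk d d' (z' j))⁻¹ := by
    refine inv_injective.comp (StrictMono.injective fun i j hij => jouk_lt hd (hzd' i) ?_)
    linarith [hsep i j hij, (hz' i).2, (hz' j).1]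
  set v : Fin g ⊕ Fin g → ℝ :=
    Sum.elim (fun j => jouk d d' (z j)) (fun j => (jouk d d' (z' j))⁻¹) with hv
  have hvi : Function.Injective v := inj1.sumElim inj2 fun i j hij => by
    linarith [hw i, hwi1 j]
  have hroot : ∀ i, N.eval (v i) = 0 := by
    rintro (j | j)
    · simp only [hv, Sum.elim_inl]
      rw [hNe (hzd j), show FA.eval (z j) - FB.eval (z j) * √((z j - d) * (z j - d')) = 0 by
        linarith [hz0 j], mul_zero]
    · simp only [hv, Sum.elim_inr]
      rw [hNe' (hzd' j), show FA.eval (z' j) + FB.eval (z' j) * √((z' j - d) * (z' j - d')) = 0 by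
        linarith [hz0' j], mul_zero]
  have hN0 : N.eval 0 = 2 * ((d' - d) / 4) ^ (g + 3) :=
    eval_zero_joukPoly hFA.coeff_top hFB.coeff_top
  have hNpos : 0 < N.eval 0 := by rw [hN0]; have : 0 < (d' - d) / 4 := by linarith
                                  positivity
  obtain ⟨K, hK⟩ : (∏ i, (Polynomial.X - Polynomial.C (v i))) ∣ N :=
    Finset.prod_dvd_of_coprime ((Polynomial.pairwise_coprime_X_sub_C hvi).set_pairwise _)
      fun i _ => Polynomial.dvd_iff_isRoot.2 (hroot i)
  have hKd : K.natDegree ≤ 3 := by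
    have hm : (∏ i, (Polynomial.X - Polynomial.C (v i))).Monic :=
      Polynomial.monic_prod_of_monic _ _ fun i _ => Polynomial.monic_X_sub_C _
    have hK0 : K ≠ 0 := by
      rintro rfl
      rw [hK] at hNpos
      simp at hNpos
    rw [hK, hm.natDegree_mul' hK0,
      Polynomial.natDegree_prod_of_monic _ _ fun i _ => Polynomial.monic_X_sub_C _] at hNd
    simp at hNd
    omega
  have hKe : ∀ w, (∏ j, (w - jouk d d' (z j))) * (∏ j, (w - (jouk d d' (z' j))⁻¹)) * K.eval w =
      N.eval w := fun w => by
    rw [hK, Polynomial.eval_mul, Polynomial.eval_prod, Fintype.prod_sum_type]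
    simp [hv]
  have hFe : ∀ x, FA.eval x = (x - yA) * (x - ζ 0) * (x - ζ 1) * ∏ j : Fin g, (x - ζ j.succ.succ) :=
    fun x => by
      rw [he, Fin.prod_univ_succ, Fin.prod_univ_succ, Fin.succ_zero_eq_one]; ring
  have hyd : hi 1 ≤ y := not_lt.1 fun h2 => hy 1 ⟨hy1, h2⟩
  have hζ0 := hζ 0
  have hζ1 := hζ 1
  have hζj : ∀ j : Fin g, d' < ζ j.succ.succ := fun j => h.lo_one_lt j (hζ j.succ.succ).1.le
  have hyy : ∀ j : Fin g, y ≤ lo j.succ.succ ∨ hi j.succ.succ ≤ y := fun j => by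
    by_contra! h3; exact hy _ h3
  have hWy := one_lt_jouk hd hy1
  have hWy0 : 0 < (jouk d d' y)⁻¹ := inv_pos.2 (by linarith)
  have hWy1 : (jouk d d' y)⁻¹ < 1 := inv_lt_one_of_one_lt₀ hWy
  obtain ⟨t₁, ht₁, e₁⟩ := exists_eq_mul_of_prod (A := fun j => -1 - jouk d d' (z j))
    (B := fun j => -1 - (jouk d d' (z' j))⁻¹) (C := fun j => ζ j.succ.succ - d)
    (K := K.eval (-1)) (c := -((d - yA) * (d - ζ 0) * (d - ζ 1)))
    (fun j => mul_pos (mul_pos_of_neg_of_neg (by linarith [hw j]) (by linarith [hwi' j]))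
      (by linarith [hζj j])) (by
      rw [hKe, hN, eval_joukPoly hFA.natDegree hFB.natDegree (by norm_num)]
      have e1 : (d + d') / 2 + (d' - d) / 4 * (-1 + (-1)⁻¹) = d := by norm_num; ring
      have e2 : ∀ j : Fin g, d - ζ j.succ.succ = (-1) * (ζ j.succ.succ - d) := fun j => by ring
      rw [e1, hFe]
      simp only [e2, Finset.prod_mul_distrib, Finset.prod_const, Finset.card_univ,
        Fintype.card_fin]
      have e3 : (-1 : ℝ) ^ (g + 3) * (-1) ^ g = -1 := by
        rw [← pow_add, show g + 3 + g = 2 * (g + 1) + 1 by ring, pow_succ, pow_mul]; norm_num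
      linear_combination ((d - yA) * (d - ζ 0) * (d - ζ 1)) *
        (∏ j : Fin g, (ζ j.succ.succ - d)) * e3)
  obtain ⟨t₂, ht₂, e₂⟩ := exists_eq_mul_of_prod (A := fun j => 0 - jouk d d' (z j))
    (B := fun j => 0 - (jouk d d' (z' j))⁻¹) (C := fun j => 1)
    (K := K.eval 0) (c := N.eval 0)
    (fun j => mul_pos (mul_pos_of_neg_of_neg (by linarith [hw j]) (by linarith [hwi' j]))
      one_pos) (by rw [hKe]; simp)
  obtain ⟨t₃, ht₃, e₃⟩ := exists_eq_mul_of_prod (A := fun j => (jouk d d' y)⁻¹ - jouk d d' (z j))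
    (B := fun j => (jouk d d' y)⁻¹ - (jouk d d' (z' j))⁻¹) (C := fun j => y - ζ j.succ.succ)
    (K := K.eval (jouk d d' y)⁻¹)
    (c := (jouk d d' y)⁻¹ ^ (g + 3) * ((y - yA) * (y - ζ 0) * (y - ζ 1)))
    (fun j => by
      rw [mul_assoc]
      refine mul_pos_of_neg_of_neg (by linarith [hw j]) ?_
      obtain ⟨hl, hr⟩ := hζ j.succ.succ
      rcases hyy j with h3 | h3
      · have := jouk_lt hd hy1 (lt_of_le_of_lt h3 (hz' j).1)
        exact mul_neg_of_pos_of_neg (sub_pos.2 (inv_strictAnti₀ (by linarith) this))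
          (by linarith)
      · have := jouk_lt hd (hzd' j) (lt_of_lt_of_le (hz' j).2 h3)
        exact mul_neg_of_neg_of_pos (sub_neg.2 (inv_strictAnti₀ (by linarith [hw' j]) this))
          (by linarith)) (by
      rw [hKe, hNe' hy1, hB0, hFe]; ring)
  obtain ⟨t₄, ht₄, e₄⟩ := exists_eq_mul_of_prod (A := fun j => 1 - jouk d d' (z j))
    (B := fun j => 1 - (jouk d d' (z' j))⁻¹) (C := fun j => d' - ζ j.succ.succ)
    (K := K.eval 1) (c := (d' - yA) * (d' - ζ 0) * (d' - ζ 1))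
    (fun j => mul_pos_of_neg_of_neg (mul_neg_of_neg_of_pos (by linarith [hw j])
      (by linarith [hwi1 j])) (by linarith [hζj j])) (by
      rw [hKe, hN, eval_joukPoly hFA.natDegree hFB.natDegree (by norm_num)]
      have e1 : (d + d') / 2 + (d' - d) / 4 * (1 + (1)⁻¹) = d' := by norm_num; ring
      rw [e1, hFe]
      simp)
  obtain ⟨t₅, ht₅, e₅⟩ := exists_eq_mul_of_prod (A := fun j => jouk d d' y - jouk d d' (z j))
    (B := fun j => jouk d d' y - (jouk d d' (z' j))⁻¹) (C := fun j => y - ζ j.succ.succ)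
    (K := K.eval (jouk d d' y))
    (c := jouk d d' y ^ (g + 3) * ((y - yA) * (y - ζ 0) * (y - ζ 1)))
    (fun j => by
      rw [mul_right_comm]
      refine mul_pos ?_ (by linarith [hwi1 j])
      obtain ⟨hl, hr⟩ := hζ j.succ.succ
      rcases hyy j with h3 | h3
      · have := jouk_lt hd hy1 (lt_of_le_of_lt h3 (hz j).1)
        exact mul_pos_of_neg_of_neg (by linarith) (by linarith)
      · have := jouk_lt hd (hzd j) (lt_of_lt_of_le (hz j).2 h3)
        exact mul_pos (by linarith) (by linarith)) (by
      rw [hKe, hNe hy1, hB0, hFe]; ring)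
  have hyneg : (y - yA) * (y - ζ 0) * (y - ζ 1) < 0 :=
    mul_neg_of_neg_of_pos (mul_neg_of_neg_of_pos (by linarith) (by linarith [hζ0.2]))
      (by linarith [hζ1.2])
  have hdpos : 0 < (d - yA) * (d - ζ 0) * (d - ζ 1) := mul_pos_of_neg_of_neg
    (mul_neg_of_neg_of_pos (by linarith) (by linarith [hζ0.2])) (by linarith [hζ1.1])
  have hdpos' : 0 < (d' - yA) * (d' - ζ 0) * (d' - ζ 1) := mul_pos_of_neg_of_neg
    (mul_neg_of_neg_of_pos (by linarith) (by linarith [hζ0.2])) (by linarith [hζ1.1])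
  refine not_four_sign_changes hKd (a := -1) (b := 0) (by norm_num) hWy0 hWy1 hWy ?_ ?_ ?_ ?_ ?_
  · rw [e₁]; exact mul_neg_of_neg_of_pos (by linarith) ht₁
  · rw [e₂]; exact mul_pos hNpos ht₂
  · rw [e₃]; exact mul_neg_of_neg_of_pos (mul_neg_of_pos_of_neg (pow_pos hWy0 _) hyneg) ht₃
  · rw [e₄]; exact mul_pos hdpos' ht₄
  · rw [e₅]
    exact mul_neg_of_neg_of_pos (mul_neg_of_pos_of_neg (pow_pos (by linarith) _) hyneg) ht₅

end NLSWhitham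
end

noncomputable section

namespace NLSWhitham

/-! ### Genus 0 and 1 -/

lemma isGaps_zero {a b : ℝ} (h : a < b) : IsGaps ![a] ![b] :=
  ⟨fun i => by fin_cases i; exact h, fun i j hij => by fin_cases i; fin_cases j; simp at hij⟩

lemma isGaps_one {a b c d : ℝ} (hab : a < b) (hbc : b < c) (hcd : c < d) :
    IsGaps ![a, c] ![b, d] :=
  ⟨fun i => by fin_cases i <;> assumption, fun i j hij => by
    fin_cases i <;> fin_cases j <;> first | (simp at hij; done) | exact hbc⟩

lemma genus_zero_speed {a b s : ℝ} (h : a < b) (hs : GapSpeed ![a] ![b] a s) :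
    s = (3 * a + b) / 4 := by
  obtain ⟨F, hF, h0⟩ := hs
  obtain ⟨ζ, -, -, h1, h2⟩ := hF.exists_roots_of_eval (isGaps_zero h) h0
    fun i => (isGaps_zero h).not_mem_Ioo ⟨0, Or.inl rfl⟩ i
  simp [endSum, endSqSum] at h1 h2
  have h3 : ζ 0 = s + (b - a) / 2 := by linarith
  rw [h3] at h2
  refine mul_left_cancel₀ (sub_ne_zero.2 h.ne') ?_
  linear_combination h2

open Polynomial in
lemma eval_derivative_prod (lo hi : Fin 2 → ℝ) (z : ℝ) :
    HasDerivAt (fun z => ∏ i, (z - lo i) * (z - hi i))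
      ((derivative (∏ i, (X - C (lo i)) * (X - C (hi i)) : ℝ[X])).eval z) z := by
  have := (∏ i, (X - C (lo i)) * (X - C (hi i)) : ℝ[X]).hasDerivAt z
  simpa [eval_prod] using this

open Polynomial in
/-- In genus 1, `Q - σ₁ / 4 * P` is a quarter of the derivative of the polynomial of the curve. -/
lemma isSpeedPoly_derivative {lo hi : Fin 2 → ℝ} (h : IsGaps lo hi) :
    IsSpeedPoly lo hi (endSum lo hi / 4)
      (C (1 / 4) * derivative (∏ i, (X - C (lo i)) * (X - C (hi i)) : ℝ[X])) := by
  set q : ℝ[X] := ∏ i, (X - C (lo i)) * (X - C (hi i)) with hq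
  have e : q = X ^ 4 - C (endSum lo hi) * X ^ 3 +
      C ((endSum lo hi ^ 2 - endSqSum lo hi) / 2) * X ^ 2 -
      C (lo 0 * hi 0 * (lo 1 + hi 1) + lo 1 * hi 1 * (lo 0 + hi 0)) * X +
      C (lo 0 * hi 0 * (lo 1 * hi 1)) := by
    refine funext fun z => ?_
    simp [hq, endSum, endSqSum]
    ring
  have e2 : C (1 / 4) * derivative q = C 1 * X ^ 3 + C (-(endSum lo hi / 2 + endSum lo hi / 4)) * X ^ 2 +
      C (endSum lo hi ^ 2 / 8 - endSqSum lo hi / 4 + endSum lo hi / 4 * (endSum lo hi / 2)) * X +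
      C (-(lo 0 * hi 0 * (lo 1 + hi 1) + lo 1 * hi 1 * (lo 0 + hi 0)) / 4) := by
    rw [e]
    refine funext fun z => ?_
    simp
    ring
  have hd : (C (1 / 4) * derivative q).natDegree = 3 := by
    rw [e2]; exact natDegree_cubic one_ne_zero
  refine ⟨?_, hd, ?_, ?_, fun i => ?_⟩
  · rw [Monic, leadingCoeff, hd, e2]
    simp only [coeff_add, coeff_C_mul, coeff_X_pow, coeff_X, coeff_C]; norm_num
  · rw [e2]; simp only [coeff_add, coeff_C_mul, coeff_X_pow, coeff_X, coeff_C]; norm_num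
  · rw [e2]; simp only [coeff_add, coeff_C_mul, coeff_X_pow, coeff_X, coeff_C]; norm_num
  · rw [gapPeriod_C_mul, mul_eq_zero]
    right
    have hlt := h.lt i
    have hcont : ContinuousOn (fun z => (derivative q).eval z / √(restProd lo hi i z))
      (Icc (lo i) (hi i)) := h.continuousOn_div_sqrt i (by fun_prop)
    have hmu : ∀ z, ∏ i, (z - lo i) * (z - hi i) =
        -((z - lo i) * (hi i - z)) * restProd lo hi i z := fun z => by
      rw [Fin.prod_univ_succAbove _ i, restProd]; ring
    have hint := intervalIntegrable_div_sqrt hlt hcont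
    have h1 : ∀ z ∈ Ioo (lo i) (hi i),
        HasDerivAt (fun z => (-2) * √(-∏ i, (z - lo i) * (z - hi i)))
        ((derivative q).eval z / √(restProd lo hi i z) / √((z - lo i) * (hi i - z))) z := by
      intro z hz
      have hr := h.restProd_pos i (Ioo_subset_Icc_self hz)
      have hw : 0 < (z - lo i) * (hi i - z) := mul_pos (by linarith [hz.1]) (by linarith [hz.2])
      have hne : -∏ i, (z - lo i) * (z - hi i) ≠ 0 := by
        rw [hmu, neg_mul, neg_neg]; exact (mul_pos hw hr).ne'
      have h2 := (((eval_derivative_prod lo hi z).fun_neg).sqrt hne).const_mul (-2)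
      refine h2.congr_deriv ?_
      rw [hmu, show -(-((z - lo i) * (hi i - z)) * restProd lo hi i z) =
        (z - lo i) * (hi i - z) * restProd lo hi i z by ring, Real.sqrt_mul hw.le, ← hq]
      have := (Real.sqrt_pos.2 hr).ne'
      have := (Real.sqrt_pos.2 hw).ne'
      field_simp
    have h3 := intervalIntegral.integral_eq_sub_of_hasDerivAt_of_le hlt.le
      (f := fun z => (-2) * √(-∏ i, (z - lo i) * (z - hi i))) (by fun_prop) h1 hint
    rw [integral_div_sqrt hlt fun z => (derivative q).eval z / √(restProd lo hi i z)] at h3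
    rw [gapPeriod, h3, hmu, hmu]
    simp

/-- The formula for a speed in genus 1. -/
lemma genus_one_speed {a b c d s : ℝ} (hab : a < b) (hbc : b < c) (hcd : c < d)
    (hs : GapSpeed ![a, c] ![b, d] c s) {P : Polynomial ℝ} (hP : IsMomPoly ![a, c] ![b, d] P) :
    (s - (a + b + c + d) / 4) * P.eval c = (c - a) * (c - b) * (c - d) / 4 := by
  obtain ⟨F, hF, h0⟩ := hs
  have h := isGaps_one hab hbc hcd
  have hS : endSum ![a, c] ![b, d] = a + b + c + d := by simp [endSum]; ring
  have h1 := (isSpeedPoly_derivative h).change h hP s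
  rw [hF.unique h h1] at h0
  have h2 := (eval_derivative_prod ![a, c] ![b, d] c).unique
    (f₁' := (c - a) * (c - b) * (c - d)) (by
      simp only [Fin.prod_univ_two, Matrix.cons_val_zero, Matrix.cons_val_one]
      have : HasDerivAt (fun z : ℝ => (z - a) * (z - b) * ((z - c) * (z - d))) _ c :=
        ((((hasDerivAt_id c).sub_const a).mul ((hasDerivAt_id c).sub_const b)).mul
          (((hasDerivAt_id c).sub_const c).mul ((hasDerivAt_id c).sub_const d)))
      refine this.congr_deriv ?_
      simp)
  rw [Polynomial.eval_add, Polynomial.eval_mul, Polynomial.eval_mul, Polynomial.eval_C, h2,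
    Polynomial.eval_C, hS] at h0
  linear_combination -h0

lemma genus_one_mom_neg {a b c d : ℝ} (hab : a < b) (hbc : b < c) (hcd : c < d) {P : Polynomial ℝ}
    (hP : IsMomPoly ![a, c] ![b, d] P) : P.eval c < 0 := by
  obtain ⟨ρ, hρ, rfl⟩ := hP.exists_roots (isGaps_one hab hbc hcd)
  have h0 := hρ 0
  have h1 := hρ 1
  simp at h0 h1
  rw [Polynomial.eval_prod, Fin.prod_univ_succ]
  simp only [Polynomial.eval_sub, Polynomial.eval_X, Polynomial.eval_C, Finset.univ_unique,
    Finset.prod_singleton]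
  exact mul_neg_of_pos_of_neg (by linarith) (show c - ρ 1 < 0 by linarith)

lemma genus_one_speed_gt {a b c d s : ℝ} (hab : a < b) (hbc : b < c) (hcd : c < d)
    (hs : GapSpeed ![a, c] ![b, d] c s) : (a + b + c + d) / 4 < s := by
  obtain ⟨P, hP⟩ := (isGaps_one hab hbc hcd).exists_isMomPoly
  have h1 := genus_one_speed hab hbc hcd hs hP
  have h2 := genus_one_mom_neg hab hbc hcd hP
  have h3 : (c - a) * (c - b) * (c - d) / 4 < 0 := by
    have := mul_pos (mul_pos (show 0 < c - a by linarith) (show 0 < c - b by linarith))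
      (show 0 < d - c by linarith)
    linarith
  rw [← h1] at h3
  have := pos_of_mul_neg_left h3 h2.le
  linarith

lemma genus_one_vieta {a b c d s : ℝ} (hab : a < b) (hbc : b < c) (hcd : c < d)
    (hs : GapSpeed ![a, c] ![b, d] c s) : ∃ x ∈ Ioo a b, ∃ y ∈ Ioo c d,
      c + x + y = (a + b + c + d) / 2 + s ∧
      c ^ 2 + x ^ 2 + y ^ 2 = s ^ 2 + (a ^ 2 + b ^ 2 + c ^ 2 + d ^ 2) / 2 := by
  have h := isGaps_one hab hbc hcd
  obtain ⟨F, hF, h0⟩ := hs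
  obtain ⟨ζ, hζ, -, h1, h2⟩ := hF.exists_roots_of_eval h h0
    fun i => h.not_mem_Ioo ⟨1, Or.inl rfl⟩ i
  refine ⟨ζ 0, hζ 0, ζ 1, hζ 1, ?_, ?_⟩
  · simp [endSum] at h1; linarith
  · simp [endSqSum] at h2; linarith

/-- The speed in the limit of a closing gap at the top. -/
lemma genus_one_harmonic {a b d : ℝ} (hab : a < b) (hbd : b < d) {ε : ℝ} (hε : 0 < ε) :
    ∃ v₀ ∈ Ioo b d, ∀ v ∈ Ioo v₀ d, ∀ s, GapSpeed ![a, v] ![b, d] v s →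
      |s - (d - ((b - a) / 2) ^ 2 / (2 * (d - (a + b) / 2)))| ≤ ε := by
  set K₁ : ℝ × ℝ → ℝ := fun p => (a + b + p.1 + d) / 2 - p.1 - p.2 with hK₁
  set K₂ : ℝ × ℝ → ℝ := fun p => (a ^ 2 + b ^ 2 + p.1 ^ 2 + d ^ 2) / 2 - p.1 ^ 2 - p.2 ^ 2 with hK₂
  have hne : K₁ (d, d) < 0 := by simp only [hK₁]; linarith
  have hlim : (K₂ (d, d) / K₁ (d, d) - K₁ (d, d)) / 2 =
      d - ((b - a) / 2) ^ 2 / (2 * (d - (a + b) / 2)) := by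
    have h4 : d - (a + b) / 2 ≠ 0 := by linarith
    have e1 : K₁ (d, d) = -(d - (a + b) / 2) := by simp only [hK₁]; ring
    have e2 : K₂ (d, d) = (d - (a + b) / 2) ^ 2 - 2 * d * (d - (a + b) / 2) +
        ((b - a) / 2) ^ 2 := by simp only [hK₂]; ring
    rw [e1, e2]
    generalize d - (a + b) / 2 = k at h4
    generalize (b - a) / 2 = h
    field_simp
    ring
  have hc : ContinuousAt (fun p => (K₂ p / K₁ p - K₁ p) / 2) (d, d) := by
    have c1 : ContinuousAt K₁ (d, d) := by fun_prop
    have c2 : ContinuousAt K₂ (d, d) := by fun_prop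
    exact ((c2.div c1 hne.ne).sub c1).div_const 2
  have hc1 : ∀ᶠ p in 𝓝 (d, d), K₁ p < 0 :=
    (show ContinuousAt K₁ (d, d) by fun_prop).eventually (Iio_mem_nhds hne)
  have hev := (Metric.tendsto_nhds.1 hc.tendsto ε hε).and hc1
  rw [Metric.eventually_nhds_iff] at hev
  obtain ⟨δ, hδ, hball⟩ := hev
  refine ⟨max ((b + d) / 2) (d - δ), ⟨lt_max_of_lt_left (by linarith),
    max_lt (by linarith) (by linarith)⟩, fun v hv s hs => ?_⟩
  have hv1 := (max_lt_iff.1 hv.1).1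
  have hv2 := (max_lt_iff.1 hv.1).2
  obtain ⟨x, hx, y, hy, h1, h2⟩ := genus_one_vieta hab (by linarith) hv.2 hs
  have hd : dist (v, y) (d, d) < δ := by
    rw [Prod.dist_eq, max_lt_iff, Real.dist_eq, Real.dist_eq]
    constructor <;> rw [abs_lt] <;> constructor <;> linarith [hy.1, hy.2, hv.2]
  obtain ⟨h3, h4⟩ := hball hd
  have e1 : x - s = K₁ (v, y) := by simp only [hK₁]; linarith
  have e2 : (x - s) * (x + s) = K₂ (v, y) := by simp only [hK₂]; linarith
  have e3 : s = (K₂ (v, y) / K₁ (v, y) - K₁ (v, y)) / 2 := by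
    rw [← e2, ← e1, mul_div_cancel_left₀ _ (by rw [e1]; exact h4.ne)]; ring
  rw [← hlim]
  rw [Real.dist_eq, ← e3] at h3
  exact h3.le

end NLSWhitham
end

noncomputable section

namespace NLSWhitham

lemma IsMomPoly.genus_one_eval {a b c d : ℝ} {P : Polynomial ℝ} (hP : IsMomPoly ![a, c] ![b, d] P)
    (z : ℝ) : P.eval z = P.eval c + (z - c) * (z + c - (a + b + c + d) / 2) := by
  have h1 := hP.coeff_one
  have h2 : P.coeff 2 = 1 := hP.coeff_top
  simp [endSum] at h1
  have h3 : P.natDegree = 2 := hP.natDegree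
  rw [Polynomial.eval_eq_sum_range, Polynomial.eval_eq_sum_range, h3]
  simp only [Finset.sum_range_succ, Finset.sum_range_zero, h1, h2]
  ring

lemma continuous_genus_one_weight {a b c d : ℝ} (hab : a < b) (hbc : b < c) (hcd : c < d)
    {f : ℝ → ℝ} (hf : Continuous f) :
    Continuous fun θ => f (gapPoint c d θ) / √((gapPoint c d θ - a) * (gapPoint c d θ - b)) := by
  have hx := continuous_gapPoint c d
  refine (hf.comp hx).div (by fun_prop) fun θ => (Real.sqrt_pos.2 ?_).ne'
  have := (gapPoint_mem_Icc hcd.le θ).1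
  exact mul_pos (by linarith) (by linarith)

lemma genus_one_period {a b c d : ℝ} (hab : a < b) (hbc : b < c) (hcd : c < d) {P : Polynomial ℝ}
    (hP : IsMomPoly ![a, c] ![b, d] P) :
    (-P.eval c) * (∫ θ in 0..Real.pi, 1 / √((gapPoint c d θ - a) * (gapPoint c d θ - b))) =
      ∫ θ in 0..Real.pi, (gapPoint c d θ - c) * (gapPoint c d θ + c - (a + b + c + d) / 2) /
        √((gapPoint c d θ - a) * (gapPoint c d θ - b)) := by
  have h1 := hP.period 1
  have hr : ∀ z, restProd ![a, c] ![b, d] 1 z = (z - a) * (z - b) := fun z => by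
    simp [restProd]
  simp only [gapPeriod, hr, Matrix.cons_val_one, Matrix.cons_val_fin_one] at h1
  have i1 := (continuous_genus_one_weight hab hbc hcd
    (f := fun _ => 1) (by fun_prop)).intervalIntegrable (μ := MeasureTheory.volume) 0 Real.pi
  have i2 := (continuous_genus_one_weight hab hbc hcd
    (f := fun z => (z - c) * (z + c - (a + b + c + d) / 2)) (by fun_prop)).intervalIntegrable
    (μ := MeasureTheory.volume) 0 Real.pi
  have h2 := intervalIntegral.integral_add (i1.const_mul (P.eval c)) i2
  rw [intervalIntegral.integral_const_mul] at h2
  have h3 : ∀ θ, P.eval (gapPoint c d θ) / √((gapPoint c d θ - a) * (gapPoint c d θ - b)) =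
      P.eval c * (1 / √((gapPoint c d θ - a) * (gapPoint c d θ - b))) +
      (gapPoint c d θ - c) * (gapPoint c d θ + c - (a + b + c + d) / 2) /
        √((gapPoint c d θ - a) * (gapPoint c d θ - b)) := fun θ => by
    rw [hP.genus_one_eval (gapPoint c d θ)]; ring
  rw [intervalIntegral.integral_congr fun θ _ => h3 θ, h2] at h1
  linarith

lemma integral_gapPoint_sub (c d : ℝ) :
    ∫ θ in 0..Real.pi, (gapPoint c d θ - c) = Real.pi * ((d - c) / 2) := by
  rw [intervalIntegral.integral_sub ((continuous_gapPoint c d).intervalIntegrable _ _) (by simp),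
    integral_gapPoint]
  simp
  ring

lemma genus_one_mom_le {a b c d δ : ℝ} (hab : a < b) (hbc : b < c) (hcd : c < d) (hδ : 0 < δ)
    (hδ' : δ ≤ 2 * c - (a + b + c + d) / 2) {P : Polynomial ℝ}
    (hP : IsMomPoly ![a, c] ![b, d] P) :
    δ * (d - c) * √((c - a) * (c - b)) ≤ 2 * √((d - a) * (d - b)) * (-P.eval c) := by
  have hV : 0 < √((c - a) * (c - b)) := Real.sqrt_pos.2 (mul_pos (by linarith) (by linarith))
  have hW : 0 < √((d - a) * (d - b)) := Real.sqrt_pos.2 (mul_pos (by linarith) (by linarith))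
  have hn := genus_one_mom_neg hab hbc hcd hP
  have hp := genus_one_period hab hbc hcd hP
  set V := √((c - a) * (c - b))
  set W := √((d - a) * (d - b))
  have hle : ∀ θ, V ≤ √((gapPoint c d θ - a) * (gapPoint c d θ - b)) ∧
      √((gapPoint c d θ - a) * (gapPoint c d θ - b)) ≤ W := fun θ => by
    obtain ⟨h1, h2⟩ := gapPoint_mem_Icc hcd.le θ
    exact ⟨Real.sqrt_le_sqrt (mul_le_mul (by linarith) (by linarith) (by linarith) (by linarith)),
      Real.sqrt_le_sqrt (mul_le_mul (by linarith) (by linarith) (by linarith) (by linarith))⟩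
  have c1 := continuous_genus_one_weight hab hbc hcd (f := fun _ => 1) (by fun_prop)
  have c2 := continuous_genus_one_weight hab hbc hcd
    (f := fun z => (z - c) * (z + c - (a + b + c + d) / 2)) (by fun_prop)
  have hI : (∫ θ in 0..Real.pi, 1 / √((gapPoint c d θ - a) * (gapPoint c d θ - b))) ≤
      Real.pi * (1 / V) := by
    have := intervalIntegral.integral_mono_on Real.pi_pos.le (c1.intervalIntegrable (μ :=
      MeasureTheory.volume) 0 Real.pi) (g := fun _ => 1 / V) (by simp) fun θ _ =>
        one_div_le_one_div_of_le hV (hle θ).1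
    simpa using this
  have hJ : δ / W * (Real.pi * ((d - c) / 2)) ≤ ∫ θ in 0..Real.pi,
      (gapPoint c d θ - c) * (gapPoint c d θ + c - (a + b + c + d) / 2) /
        √((gapPoint c d θ - a) * (gapPoint c d θ - b)) := by
    rw [← integral_gapPoint_sub, ← intervalIntegral.integral_const_mul]
    have hx := continuous_gapPoint c d
    refine intervalIntegral.integral_mono_on Real.pi_pos.le
      (Continuous.intervalIntegrable (by fun_prop) _ _) (c2.intervalIntegrable _ _) fun θ _ => ?_
    obtain ⟨h1, h2⟩ := gapPoint_mem_Icc hcd.le θ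
    obtain ⟨h3, h4⟩ := hle θ
    have h5 : 0 < √((gapPoint c d θ - a) * (gapPoint c d θ - b)) := hV.trans_le h3
    rw [div_mul_eq_mul_div, mul_comm δ]
    exact div_le_div₀ (mul_nonneg (by linarith) (by linarith))
      (mul_le_mul_of_nonneg_left (by linarith) (by linarith)) h5 h4
  have h1 : δ / W * (Real.pi * ((d - c) / 2)) ≤ (-P.eval c) * (Real.pi * (1 / V)) :=
    hJ.trans (hp ▸ mul_le_mul_of_nonneg_left hI (by linarith))
  have h2 : Real.pi / (2 * V * W) * (δ * (d - c) * V) ≤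
      Real.pi / (2 * V * W) * (2 * W * (-P.eval c)) := by
    convert h1 using 1 <;> field_simp
  exact le_of_mul_le_mul_left h2 (by have := Real.pi_pos; positivity)

/-- The speed in the limit of a closing band. -/
lemma genus_one_soliton {a b d : ℝ} (hab : a < b) (hbd : b < d) (hb : (a + d) / 2 < b) {ε : ℝ}
    (hε : 0 < ε) :
    ∃ v₀ ∈ Ioo b d, ∀ v ∈ Ioo b v₀, ∀ s, GapSpeed ![a, v] ![b, d] v s →
      |s - (a + 2 * b + d) / 4| ≤ ε := by
  set δ := b - (a + d) / 2 with hδ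
  have hδ0 : 0 < δ := by linarith
  set f : ℝ → ℝ := fun v => (v - b) / 4 +
    √((d - a) * (d - b)) * √((v - a) * (v - b)) / (2 * δ) with hf
  have hc : Continuous f := by fun_prop
  have hf0 : f b = 0 := by simp [hf]
  have hev : ∀ᶠ v in 𝓝 b, f v < ε := hc.continuousAt.eventually (Iio_mem_nhds (by rw [hf0]; exact hε))
  obtain ⟨η, hη, hball⟩ := Metric.eventually_nhds_iff.1 hev
  refine ⟨min ((b + d) / 2) (b + η), ⟨lt_min (by linarith) (by linarith),
    (min_le_left _ _).trans_lt (by linarith)⟩, fun v hv s hs => ?_⟩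
  have hv1 := (lt_min_iff.1 hv.2).1
  have hv2 := (lt_min_iff.1 hv.2).2
  have hvd : v < d := by linarith
  obtain ⟨P, hP⟩ := (isGaps_one hab hv.1 hvd).exists_isMomPoly
  have h1 := genus_one_speed hab hv.1 hvd hs hP
  have h2 := genus_one_speed_gt hab hv.1 hvd hs
  have h3 := genus_one_mom_le hab hv.1 hvd hδ0 (by linarith [hv.1]) hP
  have h4 := genus_one_mom_neg hab hv.1 hvd hP
  have h5 : f v < ε := hball (by rw [Real.dist_eq, abs_lt]; constructor <;> linarith [hv.1])
  have hV2 : √((v - a) * (v - b)) ^ 2 = (v - a) * (v - b) :=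
    Real.sq_sqrt (mul_nonneg (by linarith [hv.1]) (by linarith [hv.1]))
  have hV : 0 < √((v - a) * (v - b)) :=
    Real.sqrt_pos.2 (mul_pos (by linarith [hv.1]) (by linarith [hv.1]))
  simp only [hf] at h5
  set V := √((v - a) * (v - b))
  set W := √((d - a) * (d - b))
  have h6 : s - (a + b + v + d) / 4 ≤ W * V / (2 * δ) := by
    rw [le_div_iff₀ (by linarith)]
    have h7 : (s - (a + b + v + d) / 4) * (-P.eval v) = V ^ 2 * (d - v) / 4 := by
      rw [hV2]; linarith
    have h8 : 0 < s - (a + b + v + d) / 4 := by linarith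
    have h9 := mul_le_mul_of_nonneg_left h3 h8.le
    have h10 : ((d - v) * V) * ((s - (a + b + v + d) / 4) * (2 * δ)) ≤ ((d - v) * V) * (W * V) := by
      have : (s - (a + b + v + d) / 4) * (2 * W * -P.eval v) = W * (V ^ 2 * (d - v) / 2) := by
        linear_combination 2 * W * h7
      rw [this] at h9
      linarith
    exact le_of_mul_le_mul_left h10 (mul_pos (by linarith) hV)
  rw [abs_le]
  constructor <;> linarith [hv.1]

/-- Speeds in genus 1 at a right gap, when the gaps lie on different sides of the center. -/
lemma genus_one_separated {a b c d s : ℝ} (hab : a < b) (hbm : b < (a + d) / 2)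
    (hmc : (a + d) / 2 < c) (hcd : c < d) (hs : GapSpeed ![a, c] ![b, d] c s) :
    (a + d) / 2 < s := by
  have hbc : b < c := by linarith
  obtain ⟨P, hP⟩ := (isGaps_one hab hbc hcd).exists_isMomPoly
  have hn := genus_one_mom_neg hab hbc hcd hP
  have hp := genus_one_period hab hbc hcd hP
  have h1 := genus_one_speed hab hbc hcd hs hP
  set Δ := (c + d) / 2 - (a + b) / 2 with hΔ
  have hΔ0 : 0 < Δ := by linarith
  have c1 := continuous_genus_one_weight hab hbc hcd (f := fun _ => 1) (by fun_prop)
  have c2 := continuous_genus_one_weight hab hbc hcd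
    (f := fun z => (z - c) * (z + c - (a + b + c + d) / 2)) (by fun_prop)
  have i1 := c1.intervalIntegrable (μ := MeasureTheory.volume) 0 Real.pi
  have i2 := c2.intervalIntegrable (μ := MeasureTheory.volume) 0 Real.pi
  set M := 1 / √(((c + d) / 2 - a) * ((c + d) / 2 - b))
  have hx := continuous_gapPoint c d
  have i3 : IntervalIntegrable (fun θ => gapPoint c d θ - (c + d) / 2) MeasureTheory.volume 0
    Real.pi := Continuous.intervalIntegrable (by fun_prop) _ _
  have h0 : ∫ θ in 0..Real.pi, (gapPoint c d θ - (c + d) / 2) = 0 := by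
    rw [intervalIntegral.integral_sub (hx.intervalIntegrable _ _) (by simp), integral_gapPoint]
    simp
    ring
  have hmono : (∫ θ in 0..Real.pi, (gapPoint c d θ - c) *
      (gapPoint c d θ + c - (a + b + c + d) / 2) /
        √((gapPoint c d θ - a) * (gapPoint c d θ - b))) ≤
      ∫ θ in 0..Real.pi, ((d - c) / 2 * Δ *
        (1 / √((gapPoint c d θ - a) * (gapPoint c d θ - b))) +
        Δ * M * (gapPoint c d θ - (c + d) / 2)) := by
    refine intervalIntegral.integral_mono_on Real.pi_pos.le i2
      ((i1.const_mul _).add (i3.const_mul _)) fun θ _ => ?_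
    obtain ⟨h1, h2⟩ := gapPoint_mem_Icc hcd.le θ
    set z := gapPoint c d θ
    have hz : 0 < √((z - a) * (z - b)) := Real.sqrt_pos.2 (mul_pos (by linarith) (by linarith))
    have hm : 0 < √(((c + d) / 2 - a) * ((c + d) / 2 - b)) :=
      Real.sqrt_pos.2 (mul_pos (by linarith) (by linarith))
    have hA : (z - c) * (z + c - (a + b + c + d) / 2) =
        (d - c) / 2 * Δ + Δ * (z - (c + d) / 2) - (z - c) * (d - z) := by rw [hΔ]; ring
    have hA' : (z - c) * (z + c - (a + b + c + d) / 2) ≤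
        (d - c) / 2 * Δ + Δ * (z - (c + d) / 2) := by
      linarith [mul_nonneg (sub_nonneg.2 h1) (sub_nonneg.2 h2)]
    have hB : (z - (c + d) / 2) * (1 / √((z - a) * (z - b))) ≤ (z - (c + d) / 2) * M := by
      rcases le_total z ((c + d) / 2) with h3 | h3
      · refine mul_le_mul_of_nonpos_left (one_div_le_one_div_of_le hz (Real.sqrt_le_sqrt
          (mul_le_mul ?_ ?_ ?_ ?_))) ?_ <;> linarith
      · refine mul_le_mul_of_nonneg_left (one_div_le_one_div_of_le hm (Real.sqrt_le_sqrt
          (mul_le_mul ?_ ?_ ?_ ?_))) ?_ <;> linarith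
    calc _ = (z - c) * (z + c - (a + b + c + d) / 2) * (1 / √((z - a) * (z - b))) := by ring
      _ ≤ ((d - c) / 2 * Δ + Δ * (z - (c + d) / 2)) * (1 / √((z - a) * (z - b))) :=
        mul_le_mul_of_nonneg_right hA' (by positivity)
      _ ≤ _ := by linarith [mul_le_mul_of_nonneg_left hB hΔ0.le]
  rw [intervalIntegral.integral_add (i1.const_mul _) (i3.const_mul _),
    intervalIntegral.integral_const_mul, intervalIntegral.integral_const_mul, h0, mul_zero,
    add_zero, ← hp] at hmono
  have hI : 0 < ∫ θ in 0..Real.pi, 1 / √((gapPoint c d θ - a) * (gapPoint c d θ - b)) :=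
    intervalIntegral.intervalIntegral_pos_of_pos_on i1 (fun θ _ => by
      obtain ⟨h1, h2⟩ := gapPoint_mem_Icc hcd.le θ
      exact one_div_pos.2 (Real.sqrt_pos.2 (mul_pos (by linarith) (by linarith)))) Real.pi_pos
  have h2 : -P.eval c ≤ (d - c) / 2 * Δ := le_of_mul_le_mul_right hmono hI
  have h3 := genus_one_speed_gt hab hbc hcd hs
  have h4 : (c - a) * (c - b) * (d - c) / 4 ≤ (s - (a + b + c + d) / 4) * ((d - c) / 2 * Δ) := by
    have := mul_le_mul_of_nonneg_left h2 (show 0 ≤ s - (a + b + c + d) / 4 by linarith)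
    linarith
  have h5 : (c - a) * (c - b) ≤ (s - (a + b + c + d) / 4) * (2 * Δ) := by
    refine le_of_mul_le_mul_left ?_ (show 0 < (d - c) / 4 by linarith)
    linarith
  have h6 : ((a + d) / 2 - (a + b + c + d) / 4) * (2 * Δ) < (c - a) * (c - b) := by
    rw [hΔ]
    obtain ⟨p, rfl⟩ : ∃ p, b = (a + d) / 2 - p := ⟨(a + d) / 2 - b, by ring⟩
    obtain ⟨q, rfl⟩ : ∃ q, c = (a + d) / 2 + q := ⟨c - (a + d) / 2, by ring⟩
    obtain ⟨e, rfl⟩ : ∃ e, d = a + 2 * e := ⟨(d - a) / 2, by ring⟩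
    have hp0 : 0 < p := by linarith
    have hq0 : 0 < q := by linarith
    have hpe : p < e := by linarith
    linarith [mul_pos hp0 hq0, mul_pos hp0 (sub_pos.2 hpe), mul_pos hq0 (hp0.trans hpe),
      mul_pos hp0 hp0, mul_pos hq0 hq0]
  have h7 := h6.trans_le h5
  have := lt_of_mul_lt_mul_right h7 (by linarith)
  linarith

end NLSWhitham
end

noncomputable section

namespace NLSWhitham

/-! ### Speeds for a finite set of branch points -/

/-- `s` is the characteristic speed at the branch point `y` for the set `B` of branch points. -/
def SpeedAt (B : Finset ℝ) (y s : ℝ) : Prop :=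
  ∃ (g : ℕ) (b : Fin (2 * g + 2) → ℝ) (m : Fin (2 * g + 2)),
    StrictMono b ∧ range b = (B : Set ℝ) ∧ b m = y ∧ GapSpeed (gapLo b) (gapHi b) y s

lemma HasSpeed.speedAt {n : ℕ} {r : Fin n → ℝ} {k : Fin n} {s : ℝ} (h : HasSpeed r k s) :
    SpeedAt (branchPoints r) (r k) s := by
  obtain ⟨g, b, m, hb, hr, hm, hs⟩ := h
  exact ⟨g, b, m, hb, hr, hm, hm ▸ hs.gapSpeed hb⟩

lemma SpeedAt.mem {B : Finset ℝ} {y s : ℝ} (h : SpeedAt B y s) : y ∈ B := by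
  obtain ⟨g, b, m, hb, hr, rfl, -⟩ := h
  rw [← Finset.mem_coe, ← hr]
  exact mem_range_self m

lemma card_of_range_eq {n : ℕ} {b : Fin n → ℝ} (hb : StrictMono b) {B : Finset ℝ}
    (hr : range b = (B : Set ℝ)) : B.card = n := by
  have : B = Finset.univ.image b := by
    rw [← Finset.coe_inj, Finset.coe_image, Finset.coe_univ, image_univ, hr]
  rw [this, Finset.card_image_of_injective _ hb.injective]
  simp

lemma SpeedAt.gapSpeed {B : Finset ℝ} {y s : ℝ} (h : SpeedAt B y s) {g : ℕ}
    {b : Fin (2 * g + 2) → ℝ} (hb : StrictMono b) (hr : range b = (B : Set ℝ)) :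
    GapSpeed (gapLo b) (gapHi b) y s := by
  obtain ⟨g', b', m, hb', hr', hm, hs⟩ := h
  have h1 := card_of_range_eq hb hr
  have h2 := card_of_range_eq hb' hr'
  obtain rfl : g = g' := by omega
  rwa [(hb.range_inj hb').1 (hr.trans hr'.symm)]

lemma SpeedAt.lt {B : Finset ℝ} {y y' s s' : ℝ} (h : SpeedAt B y s) (h' : SpeedAt B y' s')
    (hy : y < y') : s < s' := by
  obtain ⟨g, b, m, hb, hr, rfl, hs⟩ := h
  have hs' := h'.gapSpeed hb hr
  obtain ⟨m', rfl⟩ : y' ∈ range b := by rw [hr]; exact h'.mem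
  have hg := isGaps_of_strictMono hb
  exact hs.lt hg hs' (hg.not_mem_Ioo (exists_eq_gapLo_or_gapHi b m))
    (hg.not_mem_Ioo (exists_eq_gapLo_or_gapHi b m')) hy

lemma SpeedAt.abs_sub_le {B : Finset ℝ} {y s a d : ℝ} (h : SpeedAt B y s)
    (hB : ∀ x ∈ B, x ∈ Icc a d) : |s - y| ≤ (d - a) / 2 := by
  obtain ⟨g, b, m, hb, hr, rfl, hs⟩ := h
  have hg := isGaps_of_strictMono hb
  have hmem : ∀ k, b k ∈ Icc a d := fun k => hB _ (by
    rw [← Finset.mem_coe, ← hr]; exact mem_range_self k)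
  have h1 := hs.abs_sub_le hg (hg.not_mem_Ioo (exists_eq_gapLo_or_gapHi b m))
  have h2 : gapHi b (Fin.last g) ≤ d := (hmem _).2
  have h3 : a ≤ gapLo b 0 := (hmem _).1
  linarith

lemma SpeedAt.reflect {B : Finset ℝ} {y s : ℝ} (h : SpeedAt B y s) (τ : ℝ) :
    SpeedAt (B.image fun x => τ - x) (τ - y) (τ - s) := by
  obtain ⟨g, b, m, hb, hr, rfl, hs⟩ := h
  have hg := isGaps_of_strictMono hb
  refine ⟨g, fun k => τ - b k.rev, m.rev, fun i j hij => ?_, ?_, by simp, ?_⟩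
  · exact sub_lt_sub_left (hb (Fin.rev_lt_rev.2 hij)) τ
  · rw [Finset.coe_image, ← hr, ← range_comp]
    exact Fin.revPerm.surjective.range_comp fun k => τ - b k
  · have := hs.reflect hg (hg.not_mem_Ioo (exists_eq_gapLo_or_gapHi b m)) τ
    convert this using 1
    · funext i
      refine congrArg (fun k => τ - b k) (Fin.ext ?_)
      simp [Fin.val_rev]; omega
    · funext i
      refine congrArg (fun k => τ - b k) (Fin.ext ?_)
      simp [Fin.val_rev]; omega

lemma strictMono_pair {a b : ℝ} (h : a < b) : StrictMono ![a, b] := by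
  refine Fin.strictMono_iff_lt_succ.2 fun i => ?_
  fin_cases i; exact h

lemma strictMono_four {a b c d : ℝ} (hab : a < b) (hbc : b < c) (hcd : c < d) :
    StrictMono ![a, b, c, d] := by
  refine Fin.strictMono_iff_lt_succ.2 fun i => ?_
  fin_cases i <;> assumption

lemma SpeedAt.genus_zero {a b s : ℝ} (h : a < b) (hs : SpeedAt {a, b} a s) :
    s = (3 * a + b) / 4 := by
  have h1 := hs.gapSpeed (g := 0) (b := ![a, b]) (strictMono_pair h)
    (by ext; simp [or_comm])
  refine genus_zero_speed h ?_
  convert h1 using 1 <;> (funext i; fin_cases i; rfl)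

lemma SpeedAt.genus_one {a b c d s : ℝ} (hab : a < b) (hbc : b < c) (hcd : c < d)
    (hs : SpeedAt {a, b, c, d} c s) : GapSpeed ![a, c] ![b, d] c s := by
  have h1 := hs.gapSpeed (g := 1) (b := ![a, b, c, d]) (strictMono_four hab hbc hcd)
    (by ext; simp [Matrix.range_cons]; tauto)
  convert h1 using 1 <;> (funext i; fin_cases i <;> rfl)

/-- A lower bound for the speed at the left end of the last gap. -/
lemma GapSpeed.last_gt (g : ℕ) {lo hi : Fin (g + 2) → ℝ} (h : IsGaps lo hi) {s : ℝ}
    (hs : GapSpeed lo hi (lo (Fin.last (g + 1))) s) :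
    (lo 0 + hi (Fin.last g).castSucc + lo (Fin.last (g + 1)) + hi (Fin.last (g + 1))) / 4 < s := by
  induction g generalizing s with
  | zero =>
    have e1 : lo = ![lo 0, lo 1] := by funext i; fin_cases i <;> rfl
    have e2 : hi = ![hi 0, hi 1] := by funext i; fin_cases i <;> rfl
    rw [e1, e2] at hs
    exact genus_one_speed_gt (h.lt 0) (h.sep 0 1 (by simp)) (h.lt 1) hs
  | succ g ih =>
    have e' : lo (Fin.last (g + 2)) = lo ((1 : Fin (g + 1 + 2)).succAbove (Fin.last (g + 1))) :=
      congrArg lo (succAbove_one_succ (Fin.last g)).symm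
    have e : lo (Fin.last (g + 2)) = (fun i => lo ((1 : Fin (g + 1 + 2)).succAbove i))
        (Fin.last (g + 1)) := e'
    have hy := fun i => h.not_mem_Ioo ⟨Fin.last (g + 2), Or.inl rfl⟩ i
    obtain ⟨s', hs'⟩ := h.removeBand.exists_gapSpeed (y := lo (Fin.last (g + 2)))
      fun i => h.removeBand.not_mem_Ioo ⟨Fin.last _, Or.inl e⟩ i
    have h1 := GapSpeed.removeBand_le h hs hs' hy
      (h.lo_one_lt (Fin.last g) le_rfl)
    rw [e] at hs'
    have h2 := ih h.removeBand hs'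
    simp only [succAbove_one_zero] at h2
    rw [← e'] at h2
    exact h2.trans_le h1

/-- A lower bound for the speed of the second largest branch point. -/
lemma SpeedAt.gt_of_second {B : Finset ℝ} {a k y d s : ℝ} (hs : SpeedAt B y s) (hyd : y < d)
    (hd : d ∈ B) (hB : ∀ x ∈ B, x ≤ y ∨ x = d) (ha : ∀ x ∈ B, a ≤ x)
    (hk : ∃ r ∈ B, k ≤ r ∧ r < y) : (a + k + y + d) / 4 < s := by
  obtain ⟨g, b, m, hb, hr, rfl, hs⟩ := hs
  obtain ⟨r, hrB, hkr, hry⟩ := hk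
  have hmem : ∀ k, b k ∈ B := fun k => by rw [← Finset.mem_coe, ← hr]; exact mem_range_self k
  obtain ⟨i, rfl⟩ : d ∈ range b := by rw [hr]; exact hd
  obtain ⟨j, rfl⟩ : r ∈ range b := by rw [hr]; exact hrB
  have hij : j < m := hb.lt_iff_lt.1 hry
  have him : m < i := hb.lt_iff_lt.1 hyd
  have hlast : ∀ l, m < l → l = i := fun l hl => by
    rcases hB _ (hmem l) with h1 | h1
    · exact absurd (hb hl) h1.not_gt
    · exact hb.injective h1
  have hi1 : (i : ℕ) = m + 1 := by
    have := hlast ⟨m + 1, by omega⟩ (by simp [Fin.lt_def])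
    rw [← this]
  have hi2 : (i : ℕ) = 2 * g + 1 := by
    have := hlast ⟨2 * g + 1, by omega⟩ (by rw [Fin.lt_def] at *; simp only; omega)
    rw [← this]
  obtain ⟨g, rfl⟩ : ∃ n, g = n + 1 := ⟨g - 1, by rw [Fin.lt_def] at *; omega⟩
  have hm : b m = gapLo b (Fin.last (g + 1)) := by
    unfold gapLo; congr 1; ext; simp; omega
  have hi' : b i = gapHi b (Fin.last (g + 1)) := by
    unfold gapHi; congr 1; ext; simp; omega
  rw [hm] at hs
  have h1 := GapSpeed.last_gt g (isGaps_of_strictMono hb) hs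
  have h2 : b j ≤ gapHi b (Fin.last g).castSucc :=
    hb.monotone (by rw [Fin.le_def]; rw [Fin.lt_def] at *; simp; omega)
  have h3 : a ≤ gapLo b 0 := ha _ (hmem _)
  rw [← hm, ← hi'] at h1
  linarith

end NLSWhitham
end

noncomputable section

namespace NLSWhitham

/-! ### Comparison of two speeds in genus 2 -/

/-- The removal of the last band does not decrease the speeds of the branch points to its left. -/
lemma genus_two_removeBand {a b u c v d s s' : ℝ} (hab : a < b) (hbu : b < u) (huc : u < c)
    (hcv : c < v) (hvd : v < d) (hs : GapSpeed ![a, u, v] ![b, c, d] u s)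
    (hs' : GapSpeed ![a, u] ![b, d] u s') : s ≤ s' := by
  have h : IsGaps ![a, u, v] ![b, c, d] := ⟨fun i => by fin_cases i <;> assumption, fun i j hij => by
    fin_cases i <;> fin_cases j <;> first | (simp at hij; done) | assumption | skip
    exact hbu.trans (huc.trans hcv)⟩
  have h' := isGaps_one hab hbu (huc.trans (hcv.trans hvd))
  have h1 := hs.reflect h (fun i => h.not_mem_Ioo ⟨1, Or.inl rfl⟩ i) 0
  have h2 := hs'.reflect h' (fun i => h'.not_mem_Ioo ⟨1, Or.inl rfl⟩ i) 0
  have h3 := GapSpeed.removeBand_le (h.reflect 0) h1 (sB := 0 - s') (by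
      convert h2 using 1 <;> (funext i; fin_cases i <;> rfl))
    (fun i => (h.reflect 0).not_mem_Ioo ⟨1, Or.inr rfl⟩ i) (by
      change 0 - c < 0 - u; linarith)
  linarith

/-- The numerator with the zeros `y`, `p 2`, `p 3`, `p 4`. -/
def quartic (y : ℝ) (p : Fin 5 → ℝ) (z : ℝ) : ℝ := (z - y) * ((z - p 2) * (z - p 3) * (z - p 4))

/-- The other factors of the curve with branch points `a, b, p 0, c, p 1, d`. -/
def quarticRest (a b c d : ℝ) (p : Fin 5 → ℝ) (i : Fin 3) (z : ℝ) : ℝ :=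
  match i with
  | 0 => (z - p 0) * (z - c) * ((z - p 1) * (z - d))
  | 1 => (z - a) * (z - b) * ((z - p 1) * (z - d))
  | 2 => (z - a) * (z - b) * ((z - p 0) * (z - c))

/-- Points of the three gaps. -/
def quarticPoint (a b c d : ℝ) (p : Fin 5 → ℝ) (i : Fin 3) (θ : ℝ) : ℝ :=
  match i with
  | 0 => gapPoint a b θ
  | 1 => gapPoint (p 0) c θ
  | 2 => gapPoint (p 1) d θ

/-- The three periods. The third gap may be closed. -/
def quarticPeriod (a b c d : ℝ) (j : Fin 5) (i : Fin 3) (p : Fin 5 → ℝ) : ℝ :=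
  ∫ θ in 0..Real.pi, quartic (p j) p (quarticPoint a b c d p i θ) /
    √(quarticRest a b c d p i (quarticPoint a b c d p i θ))

/-- The branch points `p 0`, `p 1` and zeros in the gaps. -/
def quarticBox (a b c d u₁ u₀ v₀ : ℝ) : Set (Fin 5 → ℝ) :=
  {p | p 0 ∈ Icc u₁ u₀ ∧ p 1 ∈ Icc v₀ d ∧ p 2 ∈ Icc a b ∧ p 3 ∈ Icc (p 0) c ∧ p 4 ∈ Icc (p 1) d}

variable {a b c d u₁ u₀ v₀ : ℝ}

lemma isCompact_quarticBox : IsCompact (quarticBox a b c d u₁ u₀ v₀) := by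
  refine (isCompact_Icc (a := ![u₁, v₀, a, u₁, v₀]) (b := ![u₀, d, b, c, d])).of_isClosed_subset
    ?_ ?_
  · simp only [quarticBox, mem_Icc, ofPred_and]
    refine IsClosed.inter (IsClosed.inter ?_ ?_) (IsClosed.inter (IsClosed.inter ?_ ?_)
      (IsClosed.inter (IsClosed.inter ?_ ?_) (IsClosed.inter (IsClosed.inter ?_ ?_)
      (IsClosed.inter ?_ ?_)))) <;> exact isClosed_le (by fun_prop) (by fun_prop)
  · rintro p ⟨h0, h1, h2, h3, h4⟩
    constructor <;> intro i <;> fin_cases i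
    · exact h0.1
    · exact h1.1
    · exact h2.1
    · exact h0.1.trans h3.1
    · exact h1.1.trans h4.1
    · exact h0.2
    · exact h1.2
    · exact h2.2
    · exact h3.2
    · exact h4.2

lemma quarticRest_pos (hab : a < b) (hbu : b < u₁) (huc : u₀ < c) (hcv : c < v₀)
    {p : Fin 5 → ℝ} (hp : p ∈ quarticBox a b c d u₁ u₀ v₀) (i : Fin 3) (θ : ℝ) :
    0 < quarticRest a b c d p i (quarticPoint a b c d p i θ) := by
  obtain ⟨h0, h1, -, -, -⟩ := hp
  have hcd : c < d := by linarith [h1.1, h1.2]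
  fin_cases i
  · have hz := gapPoint_mem_Icc hab.le θ
    simp only [quarticRest, quarticPoint]
    exact mul_pos (mul_pos_of_neg_of_neg (by linarith [hz.2, h0.1]) (by linarith [hz.2, h0.1, h0.2]))
      (mul_pos_of_neg_of_neg (by linarith [hz.2, h0.1, h0.2, h1.1])
        (by linarith [hz.2, h0.1, h0.2, h1.1]))
  · have hz := gapPoint_mem_Icc (h0.2.trans huc.le) θ
    simp only [quarticRest, quarticPoint]
    exact mul_pos (mul_pos (by linarith [hz.1, h0.1]) (by linarith [hz.1, h0.1]))
      (mul_pos_of_neg_of_neg (by linarith [hz.2, h1.1]) (by linarith [hz.2, h1.1]))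
  · have hz := gapPoint_mem_Icc h1.2 θ
    simp only [quarticRest, quarticPoint]
    exact mul_pos (mul_pos (by linarith [hz.1, h0.1, h0.2, h1.1])
      (by linarith [hz.1, h0.1, h0.2, h1.1])) (mul_pos (by linarith [hz.1, h0.2, h1.1])
      (by linarith [hz.1, h1.1]))

lemma continuous_quarticPoint (i : Fin 3) :
    Continuous fun q : (Fin 5 → ℝ) × ℝ => quarticPoint a b c d q.1 i q.2 := by
  match i with
  | 0 => simp only [quarticPoint, gapPoint]; fun_prop
  | 1 => simp only [quarticPoint, gapPoint]; fun_prop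
  | 2 => simp only [quarticPoint, gapPoint]; fun_prop

lemma continuous_quarticRest (i : Fin 3) :
    Continuous fun q : (Fin 5 → ℝ) × ℝ => quarticRest a b c d q.1 i q.2 := by
  match i with
  | 0 => simp only [quarticRest]; fun_prop
  | 1 => simp only [quarticRest]; fun_prop
  | 2 => simp only [quarticRest]; fun_prop

lemma continuous_quarticPeriod (hab : a < b) (hbu : b < u₁) (huc : u₀ < c) (hcv : c < v₀)
    (j : Fin 5) (i : Fin 3) : Continuous fun p : quarticBox a b c d u₁ u₀ v₀ =>
      quarticPeriod a b c d j i p := by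
  have aux : ∀ (f : (Fin 5 → ℝ) → ℝ → ℝ) (x : quarticBox a b c d u₁ u₀ v₀ × ℝ → ℝ),
      Continuous (fun q : (Fin 5 → ℝ) × ℝ => f q.1 q.2) → Continuous x →
      Continuous fun q : quarticBox a b c d u₁ u₀ v₀ × ℝ => f q.1 (x q) := fun f x hf hx =>
    hf.comp ((continuous_subtype_val.comp continuous_fst).prodMk hx)
  have hx := aux (fun p θ => quarticPoint a b c d p i θ) _ (continuous_quarticPoint i)
    continuous_snd
  have hr := aux (fun p z => quarticRest a b c d p i z) _ (continuous_quarticRest i) hx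
  have hn := aux (fun p z => quartic (p j) p z) _ (by unfold quartic; fun_prop) hx
  have : Continuous (Function.uncurry fun (p : quarticBox a b c d u₁ u₀ v₀) (θ : ℝ) =>
      quartic ((p : Fin 5 → ℝ) j) p (quarticPoint a b c d p i θ) /
        √(quarticRest a b c d p i (quarticPoint a b c d p i θ))) :=
    hn.div hr.sqrt fun q => (Real.sqrt_pos.2 (quarticRest_pos hab hbu huc hcv q.1.2 i q.2)).ne'
  exact intervalIntegral.continuous_parametric_intervalIntegral_of_continuous' this 0 Real.pi

lemma cubic_eq_of_roots {k e₂ e₁ e₀ x y z : ℝ} (hxy : x ≠ y) (hyz : y ≠ z) (hxz : x ≠ z)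
    {f : ℝ → ℝ} (hf : ∀ t, f t = k * t ^ 3 + e₂ * t ^ 2 + e₁ * t + e₀) (hx : f x = 0)
    (hy : f y = 0) (hz : f z = 0) (t : ℝ) : f t = k * ((t - x) * (t - y) * (t - z)) := by
  rw [hf] at *
  have h1 : k * (x ^ 2 + x * y + y ^ 2) + e₂ * (x + y) + e₁ = 0 :=
    mul_left_cancel₀ (sub_ne_zero.2 hxy) (by linear_combination hx - hy)
  have h2 : k * (y ^ 2 + y * z + z ^ 2) + e₂ * (y + z) + e₁ = 0 :=
    mul_left_cancel₀ (sub_ne_zero.2 hyz) (by linear_combination hy - hz)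
  have h3 : k * (x + y + z) + e₂ = 0 :=
    mul_left_cancel₀ (sub_ne_zero.2 hxz) (by linear_combination h1 - h2)
  linear_combination (t ^ 2 - t * (x + y) + x * y) * h3 + (t - x) * h1 + hx

lemma quartic_zero (hab : a < b) (hbu : b < u₁) (huc : u₀ < c) (hcv : c < v₀)
    {p : Fin 5 → ℝ} (hp : p ∈ quarticBox a b c d u₁ u₀ v₀) {f : ℝ → ℝ} (hf : Continuous f)
    (h : ∀ i, ∫ θ in 0..Real.pi, f (quarticPoint a b c d p i θ) /
      √(quarticRest a b c d p i (quarticPoint a b c d p i θ)) = 0) :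
    (∃ x ∈ Ioo a b, f x = 0) ∧ (∃ x ∈ Ioo (p 0) c, f x = 0) ∧
      (p 1 < d → ∃ x ∈ Ioo (p 1) d, f x = 0) := by
  have key : ∀ i lo hi, lo < hi → (∀ θ, quarticPoint a b c d p i θ = gapPoint lo hi θ) →
      ∃ x ∈ Ioo lo hi, f x = 0 := by
    intro i lo hi hlt he
    have hpos : ∀ x ∈ Icc lo hi, 0 < quarticRest a b c d p i x := fun x hx => by
      have hcl : Icc lo hi ⊆ gapPoint lo hi '' Icc 0 Real.pi := by
        have := intermediate_value_Icc' Real.pi_pos.le (continuous_gapPoint lo hi).continuousOn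
        refine Subset.trans (fun z hz => ?_) this
        simp only [gapPoint, Real.cos_zero, Real.cos_pi]
        constructor <;> linarith [hz.1, hz.2]
      obtain ⟨θ, -, rfl⟩ := hcl hx
      rw [← he]
      exact quarticRest_pos hab hbu huc hcv hp i θ
    have hc : Continuous (quarticRest a b c d p i) :=
      (continuous_quarticRest i).comp (Continuous.prodMk_right p)
    obtain ⟨x, hx, h0⟩ := exists_zero_of_integral_gapPoint hlt
      (f := fun x => f x / √(quarticRest a b c d p i x))
      (hf.continuousOn.div hc.sqrt.continuousOn fun x hx => (Real.sqrt_pos.2 (hpos x hx)).ne')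
      (by simpa only [he] using h i)
    exact ⟨x, hx, (div_eq_zero_iff.1 h0).resolve_right
      (Real.sqrt_pos.2 (hpos x (Ioo_subset_Icc_self hx))).ne'⟩
  exact ⟨key 0 a b hab fun _ => rfl, key 1 _ c (hp.1.2.trans_lt huc) fun _ => rfl,
    fun h1 => key 2 _ d h1 fun _ => rfl⟩

/-- The order of the speeds in genus 2, including the case of a closed third gap. -/
lemma quartic_speed_lt (hab : a < b) (hbu : b < u₁) (huc : u₀ < c) (hcv : c < v₀)
    {p q : Fin 5 → ℝ} (hp : p ∈ quarticBox a b c d u₁ u₀ v₀)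
    (hq : q ∈ quarticBox a b c d u₁ u₀ v₀) (h0 : p 0 = q 0) (h1 : p 1 = q 1)
    (hpp : ∀ i, quarticPeriod a b c d 1 i p = 0) (hqp : ∀ i, quarticPeriod a b c d 0 i q = 0) :
    q 0 + q 2 + q 3 + q 4 < p 1 + p 2 + p 3 + p 4 := by
  by_contra! hle
  have c1 : ∀ y r, Continuous (quartic y r) := fun y r => by unfold quartic; fun_prop
  obtain ⟨-, ⟨x, hx, hx0⟩, -⟩ := quartic_zero hab hbu huc hcv hp (c1 (p 1) p) hpp
  obtain ⟨hp0, hp1, hp2, hp3, hp4⟩ := id hp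
  obtain ⟨hq0, hq1, hq2, hq3, hq4⟩ := id hq
  have hp3' : p 0 < p 3 := by
    simp only [quartic, mul_eq_zero] at hx0
    rcases hx0 with h | (h | h) | h
    · linarith [hx.2, hp1.1]
    · linarith [hx.1, hp2.2, hp0.1]
    · linarith [hx.1]
    · linarith [hx.2, hp4.1, hp1.1]
  have hrest : quarticRest a b c d q = quarticRest a b c d p := by
    funext i z; fin_cases i <;> simp [quarticRest, h0, h1]
  have hpoint : quarticPoint a b c d q = quarticPoint a b c d p := by
    funext i z; fin_cases i <;> simp [quarticPoint, h0, h1]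
  have hG : ∀ i, ∫ θ in 0..Real.pi, (quartic (p 1) p (quarticPoint a b c d p i θ) -
      quartic (q 0) q (quarticPoint a b c d p i θ)) /
      √(quarticRest a b c d p i (quarticPoint a b c d p i θ)) = 0 := fun i => by
    have hr : Continuous (quarticRest a b c d p i) :=
      (continuous_quarticRest i).comp (Continuous.prodMk_right p)
    have hx : Continuous (quarticPoint a b c d p i) :=
      (continuous_quarticPoint i).comp (Continuous.prodMk_right p)
    have hci : ∀ y r, IntervalIntegrable (fun θ => quartic y r (quarticPoint a b c d p i θ) /
        √(quarticRest a b c d p i (quarticPoint a b c d p i θ))) MeasureTheory.volume 0 Real.pi :=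
      fun y r => (((c1 y r).comp hx).div (hr.comp hx).sqrt fun θ =>
        (Real.sqrt_pos.2 (quarticRest_pos hab hbu huc hcv hp i θ)).ne').intervalIntegrable _ _
    have e1 := hpp i
    have e2 := hqp i
    rw [quarticPeriod] at e1 e2
    rw [hrest, hpoint] at e2
    simp only [sub_div]
    rw [intervalIntegral.integral_sub (hci _ _) (hci _ _), e1, e2, sub_zero]
  obtain ⟨⟨x, hx, hx0⟩, ⟨y, hy, hy0⟩, h3⟩ := quartic_zero hab hbu huc hcv hp
    ((c1 (p 1) p).sub (c1 (q 0) q)) hG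
  obtain ⟨z, hz, hz0⟩ : ∃ z, c < z ∧ quartic (p 1) p z - quartic (q 0) q z = 0 := by
    rcases hp1.2.lt_or_eq with h | h
    · obtain ⟨z, hz, hz0⟩ := h3 h
      exact ⟨z, by linarith [hz.1, hp1.1], hz0⟩
    · have h4 : q 4 = d := le_antisymm hq4.2 (by rw [← h, h1]; exact hq4.1)
      exact ⟨d, by linarith [hp1.1], by simp [quartic, h, h4]⟩
  have key := cubic_eq_of_roots (k := q 0 + q 2 + q 3 + q 4 - (p 1 + p 2 + p 3 + p 4))
    (f := fun t => quartic (p 1) p t - quartic (q 0) q t)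
    (e₂ := p 1 * (p 2 + p 3 + p 4) + p 2 * p 3 + p 2 * p 4 + p 3 * p 4 -
      (q 0 * (q 2 + q 3 + q 4) + q 2 * q 3 + q 2 * q 4 + q 3 * q 4))
    (e₁ := -(p 1 * (p 2 * p 3 + p 2 * p 4 + p 3 * p 4) + p 2 * p 3 * p 4) +
      (q 0 * (q 2 * q 3 + q 2 * q 4 + q 3 * q 4) + q 2 * q 3 * q 4))
    (e₀ := p 1 * p 2 * p 3 * p 4 - q 0 * q 2 * q 3 * q 4)
    (show x ≠ y by linarith [hx.2, hy.1, hp0.1]) (show y ≠ z by linarith [hy.2])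
    (show x ≠ z by linarith [hx.2, hp0.1, hp0.2])
    (fun t => by unfold quartic; ring) hx0 hy0 hz0 (p 0)
  have e1 : quartic (q 0) q (p 0) = 0 := by simp [quartic, h0]
  simp only [e1, sub_zero] at key
  have e2 : quartic (p 1) p (p 0) < 0 := by
    unfold quartic
    refine mul_neg_of_neg_of_pos (by linarith [hp0.2, hp1.1]) ?_
    exact mul_pos_of_neg_of_neg (mul_neg_of_pos_of_neg (by linarith [hp2.2, hp0.1]) (by linarith))
      (by linarith [hp4.1, hp0.2, hp1.1])
  rw [key] at e2
  have e3 : 0 < (p 0 - x) * (p 0 - y) * (p 0 - z) :=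
    mul_pos_of_neg_of_neg (mul_neg_of_pos_of_neg (by linarith [hx.2, hp0.1]) (by linarith [hy.1]))
      (by linarith [hp0.2])
  linarith [mul_nonneg (sub_nonneg.2 hle) e3.le]

/-- A uniform version of the order of the speeds in genus 2. -/
lemma exists_quartic_gap (hab : a < b) (hbu : b < u₁) (huc : u₀ < c) (hcv : c < v₀) :
    ∃ ε > 0, ∀ p ∈ quarticBox a b c d u₁ u₀ v₀, ∀ q ∈ quarticBox a b c d u₁ u₀ v₀,
      (∀ i, quarticPeriod a b c d 1 i p = 0) → (∀ i, quarticPeriod a b c d 0 i q = 0) →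
      p 1 + p 2 + p 3 + p 4 - (p 0 + p 1) / 2 ≤ q 0 + q 2 + q 3 + q 4 - (q 0 + q 1) / 2 →
      ε < max |p 0 - q 0| |p 1 - q 1| := by
  set K := quarticBox a b c d u₁ u₀ v₀ with hK
  have : CompactSpace K := isCompact_iff_compactSpace.1 isCompact_quarticBox
  set S : Set (K × K) := {x | (∀ i, quarticPeriod a b c d 1 i x.1 = 0) ∧
    (∀ i, quarticPeriod a b c d 0 i x.2 = 0) ∧
    (x.1 : Fin 5 → ℝ) 1 + (x.1 : Fin 5 → ℝ) 2 + (x.1 : Fin 5 → ℝ) 3 + (x.1 : Fin 5 → ℝ) 4 -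
      ((x.1 : Fin 5 → ℝ) 0 + (x.1 : Fin 5 → ℝ) 1) / 2 ≤
    (x.2 : Fin 5 → ℝ) 0 + (x.2 : Fin 5 → ℝ) 2 + (x.2 : Fin 5 → ℝ) 3 + (x.2 : Fin 5 → ℝ) 4 -
      ((x.2 : Fin 5 → ℝ) 0 + (x.2 : Fin 5 → ℝ) 1) / 2} with hS
  have hv : Continuous fun x : K × K => ((x.1 : Fin 5 → ℝ), (x.2 : Fin 5 → ℝ)) := by fun_prop
  have hcl : IsClosed S := by
    have k1 : IsClosed {x : K × K | ∀ i, quarticPeriod a b c d 1 i x.1 = 0} := by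
      simp only [ofPred_forall]
      exact isClosed_iInter fun i => isClosed_eq
        ((continuous_quarticPeriod hab hbu huc hcv 1 i).comp continuous_fst) continuous_const
    have k2 : IsClosed {x : K × K | ∀ i, quarticPeriod a b c d 0 i x.2 = 0} := by
      simp only [ofPred_forall]
      exact isClosed_iInter fun i => isClosed_eq
        ((continuous_quarticPeriod hab hbu huc hcv 0 i).comp continuous_snd) continuous_const
    have k3 := IsClosed.preimage hv (isClosed_le
      (f := fun x : (Fin 5 → ℝ) × (Fin 5 → ℝ) => x.1 1 + x.1 2 + x.1 3 + x.1 4 -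
        (x.1 0 + x.1 1) / 2)
      (g := fun x => x.2 0 + x.2 2 + x.2 3 + x.2 4 - (x.2 0 + x.2 1) / 2)
      (by fun_prop) (by fun_prop))
    exact k1.inter (k2.inter k3)
  set dist' : K × K → ℝ := fun x => max |(x.1 : Fin 5 → ℝ) 0 - (x.2 : Fin 5 → ℝ) 0|
    |(x.1 : Fin 5 → ℝ) 1 - (x.2 : Fin 5 → ℝ) 1| with hdist
  have hdc : Continuous dist' := Continuous.comp
    (g := fun x : (Fin 5 → ℝ) × (Fin 5 → ℝ) => max |x.1 0 - x.2 0| |x.1 1 - x.2 1|)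
    (by fun_prop) hv
  rcases S.eq_empty_or_nonempty with hemp | hne
  · refine ⟨1, one_pos, fun p hp q hq h1 h2 h3 => ?_⟩
    have : ((⟨p, hp⟩, ⟨q, hq⟩) : K × K) ∈ S := ⟨h1, h2, h3⟩
    rw [hemp] at this
    exact absurd this (notMem_empty _)
  · obtain ⟨x, hx, hmin⟩ := hcl.isCompact.exists_isMinOn hne hdc.continuousOn
    have hpos : 0 < dist' x := by
      by_contra hle
      have h0 := (le_max_left _ _).trans (not_lt.1 hle)
      have h1 := (le_max_right _ _).trans (not_lt.1 hle)
      have e0 := sub_eq_zero.1 (abs_nonpos_iff.1 h0)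
      have e1 := sub_eq_zero.1 (abs_nonpos_iff.1 h1)
      have := quartic_speed_lt hab hbu huc hcv x.1.2 x.2.2 e0 e1 hx.1 hx.2.1
      have h3 := hx.2.2
      rw [e0, e1] at h3
      rw [e1] at this
      linarith
    refine ⟨dist' x / 2, half_pos hpos, fun p hp q hq h1 h2 h3 => ?_⟩
    have := hmin (a := ((⟨p, hp⟩, ⟨q, hq⟩) : K × K)) ⟨h1, h2, h3⟩
    exact (half_lt_self hpos).trans_le this

end NLSWhitham
end

noncomputable section

namespace NLSWhitham

/-! ### Values of odd multiplicity in a list -/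

/-- The values that occur an odd number of times. -/
def oddSet (l : List ℝ) : Finset ℝ := l.toFinset.filter fun v => Odd (l.count v)

lemma mem_oddSet {l : List ℝ} {v : ℝ} : v ∈ oddSet l ↔ Odd (l.count v) := by
  simp only [oddSet, Finset.mem_filter, List.mem_toFinset, and_iff_right_iff_imp]
  exact fun h => List.count_pos_iff.1 h.pos

lemma mem_of_mem_oddSet {l : List ℝ} {v : ℝ} (h : v ∈ oddSet l) : v ∈ l :=
  List.count_pos_iff.1 (mem_oddSet.1 h).pos

lemma oddSet_perm {l l' : List ℝ} (h : l.Perm l') : oddSet l = oddSet l' := by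
  ext v; rw [mem_oddSet, mem_oddSet, h.count_eq]

lemma oddSet_cons_cons (a : ℝ) (l : List ℝ) : oddSet (a :: a :: l) = oddSet l := by
  ext v
  simp only [mem_oddSet, List.count_cons]
  split_ifs
  · rw [add_assoc, Nat.odd_add]; simp [parity_simps]
  · rfl

lemma oddSet_cancel {l l' : List ℝ} (a : ℝ) (h : l.Perm (a :: a :: l')) :
    oddSet l = oddSet l' := by
  rw [oddSet_perm h, oddSet_cons_cons]

lemma oddSet_of_nodup {l : List ℝ} (h : l.Nodup) : oddSet l = l.toFinset := by
  ext v
  simp only [mem_oddSet, List.mem_toFinset, List.Nodup.count h]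
  split_ifs with h <;> simp [h]

lemma mem_oddSet_cons_of_ne {l : List ℝ} {a v : ℝ} (h : v ≠ a) :
    v ∈ oddSet (a :: l) ↔ v ∈ oddSet l := by
  simp [mem_oddSet, List.count_cons_of_ne h.symm]

lemma mem_oddSet_cons_self {l : List ℝ} {a : ℝ} : a ∈ oddSet (a :: l) ↔ a ∉ oddSet l := by
  simp [mem_oddSet, parity_simps]

lemma oddSet_image {l : List ℝ} {f : ℝ → ℝ} (hf : Function.Injective f) :
    (oddSet l).image f = oddSet (l.map f) := by
  ext v
  simp only [Finset.mem_image, mem_oddSet]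
  constructor
  · rintro ⟨x, hx, rfl⟩
    rwa [List.count_map_of_injective _ _ hf]
  · intro h
    obtain ⟨x, hx, rfl⟩ := List.mem_map.1 (List.count_pos_iff.1 h.pos)
    exact ⟨x, by rwa [List.count_map_of_injective _ _ hf] at h, rfl⟩

lemma branchPoints_eq_oddSet {n : ℕ} (r : Fin n → ℝ) : branchPoints r = oddSet (List.ofFn r) := by
  ext v
  have h : (List.ofFn r).count v = (Finset.univ.filter fun k => r k = v).card := by
    rw [← Multiset.coe_count, ← Fin.univ_val_map, Multiset.count_map, Finset.card_def,
      Finset.filter_val]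
    simp only [eq_comm]
  rw [mem_oddSet, h, branchPoints, Finset.mem_filter, and_iff_right_iff_imp]
  intro ho
  obtain ⟨k, hk⟩ := Finset.card_pos.1 ho.pos
  exact Finset.mem_image.2 ⟨k, Finset.mem_univ k, (Finset.mem_filter.1 hk).2⟩

/-! ### Genus 2 -/

lemma strictMono_six {a b u c v d : ℝ} (hab : a < b) (hbu : b < u) (huc : u < c) (hcv : c < v)
    (hvd : v < d) : StrictMono ![a, b, u, c, v, d] := by
  refine Fin.strictMono_iff_lt_succ.2 fun i => ?_
  fin_cases i <;> assumption

lemma isGaps_two {a b u c v d : ℝ} (hab : a < b) (hbu : b < u) (huc : u < c) (hcv : c < v)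
    (hvd : v < d) : IsGaps ![a, u, v] ![b, c, d] :=
  ⟨fun i => by fin_cases i <;> assumption, fun i j hij => by
    fin_cases i <;> fin_cases j <;> first | (simp at hij; done) | assumption | skip
    exact hbu.trans (huc.trans hcv)⟩

lemma SpeedAt.genus_two {a b u c v d y s : ℝ} (hab : a < b) (hbu : b < u) (huc : u < c)
    (hcv : c < v) (hvd : v < d) (hs : SpeedAt (oddSet [a, b, u, c, v, d]) y s) :
    GapSpeed ![a, u, v] ![b, c, d] y s := by
  have hm := strictMono_six hab hbu huc hcv hvd
  have hn : [a, b, u, c, v, d].Nodup := List.nodup_ofFn.2 hm.injective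
  rw [oddSet_of_nodup hn] at hs
  have h1 := hs.gapSpeed (g := 2) hm (by ext; simp [Matrix.range_cons]; tauto)
  convert h1 using 1 <;> (funext i; fin_cases i <;> rfl)

lemma SpeedAt.genus_one' {a b u c s : ℝ} (hab : a < b) (hbu : b < u) (huc : u < c)
    (hs : SpeedAt (oddSet [a, b, u, c]) u s) : GapSpeed ![a, u] ![b, c] u s := by
  have hn : [a, b, u, c].Nodup := List.nodup_ofFn.2 (strictMono_four hab hbu huc).injective
  rw [oddSet_of_nodup hn] at hs
  exact SpeedAt.genus_one hab hbu huc (by simpa using hs)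

variable {a b c d u₁ u₀ v₀ : ℝ}

/-- The numerator of a genus-2 speed in terms of `quarticPeriod`. -/
lemma exists_quartic_of_gapSpeed {u v s : ℝ} (hab : a < b) (hbu : b < u) (huc : u < c)
    (hcv : c < v) (hvd : v < d) (hu : u ∈ Icc u₁ u₀) (hv : v₀ ≤ v) (j : Fin 5) (hj : j = 0 ∨ j = 1)
    (hs : GapSpeed ![a, u, v] ![b, c, d] (![u, v, 0, 0, 0] j) s) :
    ∃ p ∈ quarticBox a b c d u₁ u₀ v₀, p 0 = u ∧ p 1 = v ∧
      (∀ i, quarticPeriod a b c d j i p = 0) ∧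
      p j + p 2 + p 3 + p 4 - (p 0 + p 1) / 2 = s + (a + b + c + d) / 2 := by
  have h := isGaps_two hab hbu huc hcv hvd
  obtain ⟨F, hF, h0⟩ := hs
  obtain ⟨ζ, hζ, he, hsum, -⟩ := hF.exists_roots_of_eval h h0 (h.not_mem_Ioo (by
    rcases hj with rfl | rfl
    · exact ⟨1, Or.inl rfl⟩
    · exact ⟨2, Or.inl rfl⟩))
  have hpj : (![u, v, ζ 0, ζ 1, ζ 2] : Fin 5 → ℝ) j = (![u, v, 0, 0, 0] : Fin 5 → ℝ) j := by
    rcases hj with rfl | rfl <;> rfl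
  have hz0 := Ioo_subset_Icc_self (hζ 0)
  have hz1 := Ioo_subset_Icc_self (hζ 1)
  have hz2 := Ioo_subset_Icc_self (hζ 2)
  refine ⟨![u, v, ζ 0, ζ 1, ζ 2], ⟨hu, ⟨hv, hvd.le⟩, hz0, hz1, hz2⟩, rfl, rfl, fun i => ?_, ?_⟩
  · have := hF.period i
    rw [gapPeriod] at this
    rw [quarticPeriod, hpj]
    refine Eq.trans ?_ this
    congr 1
    funext θ
    rw [he]
    fin_cases i <;>
      simp [quartic, quarticRest, quarticPoint, restProd, Fin.prod_univ_succ, Fin.succAbove, mul_assoc]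
  · rw [hpj]
    simp only [endSum, Fin.sum_univ_succ] at hsum
    simp at hsum ⊢
    linarith

/-- The numerator of a genus-1 speed in terms of `quarticPeriod` with a closed third gap. -/
lemma exists_quartic_of_gapSpeed_closed {u s : ℝ} (hab : a < b) (hbu : b < u) (huc : u < c)
    (hcd : c < d) (hu : u ∈ Icc u₁ u₀) (hv : v₀ ≤ d)
    (hs : GapSpeed ![a, u] ![b, c] u s) :
    ∃ p ∈ quarticBox a b c d u₁ u₀ v₀, p 0 = u ∧ p 1 = d ∧
      (∀ i, quarticPeriod a b c d 0 i p = 0) ∧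
      p 0 + p 2 + p 3 + p 4 - (p 0 + p 1) / 2 = s + (a + b + c + d) / 2 := by
  have h := isGaps_one hab hbu huc
  obtain ⟨F, hF, h0⟩ := hs
  obtain ⟨ζ, hζ, he, hsum, -⟩ := hF.exists_roots_of_eval h h0 (h.not_mem_Ioo ⟨1, Or.inl rfl⟩)
  have hz0 := Ioo_subset_Icc_self (hζ 0)
  have hz1 := Ioo_subset_Icc_self (hζ 1)
  refine ⟨![u, d, ζ 0, ζ 1, d], ⟨hu, ⟨hv, le_rfl⟩, hz0, hz1, ⟨le_rfl, le_rfl⟩⟩, rfl, rfl,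
    fun i => ?_, ?_⟩
  · have key : ∀ r x : ℝ, x < d → F.eval x * (x - d) / √(r * ((x - d) * (x - d))) =
        -(F.eval x / √r) := fun r x hx => by
      rw [Real.sqrt_mul' _ (mul_self_nonneg _), Real.sqrt_mul_self_eq_abs,
        abs_of_neg (sub_neg.2 hx), ← div_div, mul_div_right_comm, div_neg,
        mul_div_assoc, div_self (sub_neg.2 hx).ne, mul_one]
    have key' : ∀ i, ∀ x : ℝ, ∀ r, x < d → quartic u ![u, d, ζ 0, ζ 1, d] x = F.eval x * (x - d) ∧
        (quarticRest a b c d ![u, d, ζ 0, ζ 1, d] i x = r * ((x - d) * (x - d)) →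
        quartic u ![u, d, ζ 0, ζ 1, d] x / √(quarticRest a b c d ![u, d, ζ 0, ζ 1, d] i x) =
        -(F.eval x / √r)) := fun i x r hx => by
      have : quartic u ![u, d, ζ 0, ζ 1, d] x = F.eval x * (x - d) := by
        rw [he]; simp [quartic, Fin.prod_univ_succ]; ring
      exact ⟨this, fun hr => by rw [this, hr, key r x hx]⟩
    match i with
    | 0 =>
      refine Eq.trans ?_ ((congrArg Neg.neg (hF.period 0)).trans neg_zero)
      rw [quarticPeriod, gapPeriod, ← intervalIntegral.integral_neg]
      congr 1
      funext θ
      have hx := gapPoint_mem_Icc hab.le θ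
      refine (key' 0 _ _ (by
        change gapPoint a b θ < d; linarith [hx.2])).2 ?_
      simp [quarticRest, quarticPoint, restProd, Fin.succAbove]
    | 1 =>
      refine Eq.trans ?_ ((congrArg Neg.neg (hF.period 1)).trans neg_zero)
      rw [quarticPeriod, gapPeriod, ← intervalIntegral.integral_neg]
      congr 1
      funext θ
      have hx := gapPoint_mem_Icc huc.le θ
      refine (key' 1 _ _ (by
        change gapPoint u c θ < d; linarith [hx.2])).2 ?_
      simp [quarticRest, quarticPoint, restProd, Fin.succAbove]
    | 2 =>
      have : ∀ θ, gapPoint d d θ = d := fun θ => by simp [gapPoint]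
      simp [quarticPeriod, quarticPoint, this, quartic]
  · simp only [endSum, Fin.sum_univ_succ] at hsum
    simp at hsum ⊢
    linarith

/-- A uniform comparison of the speeds at `u` and `v` in nearby configurations. -/
lemma exists_crossing_gap (hab : a < b) (hbu : b < u₀) (huc : u₀ < c) (hcv : c < v₀) (hvd : v₀ < d)
    (hm : (a + d) / 2 < b) :
    ∃ ε > 0, ∀ u ∈ Ioc b u₀, ∀ v ∈ Ico v₀ d, ∀ u' ∈ Icc b u, u - u' ≤ ε → ∀ v' ∈ Icc v d,
      v' - v ≤ ε → ∀ s s', SpeedAt (oddSet [a, b, u, c, v', d]) u s →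
      SpeedAt (oddSet [a, b, u', c, v, d]) v s' → s ≤ s' := by
  obtain ⟨w, hw, hw'⟩ := genus_one_soliton hab (show b < d by linarith) hm
    (show 0 < (c - b) / 2 by linarith)
  obtain ⟨w₂, hw₂, hw₂'⟩ := genus_one_soliton hab (show b < c by linarith) (by linarith)
    (show 0 < (c - b) / 2 by linarith)
  set u₁ := min w w₂ with hu₁
  have hbu₁ : b < u₁ := lt_min hw.1 hw₂.1
  obtain ⟨ε, hε, hεb⟩ := exists_quartic_gap (a := a) (d := d) (u₁ := (b + u₁) / 2) hab
    (by linarith) huc hcv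
  refine ⟨min ε ((u₁ - b) / 2), lt_min hε (by linarith), ?_⟩
  intro u hu v hv u' hu' huu v' hv' hvv s s' hs hs'
  have huu1 := huu.trans (min_le_left _ _)
  have huu2 := huu.trans (min_le_right _ _)
  have hvv1 := hvv.trans (min_le_left _ _)
  have huc' : u < c := hu.2.trans_lt huc
  have hcv' : c < v := hcv.trans_le hv.1
  have hcd : c < d := by linarith
  -- the genus-1 case of the first speed
  have hs1 : v' = d → GapSpeed ![a, u] ![b, c] u s := fun h => by
    subst h
    refine SpeedAt.genus_one' hab hu.1 huc' ?_
    rwa [oddSet_cancel v' (l' := [a, b, u, c])] at hs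
    rw [List.perm_iff_count]; intro x; simp only [List.count_cons]; ring
  have hs2 : v' < d → GapSpeed ![a, u, v'] ![b, c, d] u s := fun h =>
    SpeedAt.genus_two hab hu.1 huc' (hcv'.trans_le hv'.1) h hs
  rcases lt_or_ge u u₁ with hlt | hge
  · have h1 : (a + c + v + d) / 4 < s' := by
      refine hs'.gt_of_second hv.2 ?_ ?_ ?_ ⟨c, ?_, le_rfl, hcv'⟩
      · have h1 : d ≠ u' := by linarith [hu'.2]
        rw [mem_oddSet_cons_of_ne (by linarith), mem_oddSet_cons_of_ne (by linarith),
          mem_oddSet_cons_of_ne h1, mem_oddSet_cons_of_ne (by linarith),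
          mem_oddSet_cons_of_ne hv.2.ne']
        simp [mem_oddSet]
      · intro x hx
        have := mem_of_mem_oddSet hx
        simp only [List.mem_cons, List.not_mem_nil, or_false] at this
        rcases this with rfl | rfl | rfl | rfl | rfl | rfl <;>
          first | (right; rfl) | (left; linarith [hu'.2])
      · intro x hx
        have := mem_of_mem_oddSet hx
        simp only [List.mem_cons, List.not_mem_nil, or_false] at this
        rcases this with rfl | rfl | rfl | rfl | rfl | rfl <;> linarith [hu'.1]
      · rw [mem_oddSet_cons_of_ne (by linarith), mem_oddSet_cons_of_ne (by linarith),
          mem_oddSet_cons_of_ne (by linarith [hu'.2]), mem_oddSet_cons_self,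
          mem_oddSet_cons_of_ne hcv'.ne, mem_oddSet_cons_of_ne hcd.ne]
        simp [mem_oddSet]
    rcases hv'.2.lt_or_eq with h | h
    · have hg := isGaps_one hab hu.1 (huc'.trans hcd)
      obtain ⟨t, ht⟩ := hg.exists_gapSpeed (hg.not_mem_Ioo (y := u) ⟨1, Or.inl rfl⟩)
      have h2 := genus_two_removeBand hab hu.1 huc' (hcv'.trans_le hv'.1) h (hs2 h) ht
      have h3 := (abs_le.1 (hw' u ⟨hu.1, hlt.trans_le (min_le_left _ _)⟩ t ht)).2
      linarith
    · have h3 := (abs_le.1 (hw₂' u ⟨hu.1, hlt.trans_le (min_le_right _ _)⟩ s (hs1 h))).2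
      linarith
  · by_contra! hss
    have hu1 : u' ∈ Icc ((b + u₁) / 2) u₀ := ⟨by linarith, hu'.2.trans hu.2⟩
    have hbu' : b < u' := by linarith [hu1.1]
    obtain ⟨p, hp, hp0, hp1, hpp, hps⟩ := exists_quartic_of_gapSpeed hab hbu'
      (hu'.2.trans_lt huc') hcv' hv.2 hu1 hv.1 1 (Or.inr rfl)
      (SpeedAt.genus_two hab hbu' (hu'.2.trans_lt huc') hcv' hv.2 hs')
    obtain ⟨q, hq, hq0, hq1, hqp, hqs⟩ : ∃ q ∈ quarticBox a b c d ((b + u₁) / 2) u₀ v₀,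
        q 0 = u ∧ q 1 = v' ∧ (∀ i, quarticPeriod a b c d 0 i q = 0) ∧
        q 0 + q 2 + q 3 + q 4 - (q 0 + q 1) / 2 = s + (a + b + c + d) / 2 := by
      rcases hv'.2.lt_or_eq with h | h
      · exact exists_quartic_of_gapSpeed hab hu.1 huc' (hcv'.trans_le hv'.1) h
          ⟨hu1.1.trans hu'.2, hu.2⟩ (hv.1.trans hv'.1) 0 (Or.inl rfl) (hs2 h)
      · obtain ⟨q, h1, h2, h3, h4⟩ := exists_quartic_of_gapSpeed_closed (v₀ := v₀) hab hu.1 huc' hcd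
          ⟨hu1.1.trans hu'.2, hu.2⟩ hvd.le (hs1 h)
        exact ⟨q, h1, h2, h3.trans h.symm, h4⟩
    have := hεb p hp q hq hpp hqp (by linarith)
    rw [hp0, hq0, hp1, hq1, lt_max_iff, abs_of_nonpos (by linarith [hu'.2]),
      abs_of_nonpos (by linarith [hv'.1])] at this
    rcases this with h | h <;> linarith

end NLSWhitham
end

noncomputable section

namespace NLSWhitham

/-! ### Fans of characteristics -/

/-- A function that is nonpositive at the start and cannot increase while it is positive and small
stays nonpositive. -/
lemma nonpos_of_barrier {g : ℝ → ℝ} {a b η : ℝ} (hab : a ≤ b) (hη : 0 < η)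
    (hc : ContinuousOn g (Icc a b)) (h0 : g a ≤ 0)
    (hd : ∀ t ∈ Ioo a b, 0 < g t → g t < η → ∃ d ≤ 0, HasDerivAt g d t) : g b ≤ 0 := by
  by_contra! hb
  have hS : IsCompact {t ∈ Icc a b | g t ≤ 0} :=
    isCompact_Icc.of_isClosed_subset
      (hc.preimage_isClosed_of_isClosed isClosed_Icc isClosed_Iic) (sep_subset _ _)
  obtain ⟨τ, ⟨hτ, hτ0⟩, hmax⟩ := hS.exists_isGreatest ⟨a, ⟨le_rfl, hab⟩, h0⟩
  have hτb : τ < b := hτ.2.lt_of_ne fun h => by rw [h] at hτ0; linarith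
  have hpos : ∀ t ∈ Ioc τ b, 0 < g t := fun t ht => by
    by_contra! h
    exact absurd (hmax ⟨⟨hτ.1.trans ht.1.le, ht.2⟩, h⟩) (not_le.2 ht.1)
  have hev : ∀ᶠ t in 𝓝[>] τ, g t < η := by
    have := (hc τ hτ).eventually_lt_const (hτ0.trans_lt hη)
    refine Filter.Eventually.filter_mono ?_ this
    exact nhdsWithin_le_of_mem (mem_of_superset (Ioo_mem_nhdsGT hτb) fun t ht =>
      ⟨hτ.1.trans ht.1.le, ht.2.le⟩)
  obtain ⟨t₂, ht₂, hlt⟩ := mem_nhdsGT_iff_exists_Ioc_subset.1 hev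
  set t₃ := min t₂ b with ht₃
  have h3 : τ < t₃ := lt_min ht₂ hτb
  have hd' : ∀ t ∈ Ioo τ t₃, ∃ d ≤ 0, HasDerivAt g d t := fun t ht =>
    hd t ⟨hτ.1.trans_lt ht.1, ht.2.trans_le (min_le_right _ _)⟩
      (hpos t ⟨ht.1, ht.2.le.trans (min_le_right _ _)⟩)
      (hlt ⟨ht.1, ht.2.le.trans (min_le_left _ _)⟩)
  have hanti : AntitoneOn g (Icc τ t₃) := by
    refine antitoneOn_of_deriv_nonpos (convex_Icc _ _)
      (hc.mono (Icc_subset_Icc hτ.1 (min_le_right _ _))) ?_ ?_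
    · rw [interior_Icc]
      intro t ht
      obtain ⟨d, -, hd⟩ := hd' t ht
      exact hd.differentiableAt.differentiableWithinAt
    · rw [interior_Icc]
      intro t ht
      obtain ⟨d, hd0, hd⟩ := hd' t ht
      rwa [hd.deriv]
  have h4 := hanti ⟨le_rfl, h3.le⟩ ⟨h3.le, le_rfl⟩ h3.le
  linarith [hpos t₃ ⟨h3, min_le_right _ _⟩]

/-- A nonincreasing continuous function whose values below `top` are first taken near `X`. -/
lemma lt_top_iff_of_edge {f : ℝ → ℝ} (hc : Continuous f) (ha : Antitone f) {top X : ℝ}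
    (htop : ∃ x, f x = top) (hbot : ∃ x, f x < top)
    (h : ∀ ε > 0, ∃ v < top, ∀ x, f x ∈ Ioo v top → |x - X| ≤ ε) (x : ℝ) :
    f x < top ↔ X < x := by
  obtain ⟨y, hy⟩ := htop
  obtain ⟨z, hz⟩ := hbot
  -- values close to `top` are taken
  have key : ∀ v < top, ∀ w, f w < top → ∃ x ∈ Ioc y w, f x ∈ Ioo v top := fun v hv w hw => by
    have hyw : y < w := by
      by_contra! hle
      have := ha hle
      linarith
    obtain ⟨u, hu1, hu2⟩ := exists_between (max_lt hv hw)
    obtain ⟨x, hx, hxu⟩ := intermediate_value_Icc' hyw.le hc.continuousOn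
      (show u ∈ Icc (f w) (f y) from ⟨(le_max_right _ _).trans hu1.le, hy ▸ hu2.le⟩)
    refine ⟨x, ⟨hx.1.lt_of_ne fun h => ?_, hx.2⟩, ?_, ?_⟩
    · rw [← h, hy] at hxu; linarith
    · rw [hxu]; exact (le_max_left _ _).trans_lt hu1
    · rwa [hxu]
  constructor
  · intro hx
    by_contra! hX
    obtain ⟨x₁, hx₁, hf₁⟩ := key (f x) hx x hx
    have hlt : x₁ < x := by
      by_contra! h'
      exact absurd (ha h') (not_le.2 hf₁.1)
    obtain ⟨v, hv, hv'⟩ := h ((X - x₁) / 2) (by linarith)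
    obtain ⟨x₂, hx₂, hf₂⟩ := key v hv x₁ hf₁.2
    have := (abs_le.1 (hv' x₂ hf₂)).1
    linarith [hx₂.2]
  · intro hX
    by_contra! htx
    obtain ⟨v, hv, hv'⟩ := h ((x - X) / 2) (by linarith)
    obtain ⟨x₂, -, hf₂⟩ := key v hv z hz
    have hlt : x < x₂ := by
      by_contra! h'
      have := ha h'
      linarith [hf₂.2]
    have := (abs_le.1 (hv' x₂ hf₂)).2
    linarith

lemma bot_lt_iff_of_edge {f : ℝ → ℝ} (hc : Continuous f) (ha : Antitone f) {bot X : ℝ}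
    (hbot : ∃ x, f x = bot) (htop : ∃ x, bot < f x)
    (h : ∀ ε > 0, ∃ v > bot, ∀ x, f x ∈ Ioo bot v → |x - X| ≤ ε) (x : ℝ) :
    bot < f x ↔ x < X := by
  have := lt_top_iff_of_edge (f := fun x => -f (-x)) (top := -bot) (X := -X) (by fun_prop)
    (fun x y hxy => neg_le_neg (ha (neg_le_neg hxy)))
    (hbot.imp' Neg.neg fun x hx => by simp [hx]) (htop.imp' Neg.neg fun x hx => by simpa using hx)
    (fun ε hε => ?_) (-x)
  · simpa using this
  · obtain ⟨v, hv, hv'⟩ := h ε hε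
    refine ⟨-v, neg_lt_neg hv, fun x hx => ?_⟩
    have := hv' (-x) ⟨by linarith [hx.2], by linarith [hx.1]⟩
    rw [← abs_neg]
    convert this using 2
    ring

/-- An invariant `f` that decreases from `top` to `bot` in a fan of characteristics through the
point `(x₀, 0)`. The branch points at `(x, t)` are `cfg x t`. -/
structure IsFan (T x₀ bot top : ℝ) (cfg : ℝ → ℝ → Finset ℝ) (f : ℝ → ℝ → ℝ) : Prop where
  mem : ∀ x, ∀ t ∈ Ioo 0 T, f x t ∈ Icc bot top
  continuousOn : ContinuousOn (fun p : ℝ × ℝ => f p.1 p.2) (univ ×ˢ Ioo 0 T)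
  anti : ∀ t ∈ Ioo 0 T, Antitone fun x => f x t
  left : ∀ x < x₀, Tendsto (fun p : ℝ × ℝ => f p.1 p.2) (𝓝 x ×ˢ 𝓝[>] 0) (𝓝 top)
  right : ∀ x > x₀, Tendsto (fun p : ℝ × ℝ => f p.1 p.2) (𝓝 x ×ˢ 𝓝[>] 0) (𝓝 bot)
  char : ∀ x₁, ∀ t₁ ∈ Ioo 0 T, f x₁ t₁ ∈ Ioo bot top → ∃ χ : ℝ → ℝ,
    ContinuousOn χ (Icc 0 t₁) ∧ χ 0 = x₀ ∧ χ t₁ = x₁ ∧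
    (∀ t ∈ Ioc 0 t₁, f (χ t) t = f x₁ t₁) ∧
    ∀ t ∈ Ioo 0 t₁, ∃ s, SpeedAt (cfg (χ t) t) (f x₁ t₁) s ∧ HasDerivAt χ (-s) t

section Fan

variable {T x₀ bot top : ℝ} {cfg : ℝ → ℝ → Finset ℝ} {f : ℝ → ℝ → ℝ}

lemma IsFan.continuous (h : IsFan T x₀ bot top cfg f) {t : ℝ} (ht : t ∈ Ioo 0 T) :
    Continuous fun x => f x t := by
  have h1 : Continuous fun x : ℝ => (x, t) := by fun_prop
  exact h.continuousOn.comp_continuous h1 fun x => ⟨mem_univ x, ht⟩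

lemma IsFan.continuousOn_time (h : IsFan T x₀ bot top cfg f) (x : ℝ) :
    ContinuousOn (fun t => f x t) (Ioo 0 T) := by
  have h1 : Continuous fun t : ℝ => (x, t) := by fun_prop
  exact h.continuousOn.comp h1.continuousOn fun t ht => ⟨mem_univ x, ht⟩

/-- Some speed along a characteristic is the mean speed. -/
lemma IsFan.exists_speed (h : IsFan T x₀ bot top cfg f) {x₁ t₁ : ℝ} (ht : t₁ ∈ Ioo 0 T)
    (hf : f x₁ t₁ ∈ Ioo bot top) : ∃ t ∈ Ioo 0 T, ∃ x s, f x t = f x₁ t₁ ∧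
      SpeedAt (cfg x t) (f x₁ t₁) s ∧ x₁ = x₀ - s * t₁ := by
  obtain ⟨χ, hχ, h0, h1, hv, hs⟩ := h.char x₁ t₁ ht hf
  choose! σ hσ hσ' using hs
  obtain ⟨t, ht', he⟩ := exists_hasDerivAt_eq_slope χ (fun t => -σ t) ht.1 hχ hσ'
  refine ⟨t, ⟨ht'.1, ht'.2.trans ht.2⟩, χ t, σ t, hv t ⟨ht'.1, ht'.2.le⟩, hσ t ht', ?_⟩
  rw [h0, h1, sub_zero, eq_div_iff ht.1.ne'] at he
  linarith

lemma IsFan.eq_top (h : IsFan T x₀ bot top cfg f) {K : ℝ}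
    (hK : ∀ x, ∀ t ∈ Ioo 0 T, ∀ v ∈ Ioo bot top, ∀ s, SpeedAt (cfg x t) v s → |s| ≤ K)
    (hK0 : 0 ≤ K) {x t : ℝ} (ht : t ∈ Ioo 0 T) (hx : x < x₀ - K * t) : f x t = top := by
  have key : ∀ t' ∈ Ioc 0 t, f x t' ∉ Ioo bot top := fun t' ht' hf => by
    have htT : t' ∈ Ioo 0 T := ⟨ht'.1, ht'.2.trans_lt ht.2⟩
    obtain ⟨t'', ht'', y, s, -, hs, he⟩ := h.exists_speed htT hf
    have h1 := (abs_le.1 (hK y t'' ht'' _ hf s hs)).2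
    have h2 := mul_le_mul_of_nonneg_right h1 ht'.1.le
    have h3 := mul_le_mul_of_nonneg_left ht'.2 hK0
    linarith
  by_contra hne
  have hm := h.mem x t ht
  have hlt : f x t < top := hm.2.lt_of_ne hne
  have hbot : f x t = bot := by
    by_contra hb
    exact key t ⟨ht.1, le_rfl⟩ ⟨hm.1.lt_of_ne (Ne.symm hb), hlt⟩
  have hev := ((h.left x (by nlinarith [ht.1])).comp
    (tendsto_const_nhds.prodMk tendsto_id)).eventually_const_lt
    (show (bot + top) / 2 < top by linarith)
  obtain ⟨t₂, h2, ht₂⟩ := (hev.and (Ioo_mem_nhdsGT ht.1)).exists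
  obtain ⟨t₃, h3, he⟩ := intermediate_value_Icc' ht₂.2.le
    ((h.continuousOn_time x).mono fun z hz => ⟨ht₂.1.trans_le hz.1, hz.2.trans_lt ht.2⟩)
    (show (bot + top) / 2 ∈ Icc (f x t) (f x t₂) from ⟨by linarith, h2.le⟩)
  refine key t₃ ⟨ht₂.1.trans_le h3.1, h3.2⟩ ?_
  change f x t₃ = _ at he
  rw [he]
  constructor <;> linarith

lemma tendsto_shear (m x : ℝ) : Tendsto (fun p : ℝ × ℝ => (-p.1 - 2 * m * p.2, p.2))
    (𝓝 x ×ˢ 𝓝[>] 0) (𝓝 (-x) ×ˢ 𝓝[>] 0) := by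
  refine Tendsto.prodMk ?_ tendsto_snd
  have h : Continuous fun p : ℝ × ℝ => -p.1 - 2 * m * p.2 := by fun_prop
  have h1 := h.tendsto (x, 0)
  simp only [mul_zero, sub_zero, nhds_prod_eq] at h1
  exact h1.mono_left (Filter.prod_mono le_rfl nhdsWithin_le_nhds)

/-- The Galilean reflection of a fan. -/
lemma IsFan.reflect (h : IsFan T x₀ bot top cfg f) (m : ℝ) :
    IsFan T (-x₀) (2 * m - top) (2 * m - bot)
      (fun x t => (cfg (-x - 2 * m * t) t).image fun v => 2 * m - v)
      (fun x t => 2 * m - f (-x - 2 * m * t) t) where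
  mem x t ht := by
    have := h.mem (-x - 2 * m * t) t ht
    constructor <;> linarith [this.1, this.2]
  continuousOn := by
    refine continuousOn_const.sub ?_
    have h1 : Continuous fun p : ℝ × ℝ => (-p.1 - 2 * m * p.2, p.2) := by fun_prop
    exact h.continuousOn.comp h1.continuousOn fun p hp => ⟨mem_univ _, hp.2⟩
  anti t ht x y hxy := by
    have := h.anti t ht (show -y - 2 * m * t ≤ -x - 2 * m * t by linarith)
    change 2 * m - _ ≤ 2 * m - _
    simp only at this
    linarith
  left x hx := tendsto_const_nhds.sub ((h.right (-x) (by linarith)).comp (tendsto_shear m x))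
  right x hx := tendsto_const_nhds.sub ((h.left (-x) (by linarith)).comp (tendsto_shear m x))
  char x₁ t₁ ht hf := by
    obtain ⟨χ, hχ, h0, h1, hv, hs⟩ := h.char (-x₁ - 2 * m * t₁) t₁ ht
      ⟨by linarith [hf.2], by linarith [hf.1]⟩
    refine ⟨fun t => -χ t - 2 * m * t, ?_, by simp [h0], by simp [h1], fun t ht' => ?_,
      fun t ht' => ?_⟩
    · exact hχ.neg.sub (by fun_prop)
    · have : -(-χ t - 2 * m * t) - 2 * m * t = χ t := by ring
      rw [this, hv t ht']
    · obtain ⟨s, hs1, hs2⟩ := hs t ht'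
      have : -(-χ t - 2 * m * t) - 2 * m * t = χ t := by ring
      refine ⟨2 * m - s, ?_, ?_⟩
      · rw [this]
        exact hs1.reflect (2 * m)
      · have := hs2.neg.sub ((hasDerivAt_id t).const_mul (2 * m))
        rw [mul_one] at this
        exact this.congr_deriv (by ring)

lemma IsFan.eq_bot (h : IsFan T x₀ bot top cfg f) {K : ℝ}
    (hK : ∀ x, ∀ t ∈ Ioo 0 T, ∀ v ∈ Ioo bot top, ∀ s, SpeedAt (cfg x t) v s → |s| ≤ K)
    (hK0 : 0 ≤ K) {x t : ℝ} (ht : t ∈ Ioo 0 T) (hx : x₀ + K * t < x) : f x t = bot := by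
  have := (h.reflect 0).eq_top (K := K) (fun x t ht v hv s hs => ?_) hK0 ht
    (x := -x) (by linarith)
  · simpa using this
  · have h1 := hs.reflect 0
    rw [Finset.image_image] at h1
    have h2 := hK (-x) t ht (0 - v) ⟨by linarith [hv.2], by linarith [hv.1]⟩ (0 - s) (by
      convert h1 using 1
      simp)
    simpa using h2

/-- The edge at which `f` leaves its top value, when the speeds converge. -/
lemma IsFan.lt_top_iff (h : IsFan T x₀ bot top cfg f) {K S : ℝ} (hbt : bot < top)
    (hK : ∀ x, ∀ t ∈ Ioo 0 T, ∀ v ∈ Ioo bot top, ∀ s, SpeedAt (cfg x t) v s → |s| ≤ K)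
    (hS : ∀ ε > 0, ∃ v ∈ Ico bot top, ∀ x, ∀ t ∈ Ioo 0 T, f x t ∈ Ioo v top →
      ∀ s, SpeedAt (cfg x t) (f x t) s → |s - S| ≤ ε) {x t : ℝ} (ht : t ∈ Ioo 0 T) :
    f x t < top ↔ x₀ - S * t < x := by
  have hK' : ∀ x, ∀ t ∈ Ioo 0 T, ∀ v ∈ Ioo bot top, ∀ s, SpeedAt (cfg x t) v s → |s| ≤ |K| :=
    fun x t ht v hv s hs => (hK x t ht v hv s hs).trans (le_abs_self K)
  refine lt_top_iff_of_edge (h.continuous ht) (h.anti t ht)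
    ⟨x₀ - |K| * t - 1, h.eq_top hK' (abs_nonneg K) ht (by linarith)⟩
    ⟨x₀ + |K| * t + 1, by
      rwa [h.eq_bot hK' (abs_nonneg K) ht (by linarith)]⟩ (fun ε hε => ?_) x
  obtain ⟨v, hv, hv'⟩ := hS (ε / t) (div_pos hε ht.1)
  refine ⟨v, hv.2, fun y hy => ?_⟩
  obtain ⟨t', ht', z, s, hz, hs, rfl⟩ := h.exists_speed ht ⟨hv.1.trans_lt hy.1, hy.2⟩
  have := hv' z t' ht' (by rw [hz]; exact hy) s (by rw [hz]; exact hs)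
  rw [le_div_iff₀ ht.1, ← abs_of_pos ht.1, ← abs_mul] at this
  rwa [show x₀ - s * t - (x₀ - S * t) = -((s - S) * t) by ring, abs_neg]

/-- The edge at which `f` reaches its bottom value, when the speeds converge. -/
lemma IsFan.bot_lt_iff (h : IsFan T x₀ bot top cfg f) {K S : ℝ} (hbt : bot < top)
    (hK : ∀ x, ∀ t ∈ Ioo 0 T, ∀ v ∈ Ioo bot top, ∀ s, SpeedAt (cfg x t) v s → |s| ≤ K)
    (hS : ∀ ε > 0, ∃ v ∈ Ioc bot top, ∀ x, ∀ t ∈ Ioo 0 T, f x t ∈ Ioo bot v →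
      ∀ s, SpeedAt (cfg x t) (f x t) s → |s - S| ≤ ε) {x t : ℝ} (ht : t ∈ Ioo 0 T) :
    bot < f x t ↔ x < x₀ - S * t := by
  have hK' : ∀ x, ∀ t ∈ Ioo 0 T, ∀ v ∈ Ioo bot top, ∀ s, SpeedAt (cfg x t) v s → |s| ≤ |K| :=
    fun x t ht v hv s hs => (hK x t ht v hv s hs).trans (le_abs_self K)
  refine bot_lt_iff_of_edge (h.continuous ht) (h.anti t ht)
    ⟨x₀ + |K| * t + 1, h.eq_bot hK' (abs_nonneg K) ht (by linarith)⟩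
    ⟨x₀ - |K| * t - 1, by
      rwa [h.eq_top hK' (abs_nonneg K) ht (by linarith)]⟩ (fun ε hε => ?_) x
  obtain ⟨v, hv, hv'⟩ := hS (ε / t) (div_pos hε ht.1)
  refine ⟨v, hv.1, fun y hy => ?_⟩
  obtain ⟨t', ht', z, s, hz, hs, rfl⟩ := h.exists_speed ht ⟨hy.1, hy.2.trans_le hv.2⟩
  have := hv' z t' ht' (by rw [hz]; exact hy) s (by rw [hz]; exact hs)
  rw [le_div_iff₀ ht.1, ← abs_of_pos ht.1, ← abs_mul] at this
  rwa [show x₀ - s * t - (x₀ - S * t) = -((s - S) * t) by ring, abs_neg]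

/-- If all interior values stay to the left of a line, then all values above the bottom do. -/
lemma IsFan.lt_of_bot_lt (h : IsFan T x₀ bot top cfg f) {K : ℝ}
    (hK : ∀ x, ∀ t ∈ Ioo 0 T, ∀ v ∈ Ioo bot top, ∀ s, SpeedAt (cfg x t) v s → |s| ≤ K)
    {t l : ℝ} (ht : t ∈ Ioo 0 T) (hl : ∀ x, f x t ∈ Ioo bot top → x ≤ l) {x : ℝ}
    (hx : bot < f x t) : x < l := by
  have hK' : ∀ x, ∀ t ∈ Ioo 0 T, ∀ v ∈ Ioo bot top, ∀ s, SpeedAt (cfg x t) v s → |s| ≤ |K| :=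
    fun x t ht v hv s hs => (hK x t ht v hv s hs).trans (le_abs_self K)
  have hb := h.eq_bot hK' (abs_nonneg K) ht
    (show x₀ + |K| * t < max x (x₀ + |K| * t) + 1 by linarith [le_max_right x (x₀ + |K| * t)])
  obtain ⟨u, hu1, hu2⟩ := exists_between hx
  obtain ⟨y, hy, he⟩ := intermediate_value_Icc' (show x ≤ max x (x₀ + |K| * t) + 1 by
    linarith [le_max_left x (x₀ + |K| * t)]) (h.continuous ht).continuousOn
    (show u ∈ Icc (f _ t) (f x t) from ⟨hb ▸ hu1.le, hu2.le⟩)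
  change f y t = u at he
  have hne : x ≠ y := fun hxy => by rw [hxy, he] at hu2; exact lt_irrefl _ hu2
  exact (hy.1.lt_of_ne hne).trans_le
    (hl y ⟨by rwa [he], by rw [he]; exact hu2.trans_le (h.mem x t ht).2⟩)

/-- A fan in which all speeds are at least `m` stays to the left of a line. -/
lemma IsFan.lt_of_speed (h : IsFan T x₀ bot top cfg f) {K m : ℝ}
    (hK : ∀ x, ∀ t ∈ Ioo 0 T, ∀ v ∈ Ioo bot top, ∀ s, SpeedAt (cfg x t) v s → |s| ≤ K)
    (hm : ∀ x, ∀ t ∈ Ioo 0 T, f x t ∈ Ioo bot top → ∀ s, SpeedAt (cfg x t) (f x t) s → m ≤ s)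
    {x t : ℝ} (ht : t ∈ Ioo 0 T) (hx : bot < f x t) : x < x₀ - m * t := by
  refine h.lt_of_bot_lt hK ht (fun y hy => ?_) hx
  obtain ⟨t', ht', z, s, hz, hs, rfl⟩ := h.exists_speed ht hy
  have := hm z t' ht' (by rw [hz]; exact hy) s (by rw [hz]; exact hs)
  nlinarith [ht.1]

end Fan

end NLSWhitham
end

noncomputable section

namespace NLSWhitham

lemma SpeedAt.abs_le {B : Finset ℝ} {y s a d : ℝ} (h : SpeedAt B y s)
    (hB : ∀ x ∈ B, x ∈ Icc a d) : |s| ≤ (d - a) / 2 + max |a| |d| := by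
  have h1 := h.abs_sub_le hB
  have h2 := abs_le_max_abs_abs (hB y h.mem).1 (hB y h.mem).2
  have h3 := abs_sub_abs_le_abs_sub s y
  linarith

lemma oddSet_reflect (l : List ℝ) (τ : ℝ) :
    (oddSet l).image (fun v => τ - v) = oddSet (l.map fun v => τ - v) :=
  oddSet_image sub_right_injective

section Fan

variable {T x₀ bot top A κ D : ℝ} {cfg : ℝ → ℝ → Finset ℝ} {f : ℝ → ℝ → ℝ}

lemma exists_speed_bound (hA : ∀ x, ∀ t ∈ Ioo 0 T, ∀ v ∈ cfg x t, v ∈ Icc A D) :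
    ∀ x, ∀ t ∈ Ioo 0 T, ∀ v ∈ Ioo bot top, ∀ s, SpeedAt (cfg x t) v s →
      |s| ≤ (D - A) / 2 + max |A| |D| :=
  fun x t ht _ _ _ hs => hs.abs_le (hA x t ht)

/-- The edge with vanishing oscillations. -/
lemma IsFan.harmonic_edge (h : IsFan T x₀ bot D cfg f) (hbD : bot < D)
    (hA : ∀ x, ∀ t ∈ Ioo 0 T, ∀ v ∈ cfg x t, v ∈ Icc A D) (hAκ : A < κ) (hκD : κ < D)
    {w : ℝ} (hw : w ∈ Ico bot D) (hκw : κ ≤ w)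
    (hc : ∀ x, ∀ t ∈ Ioo 0 T, f x t ∈ Ioo w D → cfg x t = oddSet [A, κ, f x t, D])
    {x t : ℝ} (ht : t ∈ Ioo 0 T) :
    f x t < D ↔ x₀ - (D - ((κ - A) / 2) ^ 2 / (2 * (D - (A + κ) / 2))) * t < x := by
  refine h.lt_top_iff hbD (exists_speed_bound hA) (fun ε hε => ?_) ht
  obtain ⟨v, hv, hv'⟩ := genus_one_harmonic hAκ hκD hε
  refine ⟨max v w, ⟨hw.1.trans (le_max_right _ _), max_lt hv.2 hw.2⟩, fun x t ht hf s hs => ?_⟩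
  have h1 := max_lt_iff.1 hf.1
  rw [hc x t ht ⟨h1.2, hf.2⟩] at hs
  exact hv' _ ⟨h1.1, hf.2⟩ s (SpeedAt.genus_one' hAκ (hκw.trans_lt h1.2) hf.2 hs)

/-- The edge with vanishing wave number. -/
lemma IsFan.soliton_edge (h : IsFan T x₀ κ top cfg f) (hκt : κ < top)
    (hA : ∀ x, ∀ t ∈ Ioo 0 T, ∀ v ∈ cfg x t, v ∈ Icc A D) (hAκ : A < κ) (hκD : κ < D)
    (hm : (A + D) / 2 < κ)
    (hc : ∀ x, ∀ t ∈ Ioo 0 T, f x t ∈ Ioo κ top → cfg x t = oddSet [A, κ, f x t, D])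
    {x t : ℝ} (ht : t ∈ Ioo 0 T) :
    κ < f x t ↔ x < x₀ - (A + 2 * κ + D) / 4 * t := by
  refine h.bot_lt_iff hκt (exists_speed_bound hA) (fun ε hε => ?_) ht
  obtain ⟨v, hv, hv'⟩ := genus_one_soliton hAκ hκD hm hε
  refine ⟨min v top, ⟨lt_min hv.1 hκt, min_le_right _ _⟩, fun x t ht hf s hs => ?_⟩
  have h1 := lt_min_iff.1 hf.2
  rw [hc x t ht ⟨hf.1, h1.2⟩] at hs
  exact hv' _ ⟨hf.1, h1.1⟩ s (SpeedAt.genus_one' hAκ hf.1 (h1.1.trans hv.2) hs)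

end Fan

/-! ### A supercritical jump -/

section Super

variable {T x₀ A κ D : ℝ} {cfg : ℝ → ℝ → Finset ℝ} {f p q : ℝ → ℝ → ℝ}

lemma IsFan.lt_center_super (hAκ : A < κ) (hκ : κ < (A + D) / 2)
    (h : IsFan T x₀ (A + D - κ) D cfg f)
    (hc : ∀ x, ∀ t ∈ Ioo 0 T, ∃ p ∈ Icc A κ, cfg x t = oddSet [A, p, f x t, D])
    (hA : ∀ x, ∀ t ∈ Ioo 0 T, ∀ v ∈ cfg x t, v ∈ Icc A D) {x t : ℝ} (ht : t ∈ Ioo 0 T)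
    (hx : A + D - κ < f x t) : x < x₀ - (A + D) / 2 * t := by
  refine h.lt_of_speed (exists_speed_bound hA) (fun x t ht hf s hs => ?_) ht hx
  obtain ⟨p, hp, he⟩ := hc x t ht
  rw [he] at hs
  rcases hp.1.eq_or_lt with rfl | h1
  · rw [oddSet_cons_cons, oddSet_of_nodup (by simp [hf.2.ne])] at hs
    have := SpeedAt.genus_zero hf.2 (by simpa using hs)
    linarith [hf.1, hf.2]
  · exact (genus_one_separated h1 (by linarith [hp.2]) (by linarith [hf.1]) hf.2
      (SpeedAt.genus_one' h1 (by linarith [hp.2, hf.1]) hf.2 hs)).le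

/-- The structure of the solution at a supercritical jump. -/
theorem super_jump (hAκ : A < κ) (hκ : κ < (A + D) / 2) (hp : IsFan T x₀ A κ cfg p)
    (hq : IsFan T x₀ (A + D - κ) D cfg q)
    (hc : ∀ x, ∀ t ∈ Ioo 0 T, cfg x t = oddSet [A, p x t, q x t, D]) {t : ℝ} (ht : t ∈ Ioo 0 T)
    (x : ℝ) :
    (q x t < D ↔ x₀ - (D - ((κ - A) / 2) ^ 2 / (2 * (D - (A + κ) / 2))) * t < x) ∧
    (A < p x t ↔
      x < x₀ + (D - ((κ - A) / 2) ^ 2 / (2 * (D - (A + κ) / 2)) - (A + D)) * t) ∧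
    (A + D - κ < q x t → x < x₀ - (A + D) / 2 * t) ∧
    (p x t < κ → x₀ - (A + D) / 2 * t < x) := by
  have hA : ∀ x, ∀ t ∈ Ioo 0 T, ∀ v ∈ cfg x t, v ∈ Icc A D := fun x t ht v hv => by
    rw [hc x t ht] at hv
    have := mem_of_mem_oddSet hv
    have h1 := hp.mem x t ht
    have h2 := hq.mem x t ht
    simp only [List.mem_cons, List.not_mem_nil, or_false] at this
    rcases this with rfl | rfl | rfl | rfl <;> constructor <;> linarith [h1.1, h1.2, h2.1, h2.2]
  have hp' := hp.reflect ((A + D) / 2)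
  have e1 : 2 * ((A + D) / 2) - κ = A + D - κ := by ring
  have e2 : 2 * ((A + D) / 2) - A = D := by ring
  have e3 : 2 * ((A + D) / 2) = A + D := by ring
  rw [e1, e2] at hp'
  simp only [e3] at hp'
  set p' : ℝ → ℝ → ℝ := fun x t => A + D - p (-x - (A + D) * t) t with hp'_def
  set cfg' : ℝ → ℝ → Finset ℝ :=
    fun x t => (cfg (-x - (A + D) * t) t).image fun v => A + D - v with hcfg'
  have hc' : ∀ x, ∀ t ∈ Ioo 0 T,
      cfg' x t = oddSet [A, A + D - q (-x - (A + D) * t) t, p' x t, D] := fun x t ht => by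
    rw [hcfg']
    simp only
    rw [hc _ t ht, oddSet_reflect]
    refine oddSet_perm ?_
    simp only [List.map_cons, List.map_nil, add_sub_cancel_left, add_sub_cancel_right]
    exact (List.reverse_perm _).symm
  have hA' : ∀ x, ∀ t ∈ Ioo 0 T, ∀ v ∈ cfg' x t, v ∈ Icc A D := fun x t ht v hv => by
    obtain ⟨w, hw, rfl⟩ := Finset.mem_image.1 hv
    have := hA _ t ht w hw
    constructor <;> linarith [this.1, this.2]
  have hqc : ∀ x, ∀ t ∈ Ioo 0 T, A + D - κ < q x t → x < x₀ - (A + D) / 2 * t :=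
    fun x t ht hx => hq.lt_center_super hAκ hκ
      (fun x t ht => ⟨p x t, hp.mem x t ht, hc x t ht⟩) hA ht hx
  have hpc' : ∀ x, ∀ t ∈ Ioo 0 T, A + D - κ < p' x t → x < -x₀ - (A + D) / 2 * t :=
    fun x t ht hx => hp'.lt_center_super hAκ hκ (fun x t ht => ⟨_, by
      have := hq.mem (-x - (A + D) * t) t ht
      constructor <;> linarith [this.1, this.2], hc' x t ht⟩) hA' ht hx
  have hx' : ∀ x t, p' (-x - (A + D) * t) t = A + D - p x t := fun x t => by
    simp only [hp'_def]; ring_nf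
  have hpc : ∀ x, ∀ t ∈ Ioo 0 T, p x t < κ → x₀ - (A + D) / 2 * t < x := fun x t ht hx => by
    have := hpc' (-x - (A + D) * t) t ht (by rw [hx']; linarith)
    linarith
  refine ⟨?_, ?_, hqc x t ht, hpc x t ht⟩
  · refine hq.harmonic_edge (by linarith) hA hAκ (by linarith) (w := A + D - κ)
      ⟨le_rfl, by linarith⟩ (by linarith) (fun x t ht hf => ?_) ht
    have h1 : p x t = κ := by
      by_contra hne
      have := hpc x t ht ((hp.mem x t ht).2.lt_of_ne hne)
      linarith [hqc x t ht hf.1]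
    rw [hc x t ht, h1]
  · have := hp'.harmonic_edge (by linarith) hA' hAκ (by linarith) (w := A + D - κ)
      ⟨le_rfl, by linarith⟩ (by linarith) (fun x t ht hf => ?_) ht (x := -x - (A + D) * t)
    · rw [hx'] at this
      constructor <;> intro h1
      · have := this.1 (by linarith)
        linarith
      · have := this.2 (by linarith)
        linarith
    · have h1 : q (-x - (A + D) * t) t = A + D - κ := by
        by_contra hne
        have := hqc _ t ht ((hq.mem _ t ht).1.lt_of_ne (Ne.symm hne))
        linarith [hpc' x t ht hf.1]
      rw [hc' x t ht, h1, sub_sub_cancel]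

end Super

end NLSWhitham
end

noncomputable section

namespace NLSWhitham

/-! ### A subcritical jump -/

lemma oddSet_append_cancel (l₁ : List ℝ) (a : ℝ) (l₂ : List ℝ) :
    oddSet (l₁ ++ a :: a :: l₂) = oddSet (l₁ ++ l₂) :=
  oddSet_cancel a (List.perm_middle.trans (List.perm_middle.cons a))

section Overlap

variable {T x₀ A κ c D : ℝ} {cfg : ℝ → ℝ → Finset ℝ} {f h : ℝ → ℝ → ℝ} {bot top : ℝ}

lemma IsFan.exists_eq (hf : IsFan T x₀ bot top cfg f)
    (hA : ∀ x, ∀ t ∈ Ioo 0 T, ∀ v ∈ cfg x t, v ∈ Icc A D) {t : ℝ} (ht : t ∈ Ioo 0 T) {v : ℝ}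
    (hv : v ∈ Icc bot top) : ∃ x, f x t = v := by
  obtain ⟨K, hK0, hK⟩ : ∃ K ≥ 0, ∀ x, ∀ t ∈ Ioo 0 T, ∀ v ∈ Ioo bot top, ∀ s,
      SpeedAt (cfg x t) v s → |s| ≤ K := ⟨abs _, abs_nonneg _, fun x t ht v hv s hs =>
    (exists_speed_bound hA x t ht v hv s hs).trans (le_abs_self _)⟩
  have h1 := hf.eq_top hK hK0 ht (sub_one_lt _)
  have h2 := hf.eq_bot hK hK0 ht (lt_add_one _)
  have hle := mul_nonneg hK0 ht.1.le
  obtain ⟨x, -, hx⟩ := intermediate_value_Icc' (show x₀ - K * t - 1 ≤ x₀ + K * t + 1 by linarith)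
    (hf.continuous ht).continuousOn (show v ∈ Icc (f _ t) (f _ t) from ⟨h2 ▸ hv.1, h1 ▸ hv.2⟩)
  exact ⟨x, hx⟩

/-- A differentiable function that increases through its zeros stays nonnegative. -/
lemma neg_of_increasing_zeros {g : ℝ → ℝ} {a b : ℝ} (hab : a ≤ b) (hc : ContinuousOn g (Icc a b))
    (hd : ∀ t ∈ Ico a b, g t = 0 → ∃ d > 0, HasDerivAt g d t) (hb : g b < 0) : g a < 0 := by
  by_contra! ha
  have hS : IsCompact {t ∈ Icc a b | 0 ≤ g t} :=
    isCompact_Icc.of_isClosed_subset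
      (hc.preimage_isClosed_of_isClosed isClosed_Icc isClosed_Ici) (sep_subset _ _)
  obtain ⟨τ, ⟨hτ, hτ0⟩, hmax⟩ := hS.exists_isGreatest ⟨a, ⟨le_rfl, hab⟩, ha⟩
  have hτb : τ < b := hτ.2.lt_of_ne fun h => by rw [h] at hτ0; linarith
  have hev : ∀ᶠ t in 𝓝[>] τ, 0 < g t := by
    rcases hτ0.eq_or_lt with h0 | h0
    · obtain ⟨d, hd0, hd⟩ := hd τ ⟨hτ.1, hτb⟩ h0.symm
      have := (hasDerivAt_iff_tendsto_slope.1 hd).eventually_const_lt hd0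
      filter_upwards [nhdsWithin_mono τ (fun t (ht : τ < t) => ht.ne') this,
        self_mem_nhdsWithin] with t h1 (h2 : τ < t)
      rw [slope_def_field, ← h0, sub_zero] at h1
      exact (div_pos_iff_of_pos_right (sub_pos.2 h2)).1 h1
    · refine Filter.Eventually.filter_mono ?_ ((hc τ hτ).eventually_const_lt h0)
      exact nhdsWithin_le_of_mem (mem_of_superset (Ioo_mem_nhdsGT hτb) fun t ht =>
        ⟨hτ.1.trans ht.1.le, ht.2.le⟩)
  obtain ⟨t, h1, h2⟩ := (hev.and (Ioo_mem_nhdsGT hτb)).exists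
  exact absurd (hmax ⟨⟨hτ.1.trans h2.1.le, h2.2.le⟩, h1.le⟩) (not_le.2 h2.1)

/-- The fans of two consecutive gaps do not overlap. -/
theorem IsFan.not_overlap (hf : IsFan T x₀ κ c cfg f) (hh : IsFan T x₀ c D cfg h)
    (hA : ∀ x, ∀ t ∈ Ioo 0 T, ∀ v ∈ cfg x t, v ∈ Icc A D) (hAκ : A < κ) (hκc : κ < c)
    (hm : (A + D) / 2 < κ)
    (hcf : ∀ x, ∀ t ∈ Ioo 0 T, f x t ∈ Ioo κ c → cfg x t = oddSet [A, κ, f x t, c, h x t, D])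
    (hch : ∀ x, ∀ t ∈ Ioo 0 T, h x t ∈ Ioo c D → cfg x t = oddSet [A, κ, f x t, c, h x t, D])
    {t₁ : ℝ} (ht₁ : t₁ ∈ Ioo 0 T) (z : ℝ) : ¬ (f z t₁ < c ∧ c < h z t₁) := by
  rintro ⟨hz1, hz2⟩
  have hT : ∀ {t}, t ∈ Ioc 0 t₁ → t ∈ Ioo 0 T := fun ht => ⟨ht.1, ht.2.trans_lt ht₁.2⟩
  have hX : ∀ u ∈ Ioo κ c, ∃ χ : ℝ → ℝ, ContinuousOn χ (Icc 0 t₁) ∧ χ 0 = x₀ ∧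
      (∀ t ∈ Ioc 0 t₁, f (χ t) t = u) ∧ ∀ t ∈ Ioo 0 t₁, ∃ s,
        SpeedAt (oddSet [A, κ, u, c, h (χ t) t, D]) u s ∧ HasDerivAt χ (-s) t := by
    intro u hu
    obtain ⟨x, rfl⟩ := hf.exists_eq hA ht₁ (Ioo_subset_Icc_self hu)
    obtain ⟨χ, h1, h2, -, h3, h4⟩ := hf.char x t₁ ht₁ hu
    refine ⟨χ, h1, h2, h3, fun t ht => ?_⟩
    obtain ⟨s, hs1, hs2⟩ := h4 t ht
    have he := h3 t (Ioo_subset_Ioc_self ht)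
    rw [hcf _ t (hT (Ioo_subset_Ioc_self ht)) (he ▸ hu), he] at hs1
    exact ⟨s, hs1, hs2⟩
  have hY : ∀ v ∈ Ioo c D, ∃ χ : ℝ → ℝ, ContinuousOn χ (Icc 0 t₁) ∧ χ 0 = x₀ ∧
      (∀ t ∈ Ioc 0 t₁, h (χ t) t = v) ∧ ∀ t ∈ Ioo 0 t₁, ∃ s,
        SpeedAt (oddSet [A, κ, f (χ t) t, c, v, D]) v s ∧ HasDerivAt χ (-s) t := by
    intro u hu
    obtain ⟨x, rfl⟩ := hh.exists_eq hA ht₁ (Ioo_subset_Icc_self hu)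
    obtain ⟨χ, h1, h2, -, h3, h4⟩ := hh.char x t₁ ht₁ hu
    refine ⟨χ, h1, h2, h3, fun t ht => ?_⟩
    obtain ⟨s, hs1, hs2⟩ := h4 t ht
    have he := h3 t (Ioo_subset_Ioc_self ht)
    rw [hch _ t (hT (Ioo_subset_Ioc_self ht)) (he ▸ hu), he] at hs1
    exact ⟨s, hs1, hs2⟩
  choose! X hXc hX0 hXv hXs using hX
  choose! Y hYc hY0 hYv hYs using hY
  have hXlt : ∀ u ∈ Ioo κ c, ∀ t ∈ Ioc 0 t₁, ∀ x, f x t < u → X u t < x := fun u hu t ht x hx => by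
    by_contra! hle
    have := hf.anti t (hT ht) hle
    simp only [hXv u hu t ht] at this
    linarith
  have hYlt : ∀ v ∈ Ioo c D, ∀ t ∈ Ioc 0 t₁, ∀ x, v < h x t → x < Y v t := fun v hv t ht x hx => by
    by_contra! hle
    have := hh.anti t (hT ht) hle
    simp only [hYv v hv t ht] at this
    linarith
  -- characteristics cross in one direction only
  have hcross : ∀ u ∈ Ioo κ c, ∀ v ∈ Ioo c D, ∀ t₂ ∈ Ioc 0 t₁, X u t₂ < Y v t₂ →
      ∀ t ∈ Ioo 0 t₂, X u t < Y v t := by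
    intro u hu v hv t₂ ht₂ hlt t ht
    have hsub : Icc t t₂ ⊆ Icc 0 t₁ := Icc_subset_Icc ht.1.le ht₂.2
    refine sub_neg.1 (neg_of_increasing_zeros (g := fun t => X u t - Y v t) ht.2.le
      (((hXc u hu).mono hsub).sub ((hYc v hv).mono hsub)) (fun τ hτ h0 => ?_) (sub_neg.2 hlt))
    have hτ1 : τ ∈ Ioo 0 t₁ := ⟨ht.1.trans_le hτ.1, hτ.2.trans_le ht₂.2⟩
    have hτ2 := Ioo_subset_Ioc_self hτ1
    obtain ⟨s, hs, hs'⟩ := hXs u hu τ hτ1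
    obtain ⟨r, hr, hr'⟩ := hYs v hv τ hτ1
    rw [sub_eq_zero.1 h0, hYv v hv τ hτ2] at hs
    rw [← sub_eq_zero.1 h0, hXv u hu τ hτ2] at hr
    exact ⟨-s - -r, by linarith [hs.lt hr (hu.2.trans hv.1)], hs'.sub hr'⟩
  obtain ⟨u₀, hu₀, hu₀c⟩ := exists_between (max_lt hκc hz1)
  obtain ⟨v₀, hcv₀, hv₀⟩ := exists_between hz2
  have hκu₀ := (le_max_left _ _).trans_lt hu₀
  have hv₀D : v₀ < D := hv₀.trans_le (hh.mem z t₁ ht₁).2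
  have ht₁' : t₁ ∈ Ioc 0 t₁ := ⟨ht₁.1, le_rfl⟩
  have hstart : X u₀ t₁ < Y v₀ t₁ :=
    (hXlt u₀ ⟨hκu₀, hu₀c⟩ t₁ ht₁' z ((le_max_right _ _).trans_lt hu₀)).trans
      (hYlt v₀ ⟨hcv₀, hv₀D⟩ t₁ ht₁' z hv₀)
  obtain ⟨ε, hε, hgap⟩ := exists_crossing_gap hAκ hκu₀ hu₀c hcv₀ hv₀D hm
  set W : Set ℝ := {d | ∃ u ∈ Ioc κ u₀, ∃ v ∈ Ico v₀ D, ∃ t ∈ Ioc 0 t₁, X u t < Y v t ∧ d = u - v}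
    with hW
  have hWb : BddBelow W := ⟨κ - D, by
    rintro d ⟨u, hu, v, hv, t, -, -, rfl⟩
    linarith [hu.1, hv.2]⟩
  have hWn : W.Nonempty :=
    ⟨_, u₀, ⟨hκu₀, le_rfl⟩, v₀, ⟨le_rfl, hv₀D⟩, t₁, ht₁', hstart, rfl⟩
  obtain ⟨-, ⟨u, hu, v, hv, t₂, ht₂, hlt, rfl⟩, hd⟩ :=
    exists_lt_of_csInf_lt hWn (lt_add_of_pos_right (sInf W) hε)
  have hu' : u ∈ Ioo κ c := ⟨hu.1, hu.2.trans_lt hu₀c⟩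
  have hv' : v ∈ Ioo c D := ⟨hcv₀.trans_le hv.1, hv.2⟩
  have hcont : ContinuousOn (fun t => Y v t - X u t) (Icc 0 t₂) :=
    ((hYc v hv').sub (hXc u hu')).mono (Icc_subset_Icc le_rfl ht₂.2)
  refine absurd (nonpos_of_barrier ht₂.1.le one_pos hcont (by simp [hX0 u hu', hY0 v hv'])
    fun t ht _ _ => ?_) (not_le.2 (sub_pos.2 hlt))
  have ht1 : t ∈ Ioo 0 t₁ := ⟨ht.1, ht.2.trans_le ht₂.2⟩
  have ht2 := Ioo_subset_Ioc_self ht1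
  have hXY := hcross u hu' v hv' t₂ ht₂ hlt t ht
  obtain ⟨s, hs, hs'⟩ := hXs u hu' t ht1
  obtain ⟨r, hr, hr'⟩ := hYs v hv' t ht1
  refine ⟨-r - -s, ?_, hr'.sub hs'⟩
  have e1 := hf.anti t (hT ht2) hXY.le
  simp only [hXv u hu' t ht2] at e1
  have e2 := hh.anti t (hT ht2) hXY.le
  simp only [hYv v hv' t ht2] at e2
  have := hgap u hu v hv (f (Y v t) t) ⟨(hf.mem _ t (hT ht2)).1, e1⟩ (by
      by_contra! hlt'
      obtain ⟨w, hw1, hw2⟩ := exists_between (lt_sub_comm.1 hlt')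
      have hw : w ∈ Ioc κ u₀ := ⟨(hf.mem _ t (hT ht2)).1.trans_lt hw1, by linarith [hu.2]⟩
      have := csInf_le hWb ⟨w, hw, v, hv, t, ht2,
        hXlt w ⟨hw.1, hw.2.trans_lt hu₀c⟩ t ht2 _ hw1, rfl⟩
      linarith)
    (h (X u t) t) ⟨e2, (hh.mem _ t (hT ht2)).2⟩ (by
      by_contra! hlt'
      obtain ⟨w, hw1, hw2⟩ := exists_between (lt_sub_iff_add_lt.1 hlt')
      have hw : w ∈ Ico v₀ D := ⟨by linarith [hv.1], hw2.trans_le (hh.mem _ t (hT ht2)).2⟩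
      have := csInf_le hWb ⟨u, hu, w, hw, t, ht2,
        hYlt w ⟨hcv₀.trans_le hw.1, hw.2⟩ t ht2 _ hw2, rfl⟩
      linarith) s r hs hr
  linarith

end Overlap

end NLSWhitham
end

noncomputable section

namespace NLSWhitham

section Sub

variable {T x₀ A κ c D : ℝ} {cfg : ℝ → ℝ → Finset ℝ} {p f h : ℝ → ℝ → ℝ}

/-- The second largest branch point is not slower than the center of the jump. -/
lemma SpeedAt.center_le {B : Finset ℝ} {y s : ℝ} (hs : SpeedAt B y s) (hm : (A + D) / 2 < κ)
    (hy : κ < y) (hyD : y < D) (hD : D ∈ B) (hB : ∀ z ∈ B, z ≤ y ∨ z = D) (hA : ∀ z ∈ B, A ≤ z)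
    (hr : ∃ r ∈ B, κ ≤ r ∧ r < y) : (A + D) / 2 ≤ s := by
  have := hs.gt_of_second hyD hD hB hA hr
  linarith

lemma IsFan.lt_center_upper (hκ : (A + D) / 2 < κ) (hA : A < κ) (hκc : κ ≤ c)
    (hp : ∀ x, ∀ t ∈ Ioo 0 T, p x t ∈ Icc A (A + D - κ))
    (hf : ∀ x, ∀ t ∈ Ioo 0 T, f x t ∈ Icc κ c) (hh : IsFan T x₀ c D cfg h)
    (hc : ∀ x, ∀ t ∈ Ioo 0 T,
      cfg x t = oddSet [A, p x t, A + D - κ, κ, f x t, c, h x t, D])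
    (hb : ∀ x, ∀ t ∈ Ioo 0 T, ∀ v ∈ cfg x t, v ∈ Icc A D) {x t : ℝ} (ht : t ∈ Ioo 0 T)
    (hx : c < h x t) : x < x₀ - (A + D) / 2 * t := by
  refine hh.lt_of_speed (exists_speed_bound hb) (fun x t ht hy s hs => ?_) ht hx
  have h1 := hp x t ht
  have h2 := hf x t ht
  have hcfg := hc x t ht
  refine hs.center_le hκ (hκc.trans_lt hy.1) hy.2 ?_ (fun z hz => ?_)
    (fun z hz => (hb x t ht z hz).1) ?_
  · rw [hcfg, mem_oddSet_cons_of_ne (by linarith [hy.1, hy.2]),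
      mem_oddSet_cons_of_ne (by linarith [hy.1, hy.2, h1.2]),
      mem_oddSet_cons_of_ne (by linarith [hy.1, hy.2]),
      mem_oddSet_cons_of_ne (by linarith [hy.1, hy.2]),
      mem_oddSet_cons_of_ne (by linarith [hy.1, hy.2, h2.2]),
      mem_oddSet_cons_of_ne (by linarith [hy.1, hy.2]), mem_oddSet_cons_of_ne hy.2.ne']
    simp [mem_oddSet]
  · rw [hcfg] at hz
    have := mem_of_mem_oddSet hz
    simp only [List.mem_cons, List.not_mem_nil, or_false] at this
    rcases this with rfl | rfl | rfl | rfl | rfl | rfl | rfl | rfl <;>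
      first | (right; rfl) | (left; linarith [hy.1, h1.2, h2.2])
  · rcases h2.1.eq_or_lt with he | hlt
    · refine ⟨c, ?_, hκc, hy.1⟩
      rw [hcfg, ← he, show oddSet [A, p x t, A + D - κ, κ, κ, c, h x t, D] =
        oddSet [A, p x t, A + D - κ, c, h x t, D] from
          oddSet_append_cancel [A, p x t, A + D - κ] κ [c, h x t, D],
        mem_oddSet_cons_of_ne (by linarith [hy.1, hy.2]),
        mem_oddSet_cons_of_ne (by linarith [hy.1, hy.2, h1.2]),
        mem_oddSet_cons_of_ne (by linarith [hy.1, hy.2]), mem_oddSet_cons_self,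
        mem_oddSet_cons_of_ne hy.1.ne, mem_oddSet_cons_of_ne (hy.1.trans hy.2).ne]
      simp [mem_oddSet]
    · refine ⟨κ, ?_, le_rfl, hκc.trans_lt hy.1⟩
      rw [hcfg, mem_oddSet_cons_of_ne (by linarith [hy.1, hy.2]),
        mem_oddSet_cons_of_ne (by linarith [hy.1, hy.2, h1.2]),
        mem_oddSet_cons_of_ne (by linarith [hy.1, hy.2]), mem_oddSet_cons_self,
        mem_oddSet_cons_of_ne hlt.ne, mem_oddSet_cons_of_ne (hlt.trans_le h2.2).ne,
        mem_oddSet_cons_of_ne (hκc.trans_lt hy.1).ne,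
        mem_oddSet_cons_of_ne (hκc.trans_lt (hy.1.trans hy.2)).ne]
      simp [mem_oddSet]

lemma IsFan.lt_center_lower (hκ : (A + D) / 2 < κ) (hA : A < κ) (hcD : c < D)
    (hp : ∀ x, ∀ t ∈ Ioo 0 T, p x t ∈ Icc A (A + D - κ))
    (hf : IsFan T x₀ κ c cfg f)
    (hc : ∀ x, ∀ t ∈ Ioo 0 T, f x t ∈ Ioo κ c → x₀ - (A + D) / 2 * t < x →
      cfg x t = oddSet [A, p x t, A + D - κ, κ, f x t, D])
    (hb : ∀ x, ∀ t ∈ Ioo 0 T, ∀ v ∈ cfg x t, v ∈ Icc A D) {x t : ℝ} (ht : t ∈ Ioo 0 T)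
    (hx : κ < f x t) : x < x₀ - (A + D) / 2 * t := by
  refine hf.lt_of_bot_lt (exists_speed_bound hb) ht (fun x₁ hx₁ => ?_) hx
  obtain ⟨χ, hχ, h0, h1, hv, hs⟩ := hf.char x₁ t ht hx₁
  have hcont : ContinuousOn (fun t => χ t - (x₀ - (A + D) / 2 * t)) (Icc 0 t) :=
    hχ.sub (by fun_prop)
  rw [← sub_nonpos, ← h1]
  refine nonpos_of_barrier (g := fun t => χ t - (x₀ - (A + D) / 2 * t)) ht.1.le one_pos hcont
    (by simp [h0]) fun τ hτ hpos _ => ?_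
  obtain ⟨s, hs1, hs2⟩ := hs τ hτ
  have hτT : τ ∈ Ioo 0 T := ⟨hτ.1, hτ.2.trans ht.2⟩
  have hfe := hv τ (Ioo_subset_Ioc_self hτ)
  have hy : f (χ τ) τ ∈ Ioo κ c := by rwa [hfe]
  have hd := hs2.sub (((hasDerivAt_id τ).const_mul ((A + D) / 2)).const_sub x₀)
  refine ⟨_, ?_, hd⟩
  rw [← hfe] at hs1
  have hcfg := hc _ τ hτT hy (sub_pos.1 hpos)
  have h1 := hp (χ τ) τ hτT
  have : (A + D) / 2 ≤ s := by
    refine hs1.center_le hκ hy.1 (hy.2.trans hcD) ?_ (fun z hz => ?_)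
      (fun z hz => (hb _ τ hτT z hz).1) ⟨κ, ?_, le_rfl, hy.1⟩
    · rw [hcfg, mem_oddSet_cons_of_ne (by linarith [hy.1, hy.2]),
        mem_oddSet_cons_of_ne (by linarith [hy.1, hy.2, h1.2]),
        mem_oddSet_cons_of_ne (by linarith [hy.1, hy.2]),
        mem_oddSet_cons_of_ne (by linarith [hy.1, hy.2]),
        mem_oddSet_cons_of_ne (by linarith [hy.1, hy.2])]
      simp [mem_oddSet]
    · rw [hcfg] at hz
      have := mem_of_mem_oddSet hz
      simp only [List.mem_cons, List.not_mem_nil, or_false] at this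
      rcases this with rfl | rfl | rfl | rfl | rfl | rfl <;>
        first | (right; rfl) | (left; linarith [hy.1, h1.2])
    · rw [hcfg, mem_oddSet_cons_of_ne (by linarith [hy.1, hy.2]),
        mem_oddSet_cons_of_ne (by linarith [hy.1, hy.2, h1.2]),
        mem_oddSet_cons_of_ne (by linarith [hy.1, hy.2]), mem_oddSet_cons_self,
        mem_oddSet_cons_of_ne hy.1.ne, mem_oddSet_cons_of_ne (hy.1.trans (hy.2.trans hcD)).ne]
      simp [mem_oddSet]
  simp only [mul_one]
  linarith

lemma IsFan.lt_center_outer (hκ : (A + D) / 2 < κ) (hκc : κ ≤ c) (hcD : c < D)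
    (hp : IsFan T x₀ κ D cfg p) (hf : ∀ x, ∀ t ∈ Ioo 0 T, f x t ∈ Icc κ c)
    (hh : ∀ x, ∀ t ∈ Ioo 0 T, h x t ∈ Icc c D)
    (hc : ∀ x, ∀ t ∈ Ioo 0 T, cfg x t =
      oddSet [A, A + D - h x t, A + D - c, A + D - f x t, A + D - κ, κ, p x t, D])
    (hb : ∀ x, ∀ t ∈ Ioo 0 T, ∀ v ∈ cfg x t, v ∈ Icc A D) {x t : ℝ} (ht : t ∈ Ioo 0 T)
    (hx : κ < p x t) : x < x₀ - (A + D) / 2 * t := by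
  refine hp.lt_of_speed (exists_speed_bound hb) (fun x t ht hy s hs => ?_) ht hx
  have h1 := hh x t ht
  have h2 := hf x t ht
  have hcfg := hc x t ht
  refine hs.center_le hκ hy.1 hy.2 ?_ (fun z hz => ?_)
    (fun z hz => (hb x t ht z hz).1) ⟨κ, ?_, le_rfl, hy.1⟩
  · rw [hcfg, mem_oddSet_cons_of_ne (by linarith [hy.1, hy.2]),
      mem_oddSet_cons_of_ne (by linarith [hy.1, hy.2, h1.1]),
      mem_oddSet_cons_of_ne (by linarith [hy.1, hy.2]),
      mem_oddSet_cons_of_ne (by linarith [hy.1, hy.2, h2.1]),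
      mem_oddSet_cons_of_ne (by linarith [hy.1, hy.2]),
      mem_oddSet_cons_of_ne (by linarith [hy.1, hy.2]), mem_oddSet_cons_of_ne hy.2.ne']
    simp [mem_oddSet]
  · rw [hcfg] at hz
    have := mem_of_mem_oddSet hz
    simp only [List.mem_cons, List.not_mem_nil, or_false] at this
    rcases this with rfl | rfl | rfl | rfl | rfl | rfl | rfl | rfl <;>
      first | (right; rfl) | (left; linarith [hy.1, h1.1, h2.1])
  · rw [hcfg, mem_oddSet_cons_of_ne (by linarith [hy.1, hy.2]),
      mem_oddSet_cons_of_ne (by linarith [hy.1, hy.2, h1.1]),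
      mem_oddSet_cons_of_ne (by linarith [hy.1, hy.2]),
      mem_oddSet_cons_of_ne (by linarith [hy.1, hy.2, h2.1]),
      mem_oddSet_cons_of_ne (by linarith [hy.1, hy.2]), mem_oddSet_cons_self,
      mem_oddSet_cons_of_ne hy.1.ne, mem_oddSet_cons_of_ne (hy.1.trans hy.2).ne]
    simp [mem_oddSet]

/-- The structure of the solution at a subcritical jump. -/
theorem sub_jump (hAκ : A < κ) (hκ : (A + D) / 2 < κ) (hκc : κ ≤ c) (hcD : c < D)
    (hp : IsFan T x₀ A (A + D - κ) cfg p) (hf : IsFan T x₀ κ c cfg f) (hh : IsFan T x₀ c D cfg h)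
    (hc : ∀ x, ∀ t ∈ Ioo 0 T,
      cfg x t = oddSet [A, p x t, A + D - κ, κ, f x t, c, h x t, D])
    {t : ℝ} (ht : t ∈ Ioo 0 T) (x : ℝ) :
    (h x t < D ↔ x₀ - (D - ((κ - A) / 2) ^ 2 / (2 * (D - (A + κ) / 2))) * t < x) ∧
    (κ < f x t ∨ c < h x t ↔ x < x₀ - (A + 2 * κ + D) / 4 * t) ∧
    (c < h x t → f x t = c) ∧
    (p x t < A + D - κ ↔ x₀ + ((A + 2 * κ + D) / 4 - (A + D)) * t < x) ∧
    (A < p x t ↔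
      x < x₀ + (D - ((κ - A) / 2) ^ 2 / (2 * (D - (A + κ) / 2)) - (A + D)) * t) := by
  have hb : ∀ x, ∀ t ∈ Ioo 0 T, ∀ v ∈ cfg x t, v ∈ Icc A D := fun x t ht v hv => by
    rw [hc x t ht] at hv
    have := mem_of_mem_oddSet hv
    have h1 := hp.mem x t ht
    have h2 := hf.mem x t ht
    have h3 := hh.mem x t ht
    simp only [List.mem_cons, List.not_mem_nil, or_false] at this
    rcases this with rfl | rfl | rfl | rfl | rfl | rfl | rfl | rfl <;> constructor <;>
      linarith [h1.1, h1.2, h2.1, h2.2, h3.1, h3.2]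
  have hp' := hp.reflect ((A + D) / 2)
  have e1 : 2 * ((A + D) / 2) - (A + D - κ) = κ := by ring
  have e2 : 2 * ((A + D) / 2) - A = D := by ring
  have e3 : 2 * ((A + D) / 2) = A + D := by ring
  rw [e1, e2] at hp'
  simp only [e3] at hp'
  set p' : ℝ → ℝ → ℝ := fun x t => A + D - p (-x - (A + D) * t) t with hp'_def
  set cfg' : ℝ → ℝ → Finset ℝ :=
    fun x t => (cfg (-x - (A + D) * t) t).image fun v => A + D - v with hcfg'
  have hc' : ∀ x, ∀ t ∈ Ioo 0 T, cfg' x t = oddSet [A, A + D - h (-x - (A + D) * t) t,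
      A + D - c, A + D - f (-x - (A + D) * t) t, A + D - κ, κ, p' x t, D] := fun x t ht => by
    rw [hcfg']
    simp only
    rw [hc _ t ht, oddSet_reflect]
    refine oddSet_perm ?_
    simp only [List.map_cons, List.map_nil, add_sub_cancel_left, add_sub_cancel_right,
      sub_sub_cancel]
    exact (List.reverse_perm _).symm
  have hb' : ∀ x, ∀ t ∈ Ioo 0 T, ∀ v ∈ cfg' x t, v ∈ Icc A D := fun x t ht v hv => by
    obtain ⟨w, hw, rfl⟩ := Finset.mem_image.1 hv
    have := hb _ t ht w hw
    constructor <;> linarith [this.1, this.2]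
  have hhc : ∀ x, ∀ t ∈ Ioo 0 T, c < h x t → x < x₀ - (A + D) / 2 * t :=
    fun x t ht hx => hh.lt_center_upper hκ hAκ hκc hp.mem hf.mem hc hb ht hx
  have hfc : ∀ x, ∀ t ∈ Ioo 0 T, κ < f x t → x < x₀ - (A + D) / 2 * t := fun x t ht hx =>
    hf.lt_center_lower hκ hAκ hcD hp.mem (fun x t ht _ hlt => by
      have h1 : h x t = c := by
        by_contra hne
        exact absurd (hhc x t ht ((hh.mem x t ht).1.lt_of_ne (Ne.symm hne))) hlt.not_gt
      rw [hc x t ht, h1]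
      exact oddSet_append_cancel [A, p x t, A + D - κ, κ, f x t] c [D]) hb ht hx
  have hpc' : ∀ x, ∀ t ∈ Ioo 0 T, κ < p' x t → x < -x₀ - (A + D) / 2 * t := fun x t ht hx =>
    hp'.lt_center_outer hκ hκc hcD (fun x t ht => hf.mem _ t ht) (fun x t ht => hh.mem _ t ht)
      hc' hb' ht hx
  have hx' : ∀ x t, p' (-x - (A + D) * t) t = A + D - p x t := fun x t => by
    simp only [hp'_def]; ring_nf
  have hpb : ∀ x, ∀ t ∈ Ioo 0 T, x < x₀ - (A + D) / 2 * t → p x t = A + D - κ :=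
    fun x t ht hx => by
      by_contra hne
      have h1 := (hp.mem x t ht).2.lt_of_ne hne
      have := hpc' (-x - (A + D) * t) t ht (by rw [hx']; linarith)
      linarith
  have hleft : ∀ x, ∀ t ∈ Ioo 0 T, x < x₀ - (A + D) / 2 * t →
      cfg x t = oddSet [A, κ, f x t, c, h x t, D] := fun x t ht hx => by
    rw [hc x t ht, hpb x t ht hx]
    exact oddSet_append_cancel [A] (A + D - κ) [κ, f x t, c, h x t, D]
  have hright : ∀ x, ∀ t ∈ Ioo 0 T, κ < p' x t → cfg' x t = oddSet [A, κ, p' x t, D] :=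
    fun x t ht hx => by
      have hlt := hpc' x t ht hx
      have h1 : h (-x - (A + D) * t) t = c := by
        by_contra hne
        have := hhc _ t ht ((hh.mem _ t ht).1.lt_of_ne (Ne.symm hne))
        linarith
      have h2 : f (-x - (A + D) * t) t = κ := by
        by_contra hne
        have := hfc _ t ht ((hf.mem _ t ht).1.lt_of_ne (Ne.symm hne))
        linarith
      rw [hc' x t ht, h1, h2]
      exact (oddSet_append_cancel [A] (A + D - c) [A + D - κ, A + D - κ, κ, p' x t, D]).trans
        (oddSet_append_cancel [A] (A + D - κ) [κ, p' x t, D])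
  have hover : ∀ x, ∀ t ∈ Ioo 0 T, c < h x t → f x t = c := fun x t ht hx => by
    rcases hκc.eq_or_lt with rfl | hlt
    · exact le_antisymm (hf.mem x t ht).2 (hf.mem x t ht).1
    · by_contra hne
      exact hf.not_overlap hh hb hAκ hlt hκ (fun x t ht hf => hleft x t ht (hfc x t ht hf.1))
        (fun x t ht hh => hleft x t ht (hhc x t ht hh.1)) ht x
        ⟨(hf.mem x t ht).2.lt_of_ne hne, hx⟩
  refine ⟨?_, ?_, hover x t ht, ?_, ?_⟩
  · refine hh.harmonic_edge hcD hb hAκ (by linarith) ⟨le_rfl, hcD⟩ hκc (fun x t ht hx => ?_) ht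
    rw [hleft x t ht (hhc x t ht hx.1), hover x t ht hx.1]
    exact oddSet_append_cancel [A, κ] c [h x t, D]
  · rcases hκc.eq_or_lt with rfl | hlt
    · have h1 : ∀ x, ∀ t ∈ Ioo 0 T, f x t = κ := fun x t ht =>
        le_antisymm (hf.mem x t ht).2 (hf.mem x t ht).1
      rw [h1 x t ht, or_iff_right (lt_irrefl _)]
      refine hh.soliton_edge hcD hb hAκ (by linarith) hκ (fun x t ht hx => ?_) ht
      rw [hleft x t ht (hhc x t ht hx.1), h1 x t ht]
      exact oddSet_append_cancel [A] κ [κ, h x t, D]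
    · have h1 : κ < f x t ∨ c < h x t ↔ κ < f x t :=
        or_iff_left_of_imp fun h1 => by rwa [hover x t ht h1]
      rw [h1]
      refine hf.soliton_edge hlt hb hAκ (by linarith) hκ (fun x t ht hx => ?_) ht
      have h2 : h x t = c := by
        by_contra hne
        exact hx.2.ne (hover x t ht ((hh.mem x t ht).1.lt_of_ne (Ne.symm hne)))
      rw [hleft x t ht (hfc x t ht hx.1), h2]
      exact oddSet_append_cancel [A, κ, f x t] c [D]
  · have := hp'.soliton_edge (by linarith) hb' hAκ (by linarith) hκ
      (fun x t ht hx => hright x t ht hx.1) ht (x := -x - (A + D) * t)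
    rw [hx'] at this
    constructor <;> intro h1
    · have := this.1 (by linarith)
      linarith
    · have := this.2 (by linarith)
      linarith
  · have := hp'.harmonic_edge (by linarith) hb' hAκ (by linarith) (w := κ)
      ⟨le_rfl, by linarith⟩ le_rfl (fun x t ht hx => hright x t ht hx.1) ht
      (x := -x - (A + D) * t)
    rw [hx'] at this
    constructor <;> intro h1
    · have := this.1 (by linarith)
      linarith
    · have := this.2 (by linarith)
      linarith

end Sub

end NLSWhitham
end

noncomputable section

namespace NLSWhitham

/-! ### Solutions with step data -/

/-- A solution whose initial data have the values `L`, `M`, `R`, without any condition at the jumps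
`-X / 2` and `X / 2`. -/
structure IsJumpSolution {n : ℕ} (T X : ℝ) (L M R : Fin n → ℝ) (r : Fin n → ℝ → ℝ → ℝ) :
    Prop where
  continuousOn : ∀ k, ContinuousOn (fun p : ℝ × ℝ => r k p.1 p.2) (univ ×ˢ Ioo 0 T)
  nonincreasing : ∀ k, ∀ t ∈ Ioo 0 T, Antitone fun x => r k x t
  left : ∀ k, ∀ x < -X / 2,
    Tendsto (fun p : ℝ × ℝ => r k p.1 p.2) (𝓝 x ×ˢ 𝓝[>] 0) (𝓝 (L k))
  mid : ∀ k, ∀ x ∈ Ioo (-X / 2) (X / 2),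
    Tendsto (fun p : ℝ × ℝ => r k p.1 p.2) (𝓝 x ×ˢ 𝓝[>] 0) (𝓝 (M k))
  right : ∀ k, ∀ x > X / 2,
    Tendsto (fun p : ℝ × ℝ => r k p.1 p.2) (𝓝 x ×ˢ 𝓝[>] 0) (𝓝 (R k))
  characteristic : ∀ k x₁, ∀ t₁ ∈ Ioo 0 T, ∃ χ : ℝ → ℝ,
    ContinuousOn χ (Icc 0 t₁) ∧ χ t₁ = x₁ ∧
    (∀ t ∈ Ioc 0 t₁, r k (χ t) t = r k x₁ t₁) ∧
    ∀ t ∈ Ioo 0 t₁, (∀ l ≠ k, r l (χ t) t ≠ r k x₁ t₁) →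
      ∃ s, SpeedAt (branchPoints fun l => r l (χ t) t) (r k x₁ t₁) s ∧ HasDerivAt χ (-s) t

variable {n : ℕ} {T X : ℝ} {L M R : Fin n → ℝ} {r : Fin n → ℝ → ℝ → ℝ}

lemma IsWhithamSolution.isJumpSolution (hX : 0 < X)
    (h : IsWhithamSolution T (stepData X L M R) r) : IsJumpSolution T X L M R r where
  continuousOn := h.continuousOn
  nonincreasing := h.nonincreasing
  left k x hx := by
    have he : stepData X L M R k =ᶠ[𝓝 x] fun _ => L k := by
      filter_upwards [Iio_mem_nhds hx] with y hy
      exact if_pos hy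
    have := h.initial k x (continuousAt_const.congr he.symm)
    rwa [he.eq_of_nhds] at this
  mid k x hx := by
    have he : stepData X L M R k =ᶠ[𝓝 x] fun _ => M k := by
      filter_upwards [Ioo_mem_nhds hx.1 hx.2] with y hy
      simp only [stepData]
      rw [if_neg hy.1.not_gt, if_pos hy.2]
    have := h.initial k x (continuousAt_const.congr he.symm)
    rwa [he.eq_of_nhds] at this
  right k x hx := by
    have he : stepData X L M R k =ᶠ[𝓝 x] fun _ => R k := by
      filter_upwards [Ioi_mem_nhds hx] with y hy
      have hy' : X / 2 < y := hy
      simp only [stepData]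
      rw [if_neg (by linarith), if_neg hy'.not_gt]
    have := h.initial k x (continuousAt_const.congr he.symm)
    rwa [he.eq_of_nhds] at this
  characteristic k x₁ t₁ ht := by
    obtain ⟨χ, h1, h2, h3, h4⟩ := h.characteristic k x₁ t₁ ht
    refine ⟨χ, h1, h2, h3, fun t ht' hnd => ?_⟩
    have he := h3 t (Ioo_subset_Ioc_self ht')
    obtain ⟨s, hs, hs'⟩ := h4 t ht' fun l hl => by
      by_contra hne
      exact hnd l hne (hl.trans he)
    exact ⟨s, he ▸ hs.speedAt, hs'⟩

lemma branchPoints_neg_rev (v : Fin n → ℝ) :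
    branchPoints (fun k => -v k.rev) = (branchPoints v).image fun x => 0 - x := by
  rw [branchPoints_eq_oddSet, branchPoints_eq_oddSet, oddSet_reflect, List.map_ofFn]
  refine oddSet_perm ?_
  have := Equiv.Perm.ofFn_comp_perm (Fin.revPerm (n := n)) fun k => 0 - v k
  simpa [Function.comp_def] using this

/-- The reflection of a solution. -/
lemma IsJumpSolution.reflect (h : IsJumpSolution T X L M R r) :
    IsJumpSolution T X (fun k => -R k.rev) (fun k => -M k.rev) (fun k => -L k.rev)
      (fun k x t => -r k.rev (-x) t) where
  continuousOn k := by
    have h1 : Continuous fun p : ℝ × ℝ => (-p.1, p.2) := by fun_prop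
    exact ((h.continuousOn k.rev).comp h1.continuousOn fun p hp => ⟨mem_univ _, hp.2⟩).neg
  nonincreasing k t ht x y hxy := neg_le_neg (h.nonincreasing k.rev t ht (neg_le_neg hxy))
  left k x hx := by
    have := tendsto_shear 0 x
    simp only [mul_zero, zero_mul, sub_zero] at this
    exact ((h.right k.rev (-x) (by linarith)).comp this).neg
  mid k x hx := by
    have := tendsto_shear 0 x
    simp only [mul_zero, zero_mul, sub_zero] at this
    exact ((h.mid k.rev (-x) ⟨by linarith [hx.2], by linarith [hx.1]⟩).comp this).neg
  right k x hx := by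
    have := tendsto_shear 0 x
    simp only [mul_zero, zero_mul, sub_zero] at this
    exact ((h.left k.rev (-x) (by linarith)).comp this).neg
  characteristic k x₁ t₁ ht := by
    obtain ⟨χ, h1, h2, h3, h4⟩ := h.characteristic k.rev (-x₁) t₁ ht
    refine ⟨fun t => -χ t, h1.neg, by simp [h2], fun t ht' => ?_, fun t ht' hnd => ?_⟩
    · simp only [neg_neg]; rw [h3 t ht']
    · obtain ⟨s, hs, hs'⟩ := h4 t ht' fun l hl he => hnd l.rev
        (fun h => hl (by rw [← h, Fin.rev_rev])) (by simp [he])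
      refine ⟨-s, ?_, hs'.neg⟩
      simp only [neg_neg]
      rw [branchPoints_neg_rev fun l => r l (χ t) t]
      have := hs.reflect 0
      simpa using this

lemma IsJumpSolution.le_of_start (h : IsJumpSolution T X L M R r) {k : Fin n} {χ : ℝ → ℝ}
    {t₁ v : ℝ} (ht : t₁ ∈ Ioo 0 T) (hχ : ContinuousOn χ (Icc 0 t₁))
    (hv : ∀ t ∈ Ioc 0 t₁, r k (χ t) t = v) {x y : ℝ} (hx : x < χ 0)
    (hy : Tendsto (fun p : ℝ × ℝ => r k p.1 p.2) (𝓝 x ×ˢ 𝓝[>] 0) (𝓝 y)) : v ≤ y := by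
  have hT : Ioo 0 t₁ ∈ 𝓝[>] (0 : ℝ) := Ioo_mem_nhdsGT ht.1
  refine ge_of_tendsto (hy.comp (tendsto_const_nhds.prodMk tendsto_id)) ?_
  have hc' : ∀ᶠ t in 𝓝[>] 0, x < χ t := by
    have : ContinuousWithinAt χ (Icc 0 t₁) 0 := hχ 0 ⟨le_rfl, ht.1.le⟩
    exact Filter.Eventually.filter_mono (nhdsWithin_le_of_mem
      (mem_of_superset hT Ioo_subset_Icc_self)) (this.eventually_const_lt hx)
  filter_upwards [hc', hT] with t h1 h2
  rw [← hv t (Ioo_subset_Ioc_self h2)]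
  exact h.nonincreasing k t ⟨h2.1, h2.2.trans ht.2⟩ h1.le

lemma IsJumpSolution.ge_of_start (h : IsJumpSolution T X L M R r) {k : Fin n} {χ : ℝ → ℝ}
    {t₁ v : ℝ} (ht : t₁ ∈ Ioo 0 T) (hχ : ContinuousOn χ (Icc 0 t₁))
    (hv : ∀ t ∈ Ioc 0 t₁, r k (χ t) t = v) {x y : ℝ} (hx : χ 0 < x)
    (hy : Tendsto (fun p : ℝ × ℝ => r k p.1 p.2) (𝓝 x ×ˢ 𝓝[>] 0) (𝓝 y)) : y ≤ v := by
  have h0 := tendsto_shear 0 (-x)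
  simp only [mul_zero, zero_mul, sub_zero, neg_neg] at h0
  have := h.reflect.le_of_start (k := k.rev) (χ := fun t => -χ t) (v := -v) (x := -x) (y := -y) ht
    hχ.neg (fun t ht' => by simp [hv t ht']) (by linarith) (by
      simp only [Fin.rev_rev]
      exact (hy.comp h0).neg)
  linarith

lemma IsJumpSolution.le_left (h : IsJumpSolution T X L M R r) (k : Fin n) (x : ℝ) {t : ℝ}
    (ht : t ∈ Ioo 0 T) : r k x t ≤ L k := by
  obtain ⟨χ, h1, -, h3, -⟩ := h.characteristic k x t ht
  exact h.le_of_start ht h1 h3 (x := min (χ 0) (-X / 2) - 1)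
    (by linarith [min_le_left (χ 0) (-X / 2)])
    (h.left k _ (by linarith [min_le_right (χ 0) (-X / 2)]))

lemma IsJumpSolution.right_le (h : IsJumpSolution T X L M R r) (k : Fin n) (x : ℝ) {t : ℝ}
    (ht : t ∈ Ioo 0 T) : R k ≤ r k x t := by
  obtain ⟨χ, h1, -, h3, -⟩ := h.characteristic k x t ht
  exact h.ge_of_start ht h1 h3 (x := max (χ 0) (X / 2) + 1)
    (by linarith [le_max_left (χ 0) (X / 2)])
    (h.right k _ (by linarith [le_max_right (χ 0) (X / 2)]))

lemma IsJumpSolution.exists_speed_bound (h : IsJumpSolution T X L M R r) : ∃ K ≥ 0, ∀ x,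
    ∀ t ∈ Ioo 0 T, ∀ v s, SpeedAt (branchPoints fun l => r l x t) v s → |s| ≤ K := by
  set K := ∑ k, (|L k| + |R k|) with hK
  have hle : ∀ k, |L k| + |R k| ≤ K := fun k =>
    Finset.single_le_sum (f := fun k => |L k| + |R k|) (fun k _ => by positivity)
      (Finset.mem_univ k)
  refine ⟨abs _, abs_nonneg _, fun x t ht v s hs =>
    (hs.abs_le (a := -K) (d := K) fun y hy => ?_).trans (le_abs_self _)⟩
  rw [branchPoints_eq_oddSet] at hy
  obtain ⟨k, rfl⟩ := (List.mem_ofFn' _ _).1 (mem_of_mem_oddSet hy)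
  have h1 := h.le_left k x ht
  have h2 := h.right_le k x ht
  have h3 := hle k
  constructor
  · linarith [neg_abs_le (R k), abs_nonneg (L k)]
  · linarith [le_abs_self (L k), abs_nonneg (R k)]

lemma IsJumpSolution.continuousAt_time (h : IsJumpSolution T X L M R r) (k : Fin n) (x : ℝ) {t : ℝ}
    (ht : t ∈ Ioo 0 T) : ContinuousAt (fun t => r k x t) t := by
  have h1 : Continuous fun t : ℝ => (x, t) := by fun_prop
  have h2 := (h.continuousOn k).continuousAt (x := (x, t))
    ((isOpen_univ.prod isOpen_Ioo).mem_nhds ⟨mem_univ x, ht⟩)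
  exact ContinuousAt.comp (f := fun t : ℝ => (x, t)) (x := t) h2 h1.continuousAt

lemma eq_of_eq_before {f : ℝ → ℝ} {τ v : ℝ} (hτ : 0 < τ) (hf : ContinuousAt f τ)
    (h : ∀ t ∈ Ioo 0 τ, f t = v) : f τ = v := by
  have h1 : Tendsto f (𝓝[<] τ) (𝓝 v) := tendsto_const_nhds.congr' (by
    filter_upwards [Ioo_mem_nhdsLT hτ] with t ht
    exact (h t ht).symm)
  exact tendsto_nhds_unique (hf.tendsto.mono_left nhdsWithin_le_nhds) h1

/-- Near the middle state, the values from the left jump need some time to reach `x = 0`. -/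
lemma IsJumpSolution.eventually_eq_mid (h : IsJumpSolution T X L M R r) {k : Fin n}
    (hR : M k = R k) (hnd : ∀ l ≠ k, M l = M k → L l = M l) {τ a b : ℝ} (hτ : τ ∈ Ico 0 T)
    (ha : a < 0) (hb : 0 < b) (hla : ∀ l, Tendsto (fun t => r l a t) (𝓝[>] τ) (𝓝 (M l)))
    (hlb : ∀ l, Tendsto (fun t => r l b t) (𝓝[>] τ) (𝓝 (M l)))
    (hterm : τ = 0 ∧ a ∈ Ioo (-X / 2) (X / 2) ∨ 0 < τ ∧ r k a τ = M k) :
    ∀ᶠ t in 𝓝[>] τ, r k 0 t = M k := by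
  obtain ⟨K, hK0, hK⟩ := h.exists_speed_bound
  have hTn : Ioo τ T ∈ 𝓝[>] τ := Ioo_mem_nhdsGT hτ.2
  have hev : ∀ᶠ t in 𝓝[>] τ, ∀ l, l ≠ k → ∀ x ∈ Icc a b, M k < r k x t → r l x t ≠ r k x t := by
    refine eventually_all.2 fun l => ?_
    rcases eq_or_ne l k with rfl | hlk
    · exact Eventually.of_forall fun t h => absurd rfl h
    rcases lt_trichotomy (M l) (M k) with hlt | heq | hgt
    · obtain ⟨w, hw1, hw2⟩ := exists_between hlt
      filter_upwards [(hla l).eventually_lt_const hw1, (hlb k).eventually_const_lt hw2, hTn] with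
        t h1 h2 h3 _ x hx _
      have ht : t ∈ Ioo 0 T := ⟨hτ.1.trans_lt h3.1, h3.2⟩
      have e1 := h.nonincreasing l t ht hx.1
      have e2 := h.nonincreasing k t ht hx.2
      simp only at e1 e2
      linarith
    · filter_upwards [hTn] with t h3 _ x hx hgt
      have ht : t ∈ Ioo 0 T := ⟨hτ.1.trans_lt h3.1, h3.2⟩
      have e1 := h.le_left l x ht
      rw [hnd l hlk heq] at e1
      linarith
    · obtain ⟨w, hw1, hw2⟩ := exists_between hgt
      filter_upwards [(hla k).eventually_lt_const hw1, (hlb l).eventually_const_lt hw2, hTn] with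
        t h1 h2 h3 _ x hx _
      have ht : t ∈ Ioo 0 T := ⟨hτ.1.trans_lt h3.1, h3.2⟩
      have e1 := h.nonincreasing k t ht hx.1
      have e2 := h.nonincreasing l t ht hx.2
      simp only at e1 e2
      linarith
  obtain ⟨u, hu, hsub⟩ := mem_nhdsGT_iff_exists_Ioo_subset.1 hev
  set δ := min (-a) b / (K + 1) with hδ
  have hmin : 0 < min (-a) b := lt_min (by linarith) hb
  have hδ0 : 0 < δ := by positivity
  filter_upwards [Ioo_mem_nhdsGT hu, hTn, Ioo_mem_nhdsGT (show τ < τ + δ by linarith)] with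
    t₁ h1 h2 h3
  have ht₁ : t₁ ∈ Ioo 0 T := ⟨hτ.1.trans_lt h2.1, h2.2⟩
  by_contra hne
  have hgt : M k < r k 0 t₁ := (hR ▸ h.right_le k 0 ht₁).lt_of_ne (Ne.symm hne)
  obtain ⟨χ, hχ, hχ1, hv, hs⟩ := h.characteristic k 0 t₁ ht₁
  have hKt : K * (t₁ - τ) < min (-a) b := by
    have : t₁ - τ < δ := by linarith [h3.2]
    rw [hδ, lt_div_iff₀ (by linarith)] at this
    nlinarith [h1.1]
  have hKs : ∀ s ∈ Ioo 0 (t₁ - τ), K * s ≤ K * (t₁ - τ) := fun s hs =>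
    mul_le_mul_of_nonneg_left hs.2.le hK0
  have hderiv : ∀ s ∈ Ioo 0 (t₁ - τ), χ (t₁ - s) ∈ Icc a b →
      ∃ σ, |σ| ≤ K ∧ HasDerivAt (fun s => χ (t₁ - s)) σ s := fun s hs' hx => by
    have ht : t₁ - s ∈ Ioo 0 t₁ := ⟨by linarith [hs'.2, hτ.1], by linarith [hs'.1]⟩
    have hve := hv _ (Ioo_subset_Ioc_self ht)
    obtain ⟨σ, hσ, hd⟩ := hs (t₁ - s) ht fun l hl => by
      rw [← hve]
      exact hsub (show t₁ - s ∈ Ioo τ u from ⟨by linarith [hs'.2], by linarith [h1.2, hs'.1]⟩) l hl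
        _ hx (by rwa [hve])
    refine ⟨σ, hK _ _ ⟨ht.1, ht.2.trans ht₁.2⟩ _ σ hσ, ?_⟩
    have := hd.comp_const_sub t₁ s
    rwa [neg_neg] at this
  have hcont : ContinuousOn (fun s => χ (t₁ - s)) (Icc 0 (t₁ - τ)) :=
    hχ.comp (by fun_prop) fun s hs => ⟨by linarith [hs.2, hτ.1], by linarith [hs.1]⟩
  have hKc : ContinuousOn (fun s : ℝ => K * s) (Icc 0 (t₁ - τ)) := by fun_prop
  have hub : χ τ ≤ K * (t₁ - τ) := by
    have := nonpos_of_barrier (g := fun s => χ (t₁ - s) - K * s) (a := 0) (b := t₁ - τ)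
      (η := b - K * (t₁ - τ)) (by linarith [h1.1]) (by linarith [min_le_right (-a) b])
      (hcont.sub hKc) (by simp [hχ1]) fun s hs' hp hη => ?_
    · simp only [sub_sub_cancel] at this
      linarith
    · have hks := mul_nonneg hK0 hs'.1.le
      obtain ⟨σ, hσ, hd⟩ := hderiv s hs' ⟨by linarith, by linarith [hKs s hs']⟩
      refine ⟨_, ?_, hd.sub ((hasDerivAt_id s).const_mul K)⟩
      linarith [(abs_le.1 hσ).2]
  have hlb : -χ τ ≤ K * (t₁ - τ) := by
    have := nonpos_of_barrier (g := fun s => -χ (t₁ - s) - K * s) (a := 0) (b := t₁ - τ)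
      (η := -a - K * (t₁ - τ)) (by linarith [h1.1]) (by linarith [min_le_left (-a) b])
      (hcont.neg.sub hKc) (by simp [hχ1]) fun s hs' hp hη => ?_
    · simp only [sub_sub_cancel] at this
      linarith
    · have hks := mul_nonneg hK0 hs'.1.le
      obtain ⟨σ, hσ, hd⟩ := hderiv s hs' ⟨by linarith [hKs s hs'], by linarith⟩
      refine ⟨_, ?_, hd.neg.sub ((hasDerivAt_id s).const_mul K)⟩
      linarith [(abs_le.1 hσ).1]
  have haχ : a < χ τ := by linarith [min_le_left (-a) b]
  rcases hterm with ⟨rfl, hterm⟩ | ⟨hτ0, hterm⟩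
  · exact absurd (h.le_of_start ht₁ hχ hv haχ (h.mid k a hterm)) (not_le.2 hgt)
  · have e1 := h.nonincreasing k τ ⟨hτ0, hτ.2⟩ haχ.le
    simp only [hterm, hv τ ⟨hτ0, h1.1.le⟩] at e1
    linarith

/-- The middle state persists at `x = 0` as long as the left jump does not reach it. -/
theorem IsJumpSolution.eq_mid {T' : ℝ} (hX : 0 < X) (hT' : T' ≤ T)
    (hsymL : ∀ k, L k = -R k.rev) (hsymM : ∀ k, M k = -M k.rev)
    (htype : ∀ k, M k = R k ∨ L k = M k)
    (hnd : ∀ k, L k ≠ M k → ∀ l ≠ k, M l = M k → L l = M l)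
    (hcore : ∀ r, IsJumpSolution T X L M R r → ∀ τ ∈ Ioo 0 T', (∀ t ∈ Ioo 0 τ, ∀ k, r k 0 t = M k) →
      ∃ a < 0, ∀ t ∈ Ioo 0 τ, ∀ k, L k ≠ M k → r k a t = M k)
    (h : IsJumpSolution T X L M R r) : ∀ t ∈ Ioo 0 T', ∀ k, r k 0 t = M k := by
  have hsymR : ∀ k, R k = -L k.rev := fun k => by rw [hsymL, Fin.rev_rev, neg_neg]
  have hrefl : ∀ {r}, IsJumpSolution T X L M R r →
      IsJumpSolution T X L M R (fun k x t => -r k.rev (-x) t) := fun h => by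
    have := h.reflect
    rwa [show (fun k => -R (Fin.rev k)) = L from funext fun k => (hsymL k).symm,
      show (fun k => -M (Fin.rev k)) = M from funext fun k => (hsymM k).symm,
      show (fun k => -L (Fin.rev k)) = R from funext fun k => (hsymR k).symm] at this
  -- the state at the end of an interval
  have hend : ∀ r, IsJumpSolution T X L M R r → ∀ τ ∈ Ioo 0 T',
      (∀ t ∈ Ioo 0 τ, ∀ k, r k 0 t = M k) → ∃ a < 0, ∀ k, r k a τ = M k := by
    intro r h τ hτ hg
    obtain ⟨a, ha, hak⟩ := hcore r h τ hτ hg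
    have hτT : τ ∈ Ioo 0 T := ⟨hτ.1, hτ.2.trans_le hT'⟩
    refine ⟨a, ha, fun k => ?_⟩
    by_cases hk : L k = M k
    · have e1 := eq_of_eq_before hτ.1 (h.continuousAt_time k 0 hτT) fun t ht => hg t ht k
      have e2 := h.nonincreasing k τ hτT ha.le
      simp only [e1] at e2
      exact le_antisymm (hk ▸ h.le_left k a hτT) e2
    · exact eq_of_eq_before hτ.1 (h.continuousAt_time k a hτT) fun t ht => hak t ht k hk
  have hgood : ∀ (r : Fin n → ℝ → ℝ → ℝ) (t : ℝ), (∀ k, r k 0 t = M k) →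
      ∀ k : Fin n, -r k.rev (-0) t = M k :=
    fun r t h k => by rw [neg_zero, h, ← hsymM]
  have hstep : ∀ r, IsJumpSolution T X L M R r → ∀ τ ∈ Ico 0 T',
      (∀ t ∈ Ioo 0 τ, ∀ k, r k 0 t = M k) → ∀ k, L k ≠ M k → ∀ᶠ t in 𝓝[>] τ, r k 0 t = M k := by
    intro r h τ hτ hg k hk
    have hτT : τ ∈ Ico 0 T := ⟨hτ.1, hτ.2.trans_le hT'⟩
    have hR := (htype k).resolve_right hk
    rcases hτ.1.eq_or_lt with rfl | hτ0
    · have hmid : ∀ x ∈ Ioo (-X / 2) (X / 2), ∀ l,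
          Tendsto (fun t => r l x t) (𝓝[>] 0) (𝓝 (M l)) := fun x hx l =>
        (h.mid l x hx).comp (tendsto_const_nhds.prodMk tendsto_id)
      exact h.eventually_eq_mid hR (hnd k hk) hτT (a := -X / 4) (b := X / 4) (by linarith)
        (by linarith) (hmid _ ⟨by linarith, by linarith⟩) (hmid _ ⟨by linarith, by linarith⟩)
        (Or.inl ⟨rfl, by linarith, by linarith⟩)
    · obtain ⟨a, ha, hak⟩ := hend r h τ ⟨hτ0, hτ.2⟩ hg
      obtain ⟨b, hb, hbk⟩ := hend _ (hrefl h) τ ⟨hτ0, hτ.2⟩ fun t ht => hgood r t (hg t ht)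
      have hbk' : ∀ l, r l (-b) τ = M l := fun l => by
        have := hbk l.rev
        rw [Fin.rev_rev] at this
        rw [hsymM l]
        linarith
      have hcont : ∀ x l, r l x τ = M l → Tendsto (fun t => r l x t) (𝓝[>] τ) (𝓝 (M l)) :=
        fun x l hx => hx ▸ (h.continuousAt_time l x ⟨hτ0, hτT.2⟩).tendsto.mono_left
          nhdsWithin_le_nhds
      exact h.eventually_eq_mid hR (hnd k hk) hτT ha (by linarith : 0 < -b)
        (fun l => hcont a l (hak l)) (fun l => hcont (-b) l (hbk' l)) (Or.inr ⟨hτ0, hak k⟩)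
  by_contra hne
  push Not at hne
  set B : Set ℝ := {t | t ∈ Ioo 0 T' ∧ ∃ k, r k 0 t ≠ M k} with hB
  have hBn : B.Nonempty := by
    obtain ⟨t, ht, k, hk⟩ := hne
    exact ⟨t, ht, k, hk⟩
  have hBb : BddBelow B := ⟨0, fun t ht => ht.1.1.le⟩
  set τ := sInf B with hτ
  have hτ' : τ ∈ Ico 0 T' := by
    obtain ⟨t, ht⟩ := hBn
    exact ⟨le_csInf ⟨t, ht⟩ fun t ht => ht.1.1.le, (csInf_le hBb ht).trans_lt ht.1.2⟩
  have hg : ∀ t ∈ Ioo 0 τ, ∀ k, r k 0 t = M k := fun t ht => by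
    by_contra! hk
    exact absurd (csInf_le hBb (show t ∈ B from ⟨⟨ht.1, ht.2.trans hτ'.2⟩, hk⟩)) (not_le.2 ht.2)
  have hall : ∀ᶠ t in 𝓝[>] τ, ∀ k, r k 0 t = M k := by
    refine eventually_all.2 fun k => ?_
    by_cases hk : L k = M k
    · by_cases hk' : M k = R k
      · filter_upwards [Ioo_mem_nhdsGT (hτ'.2.trans_le hT')] with t ht
        have ht' : t ∈ Ioo 0 T := ⟨hτ'.1.trans_lt ht.1, ht.2⟩
        exact le_antisymm (hk ▸ h.le_left k 0 ht') (hk' ▸ h.right_le k 0 ht')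
      · have := hstep _ (hrefl h) τ hτ' (fun t ht => hgood r t (hg t ht)) k.rev (fun he => hk' (by
          rw [hsymL, hsymM k.rev, Fin.rev_rev] at he
          linarith))
        filter_upwards [this] with t ht
        rw [Fin.rev_rev, neg_zero] at ht
        rw [hsymM k]
        linarith
    · exact hstep r h τ hτ' hg k hk
  obtain ⟨u, hu, hsub⟩ := mem_nhdsGT_iff_exists_Ioo_subset.1 hall
  obtain ⟨t, ht, htu⟩ := exists_lt_of_csInf_lt hBn (show sInf B < u from hu)
  rcases (csInf_le hBb ht).eq_or_lt with he | hlt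
  · obtain ⟨k, hk⟩ := ht.2
    rw [← he] at hk
    have hτ0 : 0 < sInf B := he ▸ ht.1.1
    exact hk (eq_of_eq_before hτ0 (h.continuousAt_time k 0 ⟨hτ0, hτ'.2.trans_le hT'⟩)
      fun t ht => hg t ht k)
  · obtain ⟨k, hk⟩ := ht.2
    exact hk (hsub ⟨hlt, htu⟩ k)

/-- The left jump of a solution, as long as the middle state persists at `x = 0`. -/
lemma IsJumpSolution.isFan {T' : ℝ} (h : IsJumpSolution T X L M R r) (hX : 0 < X) (hT' : T' ≤ T)
    (hmid : ∀ t ∈ Ioo 0 T', ∀ k, r k 0 t = M k) {k : Fin n}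
    (hdis : ∀ l ≠ k, L l ≤ M k ∨ L k ≤ M l) :
    IsFan T' (-X / 2) (M k) (L k) (fun x t => branchPoints fun l => r l (min x 0) t)
      (fun x t => r k (min x 0) t) := by
  have hsub : ∀ {t}, t ∈ Ioo 0 T' → t ∈ Ioo 0 T := fun ht => ⟨ht.1, ht.2.trans_le hT'⟩
  have hmem : ∀ l, ∀ x ≤ 0, ∀ t ∈ Ioo 0 T', r l x t ∈ Icc (M l) (L l) := fun l x hx t ht =>
    ⟨hmid t ht l ▸ h.nonincreasing l t (hsub ht) hx, h.le_left l x (hsub ht)⟩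
  have hmin : ∀ x : ℝ, Tendsto (fun p : ℝ × ℝ => (min p.1 0, p.2)) (𝓝 x ×ˢ 𝓝[>] 0)
      (𝓝 (min x 0) ×ˢ 𝓝[>] 0) := fun x =>
    ((continuous_id.min continuous_const).tendsto x).prodMap tendsto_id
  refine ⟨fun x t ht => hmem k _ (min_le_right _ _) t ht, ?_, fun t ht x y hxy =>
    h.nonincreasing k t (hsub ht) (min_le_min_right 0 hxy), fun x hx => ?_, fun x hx => ?_,
    fun x₁ t₁ ht hf => ?_⟩
  · have h1 : Continuous fun p : ℝ × ℝ => (min p.1 0, p.2) := by fun_prop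
    exact (h.continuousOn k).comp h1.continuousOn fun p hp => ⟨mem_univ _, hsub hp.2⟩
  · have := (h.left k (min x 0) ((min_le_left _ _).trans_lt hx)).comp (hmin x)
    exact this
  · have := (h.mid k (min x 0) ⟨lt_min hx (by linarith), (min_le_right _ _).trans_lt
      (by linarith)⟩).comp (hmin x)
    exact this
  · have hneg : ∀ x, ∀ t ∈ Ioo 0 T', M k < r k x t → x < 0 := fun x t ht hx => by
      by_contra! hle
      have := h.nonincreasing k t (hsub ht) hle
      simp only [hmid t ht k] at this
      linarith
    have hx₁ : x₁ < 0 := by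
      by_contra! hle
      rw [min_eq_right hle, hmid t₁ ht k] at hf
      exact lt_irrefl _ hf.1
    rw [min_eq_left hx₁.le] at hf ⊢
    obtain ⟨χ, h1, h2, h3, h4⟩ := h.characteristic k x₁ t₁ (hsub ht)
    have hχ : ∀ t ∈ Ioc 0 t₁, χ t < 0 := fun t ht' =>
      hneg _ t ⟨ht'.1, ht'.2.trans_lt ht.2⟩ (by rw [h3 t ht']; exact hf.1)
    refine ⟨χ, h1, le_antisymm ?_ ?_, h2, fun t ht' => ?_, fun t ht' => ?_⟩
    · by_contra! hlt
      obtain ⟨x, hx, hx'⟩ := exists_between (lt_min hlt (show -X / 2 < X / 2 by linarith))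
      have := h.le_of_start (hsub ht) h1 h3 (hx'.trans_le (min_le_left _ _))
        (h.mid k x ⟨hx, hx'.trans_le (min_le_right _ _)⟩)
      linarith [hf.1]
    · by_contra! hlt
      obtain ⟨x, hx, hx'⟩ := exists_between hlt
      have := h.ge_of_start (hsub ht) h1 h3 hx (h.left k x hx')
      linarith [hf.2]
    · rw [min_eq_left (hχ t ht').le, h3 t ht']
    · have ht'' := Ioo_subset_Ioc_self ht'
      rw [min_eq_left (hχ t ht'').le]
      refine h4 t ht' fun l hl he => ?_
      have := hmem l _ (hχ t ht'').le t ⟨ht'.1, ht'.2.trans ht.2⟩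
      rw [he] at this
      rcases hdis l hl with h5 | h5
      · linarith [this.2, hf.1]
      · linarith [this.1, hf.2]

end NLSWhitham
end

noncomputable section

namespace NLSWhitham

/-- Step data with two jumps that are reflections of each other, such that the ranges of different
invariants do not overlap at the left jump. -/
structure IsSymmetricData {n : ℕ} (L M R : Fin (n + 1) → ℝ) : Prop where
  left_eq : ∀ k, L k = -R k.rev
  mid_eq : ∀ k, M k = -M k.rev
  mid_le : ∀ k, M k ≤ L k
  type : ∀ k, M k = R k ∨ L k = M k
  interlace : ∀ i : Fin n, L i.castSucc ≤ M i.succ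

section Symmetric

variable {n : ℕ} {T T' X : ℝ} {L M R : Fin (n + 1) → ℝ} {r : Fin (n + 1) → ℝ → ℝ → ℝ}

lemma IsSymmetricData.disjoint (hd : IsSymmetricData L M R) {k l : Fin (n + 1)} (hl : l ≠ k) :
    L l ≤ M k ∨ L k ≤ M l := by
  have hM : Monotone M := Fin.monotone_iff_le_succ.2 fun i =>
    (hd.mid_le i.castSucc).trans (hd.interlace i)
  have key : ∀ {i j : Fin (n + 1)}, i < j → L i ≤ M j := fun {i j} hij => by
    obtain ⟨i', rfl⟩ := Fin.exists_castSucc_eq.2 (hij.trans_le (Fin.le_last j)).ne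
    exact (hd.interlace i').trans (hM (Fin.castSucc_lt_iff_succ_le.1 hij))
  exact (lt_or_gt_of_ne hl).imp key key

lemma IsJumpSolution.symm (hd : IsSymmetricData L M R) (h : IsJumpSolution T X L M R r) :
    IsJumpSolution T X L M R (fun k x t => -r k.rev (-x) t) := by
  have := h.reflect
  rwa [show (fun k => -R (Fin.rev k)) = L from funext fun k => (hd.left_eq k).symm,
    show (fun k => -M (Fin.rev k)) = M from funext fun k => (hd.mid_eq k).symm,
    show (fun k => -L (Fin.rev k)) = R from
      funext fun k => by rw [hd.left_eq, Fin.rev_rev, neg_neg]] at this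

lemma IsJumpSolution.eq_const (h : IsJumpSolution T X L M R r) (hT' : T' ≤ T)
    (hmid : ∀ t ∈ Ioo 0 T', ∀ k, r k 0 t = M k) {k : Fin (n + 1)} (hk : L k = M k) (x : ℝ) {t : ℝ}
    (ht : t ∈ Ioo 0 T') : r k (min x 0) t = M k := by
  have ht' : t ∈ Ioo 0 T := ⟨ht.1, ht.2.trans_le hT'⟩
  refine le_antisymm (hk ▸ h.le_left k _ ht') ?_
  have := h.nonincreasing k t ht' (min_le_right x 0)
  simp only [hmid t ht k] at this
  exact this

lemma IsJumpSolution.eq_of_eq (h : IsJumpSolution T X L M R r) (hT' : T' ≤ T)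
    (hmid : ∀ t ∈ Ioo 0 T', ∀ k, r k 0 t = M k) {k : Fin (n + 1)} {v : ℝ} (hL : L k = v)
    (hM : M k = v) (x : ℝ) {t : ℝ} (ht : t ∈ Ioo 0 T') : r k (min x 0) t = v := by
  rw [← hM]
  exact h.eq_const hT' hmid (hL.trans hM.symm) x ht

lemma IsJumpSolution.isFan_of_eq (hd : IsSymmetricData L M R) (h : IsJumpSolution T X L M R r)
    (hX : 0 < X) (hT' : T' ≤ T) (hmid : ∀ t ∈ Ioo 0 T', ∀ k, r k 0 t = M k) {k : Fin (n + 1)}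
    {bot top : ℝ} (hM : M k = bot) (hL : L k = top) :
    IsFan T' (-X / 2) bot top (fun x t => branchPoints fun l => r l (min x 0) t)
      (fun x t => r k (min x 0) t) := by
  subst hM hL
  exact h.isFan hX hT' hmid fun l hl => hd.disjoint hl

/-- The local genus to the left of the symmetry axis determines the local genus. -/
lemma IsJumpSolution.genusRegion_eq (hd : IsSymmetricData L M R) {G : Set ℝ} {t : ℝ}
    (hG : ∀ r, IsJumpSolution T X L M R r → ∀ x ≤ 0,
      (x ∈ G → (branchPoints fun l => r l x t).card = 4) ∧
      (x ∉ G → (branchPoints fun l => r l x t).card = 2))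
    (hG0 : G ⊆ Iio 0) (h : IsJumpSolution T X L M R r) :
    genusRegion r 1 t = G ∪ {x | -x ∈ G} ∧ genusRegion r 0 t = (genusRegion r 1 t)ᶜ := by
  have key : ∀ x, (x ∈ G ∪ {x | -x ∈ G} → (branchPoints fun l => r l x t).card = 4) ∧
      (x ∉ G ∪ {x | -x ∈ G} → (branchPoints fun l => r l x t).card = 2) := by
    intro x
    rcases le_total x 0 with hx | hx
    · have h1 := hG r h x hx
      have h2 : -x ∉ G := fun hx' => by
        have := hG0 hx'
        simp only [mem_Iio] at this
        linarith
      simpa [h2] using h1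
    · have h1 := hG _ (h.symm hd) (-x) (by linarith)
      have h2 : x ∉ G := fun hx' => by
        have := hG0 hx'
        simp only [mem_Iio] at this
        linarith
      simp only [neg_neg, branchPoints_neg_rev fun l => r l x t,
        Finset.card_image_of_injective _ (sub_right_injective (b := (0 : ℝ)))] at h1
      simpa [h2] using h1
  have e1 : genusRegion r 1 t = G ∪ {x | -x ∈ G} := by
    ext x
    simp only [genusRegion, HasGenus, mem_ofPred_eq]
    by_cases hx : x ∈ G ∪ {x | -x ∈ G}
    · simp [(key x).1 hx, hx]
    · simp [(key x).2 hx, hx]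
  refine ⟨e1, ?_⟩
  rw [e1]
  ext x
  simp only [genusRegion, HasGenus, mem_ofPred_eq, mem_compl_iff]
  by_cases hx : x ∈ G ∪ {x | -x ∈ G}
  · simp [(key x).1 hx, hx]
  · simp [(key x).2 hx, hx]

end Symmetric

/-! ### The branch points at a jump -/

lemma card_oddSet_four {a b c d : ℝ} (hab : a < b) (hbc : b < c) (hcd : c < d) :
    (oddSet [a, b, c, d]).card = 4 := by
  have h : [a, b, c, d].Nodup := List.nodup_ofFn.2 (strictMono_four hab hbc hcd).injective
  rw [oddSet_of_nodup h, List.toFinset_card_of_nodup h]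
  rfl

lemma card_oddSet_two {a b : ℝ} (hab : a < b) : (oddSet [a, b]).card = 2 := by
  rw [oddSet_of_nodup (by simp [hab.ne]), List.toFinset_card_of_nodup (by simp [hab.ne])]
  rfl

lemma card_super {A κ D p q x e₁ e₂ m : ℝ} (hAκ : A < κ) (hκ : κ < (A + D) / 2)
    (hp : p ∈ Icc A κ) (hq : q ∈ Icc (A + D - κ) D) (h1 : q < D ↔ e₁ < x) (h2 : A < p ↔ x < e₂)
    (h3 : A + D - κ < q → x < m) (h4 : p < κ → m < x) :
    (x ∈ Ioo e₁ e₂ → (oddSet [A, p, q, D]).card = 4) ∧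
    (x ∉ Ioo e₁ e₂ → (oddSet [A, p, q, D]).card = 2) := by
  constructor
  · rintro ⟨hx1, hx2⟩
    exact card_oddSet_four (h2.2 hx2) (by linarith [hp.2, hq.1]) (h1.2 hx1)
  · intro hx
    rcases not_and_or.1 hx with hx | hx
    · have e : q = D := le_antisymm hq.2 (not_lt.1 fun h => hx (h1.1 h))
      have e' : p = κ := le_antisymm hp.2 (not_lt.1 fun h => by
        have := h3 (by linarith)
        linarith [h4 h])
      rw [e, e', show oddSet [A, κ, D, D] = oddSet [A, κ] from oddSet_append_cancel [A, κ] D []]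
      exact card_oddSet_two hAκ
    · have e : p = A := le_antisymm (not_lt.1 fun h => hx (h2.1 h)) hp.1
      have e' : q = A + D - κ := le_antisymm (not_lt.1 fun h => by
        have := h4 (by linarith)
        linarith [h3 h]) hq.1
      rw [e, e', oddSet_cons_cons]
      exact card_oddSet_two (by linarith)

lemma card_sub {A κ c D p f h x e₁ e₂ e₃ e₄ : ℝ} (hAκ : A < κ) (hκ : (A + D) / 2 < κ)
    (hκc : κ ≤ c) (hcD : c < D) (hp : p ∈ Icc A (A + D - κ)) (hf : f ∈ Icc κ c) (hh : h ∈ Icc c D)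
    (h1 : h < D ↔ e₁ < x) (h2 : κ < f ∨ c < h ↔ x < e₂) (h3 : c < h → f = c)
    (h4 : p < A + D - κ ↔ e₃ < x) (h5 : A < p ↔ x < e₄) (he : e₂ ≤ e₃) :
    (x ∈ Ioo e₁ e₂ ∪ Ioo e₃ e₄ → (oddSet [A, p, A + D - κ, κ, f, c, h, D]).card = 4) ∧
    (x ∉ Ioo e₁ e₂ ∪ Ioo e₃ e₄ → (oddSet [A, p, A + D - κ, κ, f, c, h, D]).card = 2) := by
  have hmidd : e₂ ≤ x → f = κ ∧ h = c := fun hx => by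
    have := mt h2.1 hx.not_gt
    push Not at this
    exact ⟨le_antisymm this.1 hf.1, le_antisymm this.2 hh.1⟩
  rcases le_or_gt x e₃ with hx3 | hx3
  · have ep : p = A + D - κ := le_antisymm hp.2 (not_lt.1 fun h => hx3.not_gt (h4.1 h))
    have eB : oddSet [A, p, A + D - κ, κ, f, c, h, D] = oddSet [A, κ, f, c, h, D] := by
      rw [ep]
      exact oddSet_append_cancel [A] (A + D - κ) [κ, f, c, h, D]
    rw [eB]
    have hnot : x ∉ Ioo e₃ e₄ := fun hx => hx3.not_gt hx.1
    simp only [mem_union, hnot, or_false]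
    constructor
    · rintro ⟨hx1, hx2⟩
      rcases hh.1.eq_or_lt with hc | hc
      · have hκf : κ < f := (h2.2 hx2).resolve_right (by rw [hc]; exact lt_irrefl _)
        rw [← hc, show oddSet [A, κ, f, c, c, D] = oddSet [A, κ, f, D] from
          oddSet_append_cancel [A, κ, f] c [D]]
        exact card_oddSet_four hAκ hκf (hf.2.trans_lt hcD)
      · rw [h3 hc, show oddSet [A, κ, c, c, h, D] = oddSet [A, κ, h, D] from
          oddSet_append_cancel [A, κ] c [h, D]]
        exact card_oddSet_four hAκ (hκc.trans_lt hc) (h1.2 hx1)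
    · intro hx
      rcases not_and_or.1 hx with hx | hx
      · have e : h = D := le_antisymm hh.2 (not_lt.1 fun h => hx (h1.1 h))
        rw [h3 (e ▸ hcD), e, show oddSet [A, κ, c, c, D, D] = oddSet [A, κ, D, D] from
          oddSet_append_cancel [A, κ] c [D, D], show oddSet [A, κ, D, D] = oddSet [A, κ] from
          oddSet_append_cancel [A, κ] D []]
        exact card_oddSet_two hAκ
      · obtain ⟨e, e'⟩ := hmidd (not_lt.1 hx)
        rw [e, e', show oddSet [A, κ, κ, c, c, D] = oddSet [A, c, c, D] from
          oddSet_append_cancel [A] κ [c, c, D], show oddSet [A, c, c, D] = oddSet [A, D] from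
          oddSet_append_cancel [A] c [D]]
        exact card_oddSet_two (by linarith)
  · obtain ⟨e, e'⟩ := hmidd (he.trans hx3.le)
    have eB : oddSet [A, p, A + D - κ, κ, f, c, h, D] = oddSet [A, p, A + D - κ, D] := by
      rw [e, e']
      exact (oddSet_append_cancel [A, p, A + D - κ] κ [c, c, D]).trans
        (oddSet_append_cancel [A, p, A + D - κ] c [D])
    rw [eB]
    have hnot : x ∉ Ioo e₁ e₂ := fun hx => (he.trans hx3.le).not_gt hx.2
    simp only [mem_union, hnot, false_or]
    constructor
    · rintro ⟨hx1, hx2⟩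
      exact card_oddSet_four (h5.2 hx2) (h4.2 hx1) (by linarith)
    · intro hx
      have hx' : ¬ x < e₄ := fun h => hx ⟨hx3, h⟩
      have ep : p = A := le_antisymm (not_lt.1 fun h => hx' (h5.1 h)) hp.1
      rw [ep, oddSet_cons_cons]
      exact card_oddSet_two (by linarith)

/-! ### Boundaries of unions of intervals -/

lemma boundary_two {a b c d : ℝ} (hab : a < b) (hbc : b < c) (hcd : c < d) :
    closure (Ioo a b ∪ Ioo c d)ᶜ ∩ closure (Ioo a b ∪ Ioo c d) = {a, b, c, d} := by
  rw [(isOpen_Ioo.union isOpen_Ioo).isClosed_compl.closure_eq, closure_union,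
    closure_Ioo hab.ne, closure_Ioo hcd.ne]
  ext x
  simp only [mem_inter_iff, mem_compl_iff, mem_union, mem_Ioo, mem_Icc, mem_insert_iff,
    mem_singleton_iff]
  grind

lemma boundary_four {a b c d e f g h : ℝ} (hab : a < b) (hbc : b < c) (hcd : c < d) (hde : d < e)
    (hef : e < f) (hfg : f < g) (hgh : g < h) :
    closure (Ioo a b ∪ Ioo c d ∪ (Ioo e f ∪ Ioo g h))ᶜ ∩
      closure (Ioo a b ∪ Ioo c d ∪ (Ioo e f ∪ Ioo g h)) = {a, b, c, d, e, f, g, h} := by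
  rw [((isOpen_Ioo.union isOpen_Ioo).union
    (isOpen_Ioo.union isOpen_Ioo)).isClosed_compl.closure_eq, closure_union, closure_union,
    closure_union, closure_Ioo hab.ne, closure_Ioo hcd.ne, closure_Ioo hef.ne, closure_Ioo hgh.ne]
  ext x
  simp only [mem_inter_iff, mem_compl_iff, mem_union, mem_Ioo, mem_Icc, mem_insert_iff,
    mem_singleton_iff]
  constructor
  · rintro ⟨h1, h2⟩
    grind
  · rintro (rfl | rfl | rfl | rfl | rfl | rfl | rfl | rfl) <;> constructor <;> grind

end NLSWhitham
end

noncomputable section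

namespace NLSWhitham

/-! ### Two supercritical jumps -/

def superLeft (q₀ u₀ : ℝ) : Fin 6 → ℝ :=
  ![-2*u₀ - 2*q₀, -2*u₀ + 2*q₀,  2*q₀,  2*q₀, 2*u₀ + 2*q₀, 2*u₀ + 2*q₀]

def superMid (q₀ u₀ : ℝ) : Fin 6 → ℝ :=
  ![-2*u₀ - 2*q₀, -2*u₀ - 2*q₀, -2*q₀,  2*q₀, 2*u₀ + 2*q₀, 2*u₀ + 2*q₀]

def superRight (q₀ u₀ : ℝ) : Fin 6 → ℝ :=
  ![-2*u₀ - 2*q₀, -2*u₀ - 2*q₀, -2*q₀, -2*q₀, 2*u₀ - 2*q₀, 2*u₀ + 2*q₀]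

variable {q₀ u₀ X T T' : ℝ}

lemma isSymmetricData_super (hq : 0 < q₀) (hu : 2 * q₀ < u₀) :
    IsSymmetricData (superLeft q₀ u₀) (superMid q₀ u₀) (superRight q₀ u₀) where
  left_eq k := by fin_cases k <;> simp [superLeft, superRight, Fin.rev] <;> ring
  mid_eq k := by fin_cases k <;> simp [superMid, Fin.rev] <;> ring
  mid_le k := by fin_cases k <;> simp [superMid, superLeft] <;> linarith
  type k := by fin_cases k <;> simp [superMid, superLeft, superRight]
  interlace i := by fin_cases i <;> simp [superMid, superLeft] <;> linarith

lemma harmonic_speed (hq : 0 < q₀) (hu : 0 < u₀) :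
    2 * q₀ - ((-2*u₀ + 2*q₀ - (-2*u₀ - 2*q₀)) / 2) ^ 2 /
      (2 * (2 * q₀ - (-2*u₀ - 2*q₀ + (-2*u₀ + 2*q₀)) / 2)) = sOuter q₀ u₀ - u₀ := by
  have h : u₀ + q₀ ≠ 0 := by positivity
  have e : 2 * (2 * q₀ - (-2*u₀ - 2*q₀ + (-2*u₀ + 2*q₀)) / 2) = 4 * (u₀ + q₀) := by ring
  rw [e, sOuter]
  field_simp
  ring

lemma soliton_speed :
    (-2*u₀ - 2*q₀ + 2 * (-2*u₀ + 2*q₀) + 2 * q₀) / 4 = sInner q₀ u₀ - u₀ := by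
  rw [sInner]; ring

lemma sOuter_gt (hq : 0 < q₀) (hu : 0 < u₀) : u₀ + q₀ < sOuter q₀ u₀ := by
  have h : 0 < u₀ + q₀ := by positivity
  have : 0 < u₀ * q₀ / (u₀ + q₀) ^ 2 := by positivity
  rw [sOuter]
  nlinarith

lemma lt_interactionTime (hq : 0 < q₀) (hu : 0 < u₀) {t : ℝ}
    (ht : t < interactionTime q₀ u₀ X) : (sOuter q₀ u₀ + u₀) * t < X / 2 := by
  have := sOuter_gt hq hu
  rw [interactionTime, lt_div_iff₀ (by linarith)] at ht
  linarith

section Super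

variable {r : Fin 6 → ℝ → ℝ → ℝ}

lemma super_left (hq : 0 < q₀) (hu : 2 * q₀ < u₀) (hX : 0 < X) (hT' : T' ≤ T)
    (h : IsJumpSolution T X (superLeft q₀ u₀) (superMid q₀ u₀) (superRight q₀ u₀) r)
    (hmid : ∀ t ∈ Ioo 0 T', ∀ k, r k 0 t = superMid q₀ u₀ k) {t : ℝ} (ht : t ∈ Ioo 0 T') (x : ℝ) :
    r 1 (min x 0) t ∈ Icc (-2*u₀ - 2*q₀) (-2*u₀ + 2*q₀) ∧
    r 2 (min x 0) t ∈ Icc (-2*u₀ - 2*q₀ + 2*q₀ - (-2*u₀ + 2*q₀)) (2*q₀) ∧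
    (branchPoints fun l => r l (min x 0) t) =
      oddSet [-2*u₀ - 2*q₀, r 1 (min x 0) t, r 2 (min x 0) t, 2*q₀] ∧
    (r 2 (min x 0) t < 2 * q₀ ↔ leftLine u₀ X (-sOuter q₀ u₀) t < x) ∧
    (-2*u₀ - 2*q₀ < r 1 (min x 0) t ↔ x < leftLine u₀ X (sOuter q₀ u₀) t) ∧
    (-2*u₀ - 2*q₀ + 2*q₀ - (-2*u₀ + 2*q₀) < r 2 (min x 0) t → x < leftLine u₀ X 0 t) ∧
    (r 1 (min x 0) t < -2*u₀ + 2*q₀ → leftLine u₀ X 0 t < x) := by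
  have hd := isSymmetricData_super hq hu
  have hp := h.isFan_of_eq hd hX hT' hmid (k := 1) (bot := -2*u₀ - 2*q₀) (top := -2*u₀ + 2*q₀)
    (by simp [superMid]) (by simp [superLeft])
  have hf := h.isFan_of_eq hd hX hT' hmid (k := 2) (bot := -2*q₀) (top := 2*q₀)
    (by simp [superMid]) (by simp [superLeft])
  have hc : ∀ x, ∀ t ∈ Ioo 0 T', (branchPoints fun l => r l (min x 0) t) =
      oddSet [-2*u₀ - 2*q₀, r 1 (min x 0) t, r 2 (min x 0) t, 2*q₀] := fun x t ht => by
    have e0 : r 0 (min x 0) t = -2*u₀ - 2*q₀ := h.eq_of_eq hT' hmid (k := 0)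
      (by simp [superLeft]) (by simp [superMid]) x ht
    have e3 : r 3 (min x 0) t = 2*q₀ := h.eq_of_eq hT' hmid (k := 3)
      (by simp [superLeft]) (by simp [superMid]) x ht
    have e4 : r 4 (min x 0) t = 2*u₀ + 2*q₀ := h.eq_of_eq hT' hmid (k := 4)
      (by simp [superLeft]) (by simp [superMid]) x ht
    have e5 : r 5 (min x 0) t = 2*u₀ + 2*q₀ := h.eq_of_eq hT' hmid (k := 5)
      (by simp [superLeft]) (by simp [superMid]) x ht
    rw [branchPoints_eq_oddSet]
    change oddSet [r 0 (min x 0) t, r 1 (min x 0) t, r 2 (min x 0) t, r 3 (min x 0) t,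
      r 4 (min x 0) t, r 5 (min x 0) t] = _
    rw [e0, e3, e4, e5]
    exact oddSet_append_cancel [_, _, _, _] _ []
  have eb : -2*u₀ - 2*q₀ + 2*q₀ - (-2*u₀ + 2*q₀) = -2*q₀ := by ring
  have hf' : IsFan T' (-X / 2) (-2*u₀ - 2*q₀ + 2*q₀ - (-2*u₀ + 2*q₀)) (2*q₀)
      (fun x t => branchPoints fun l => r l (min x 0) t) (fun x t => r 2 (min x 0) t) := by
    rw [eb]; exact hf
  have key := super_jump (A := -2*u₀ - 2*q₀) (κ := -2*u₀ + 2*q₀) (D := 2*q₀) (by linarith)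
    (by linarith) hp hf' hc ht x
  rw [harmonic_speed hq (by linarith)] at key
  refine ⟨hp.mem x t ht, hf'.mem x t ht, hc x t ht, ?_⟩
  convert key using 4 <;> rw [leftLine] <;> ring_nf

lemma super_eq_mid (hq : 0 < q₀) (hu : 2 * q₀ < u₀) (hX : 0 < X)
    (h : IsJumpSolution T X (superLeft q₀ u₀) (superMid q₀ u₀) (superRight q₀ u₀) r) :
    ∀ t ∈ Ioo 0 (min T (interactionTime q₀ u₀ X)), ∀ k, r k 0 t = superMid q₀ u₀ k := by
  have hd := isSymmetricData_super hq hu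
  have hu0 : 0 < u₀ := by linarith
  refine IsJumpSolution.eq_mid hX (min_le_left _ _) hd.left_eq hd.mid_eq hd.type
    (fun k hk l hl he => ?_) (fun r h τ hτ hmid => ?_) h
  · rcases hd.disjoint hl with h1 | h1
    · exact le_antisymm (he ▸ h1) (hd.mid_le l)
    · exact absurd (le_antisymm (he ▸ h1) (hd.mid_le k)) hk
  · have hS := sOuter_gt hq hu0
    have hτX := lt_interactionTime hq hu0 (hτ.2.trans_le (min_le_right _ _))
    obtain ⟨a, ha1, ha2⟩ := exists_between (show leftLine u₀ X (sOuter q₀ u₀) τ < 0 by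
      rw [leftLine]; linarith)
    refine ⟨a, ha2, fun t ht k hk => ?_⟩
    obtain ⟨h1, h2, -, h4, h5, h6, h7⟩ :=
      super_left hq hu hX (hτ.2.le.trans (min_le_left _ _)) h hmid ht a
    rw [min_eq_left ha2.le] at *
    have hlt : ¬ a < leftLine u₀ X (sOuter q₀ u₀) t := fun hlt => by
      rw [leftLine] at hlt ha1
      nlinarith [ht.2]
    have e1 : r 1 a t = -2*u₀ - 2*q₀ := le_antisymm (not_lt.1 fun h => hlt (h5.1 h)) h1.1
    have e2 : r 2 a t = -2*q₀ := by
      have := h7 (by linarith)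
      have := not_lt.1 fun h => (h6 h).not_gt this
      linarith [h2.1]
    fin_cases k
    · simp [superLeft, superMid] at hk
    · simpa [superMid] using e1
    · simpa [superMid] using e2
    all_goals simp [superLeft, superMid] at hk

theorem super_regions (hq : 0 < q₀) (hu : 2 * q₀ < u₀) (hX : 0 < X)
    (h : IsWhithamSolution T (superData q₀ u₀ X) r) {t : ℝ} (ht0 : 0 < t) (htT : t < T)
    (htI : t < interactionTime q₀ u₀ X) :
    genusBoundary r t = {leftLine u₀ X (-sOuter q₀ u₀) t, leftLine u₀ X (sOuter q₀ u₀) t,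
      rightLine u₀ X (-sOuter q₀ u₀) t, rightLine u₀ X (sOuter q₀ u₀) t} ∧
    genusRegion r 1 t =
      Ioo (leftLine u₀ X (-sOuter q₀ u₀) t) (leftLine u₀ X (sOuter q₀ u₀) t) ∪
      Ioo (rightLine u₀ X (-sOuter q₀ u₀) t) (rightLine u₀ X (sOuter q₀ u₀) t) ∧
    genusRegion r 0 t = (genusRegion r 1 t)ᶜ := by
  have hd := isSymmetricData_super hq hu
  have hu0 : 0 < u₀ := by linarith
  have hj : IsJumpSolution T X (superLeft q₀ u₀) (superMid q₀ u₀) (superRight q₀ u₀) r :=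
    IsWhithamSolution.isJumpSolution hX h
  have hS := sOuter_gt hq hu0
  have htX := lt_interactionTime hq hu0 htI
  have ht : t ∈ Ioo 0 (min T (interactionTime q₀ u₀ X)) := ⟨ht0, lt_min htT htI⟩
  obtain ⟨h1, h0⟩ := hj.genusRegion_eq (t := t) hd
    (G := Ioo (leftLine u₀ X (-sOuter q₀ u₀) t) (leftLine u₀ X (sOuter q₀ u₀) t))
    (fun r h x hx => by
      obtain ⟨h1, h2, h3, h4, h5, h6, h7⟩ :=
        super_left hq hu hX (min_le_left _ _) h (super_eq_mid hq hu hX h) ht x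
      rw [min_eq_left hx] at *
      rw [h3]
      exact card_super (by linarith) (by linarith) h1 h2 h4 h5 h6 h7)
    (fun x hx => by
      have := hx.2
      rw [leftLine] at this
      change x < 0
      linarith)
  have e : {x | -x ∈ Ioo (leftLine u₀ X (-sOuter q₀ u₀) t) (leftLine u₀ X (sOuter q₀ u₀) t)} =
      Ioo (rightLine u₀ X (-sOuter q₀ u₀) t) (rightLine u₀ X (sOuter q₀ u₀) t) := by
    ext x
    simp only [mem_ofPred_eq, mem_Ioo, leftLine, rightLine]
    constructor <;> rintro ⟨h1, h2⟩ <;> constructor <;> linarith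
  rw [e] at h1
  refine ⟨?_, h1, h0⟩
  rw [genusBoundary, h0, h1]
  have := mul_pos ht0 (show 0 < sOuter q₀ u₀ by linarith)
  exact boundary_two (by rw [leftLine, leftLine]; linarith)
    (by rw [leftLine, rightLine]; linarith) (by rw [rightLine, rightLine]; linarith)

end Super

end NLSWhitham
end

noncomputable section

namespace NLSWhitham

/-! ### Two subcritical jumps -/

def interLeft (q₀ u₀ : ℝ) : Fin 10 → ℝ :=
  ![-2*u₀ - 2*q₀,        -2*q₀, -2*q₀, -2*u₀ + 2*q₀,  2*u₀ - 2*q₀,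
     2*u₀ - 2*q₀,         2*q₀,  2*q₀,  2*u₀ + 2*q₀,  2*u₀ + 2*q₀]

def interMid (q₀ u₀ : ℝ) : Fin 10 → ℝ :=
  ![-2*u₀ - 2*q₀, -2*u₀ - 2*q₀, -2*q₀, -2*u₀ + 2*q₀, -2*u₀ + 2*q₀,
     2*u₀ - 2*q₀,  2*u₀ - 2*q₀,  2*q₀,  2*u₀ + 2*q₀,  2*u₀ + 2*q₀]

def interRight (q₀ u₀ : ℝ) : Fin 10 → ℝ :=
  ![-2*u₀ - 2*q₀, -2*u₀ - 2*q₀, -2*q₀,        -2*q₀, -2*u₀ + 2*q₀,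
    -2*u₀ + 2*q₀,  2*u₀ - 2*q₀,  2*q₀,         2*q₀,  2*u₀ + 2*q₀]

def subLeft (q₀ u₀ : ℝ) : Fin 10 → ℝ :=
  ![-2*u₀ - 2*q₀,        -2*q₀, -2*q₀,  2*u₀ - 2*q₀,  2*u₀ - 2*q₀,
    -2*u₀ + 2*q₀,         2*q₀,  2*q₀,  2*u₀ + 2*q₀,  2*u₀ + 2*q₀]

def subMid (q₀ u₀ : ℝ) : Fin 10 → ℝ :=
  ![-2*u₀ - 2*q₀, -2*u₀ - 2*q₀, -2*q₀,  2*u₀ - 2*q₀,  2*u₀ - 2*q₀,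
    -2*u₀ + 2*q₀, -2*u₀ + 2*q₀,  2*q₀,  2*u₀ + 2*q₀,  2*u₀ + 2*q₀]

def subRight (q₀ u₀ : ℝ) : Fin 10 → ℝ :=
  ![-2*u₀ - 2*q₀, -2*u₀ - 2*q₀, -2*q₀,        -2*q₀,  2*u₀ - 2*q₀,
    -2*u₀ + 2*q₀, -2*u₀ + 2*q₀,  2*q₀,         2*q₀,  2*u₀ + 2*q₀]

variable {q₀ u₀ X T T' : ℝ}

lemma isSymmetricData_inter (hu : q₀ < u₀) (hu' : u₀ < 2 * q₀) :
    IsSymmetricData (interLeft q₀ u₀) (interMid q₀ u₀) (interRight q₀ u₀) where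
  left_eq k := by fin_cases k <;> simp [interLeft, interRight, Fin.rev] <;> ring
  mid_eq k := by fin_cases k <;> simp [interMid, Fin.rev] <;> ring
  mid_le k := by fin_cases k <;> simp [interMid, interLeft] <;> linarith
  type k := by fin_cases k <;> simp [interMid, interLeft, interRight]
  interlace i := by fin_cases i <;> simp [interMid, interLeft] <;> linarith

lemma isSymmetricData_sub (hu : 0 < u₀) (hu' : u₀ ≤ q₀) :
    IsSymmetricData (subLeft q₀ u₀) (subMid q₀ u₀) (subRight q₀ u₀) where
  left_eq k := by fin_cases k <;> simp [subLeft, subRight, Fin.rev] <;> ring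
  mid_eq k := by fin_cases k <;> simp [subMid, Fin.rev] <;> ring
  mid_le k := by fin_cases k <;> simp [subMid, subLeft] <;> linarith
  type k := by fin_cases k <;> simp [subMid, subLeft, subRight]
  interlace i := by fin_cases i <;> simp [subMid, subLeft] <;> linarith

/-- The left jump consists of the fans of `r 1`, `f` and `h`. -/
structure IsSubFans (q₀ u₀ X T' : ℝ) (L M : Fin 10 → ℝ) (r : Fin 10 → ℝ → ℝ → ℝ) (c : ℝ)
    (f h : ℝ → ℝ → ℝ) : Prop where
  le : -2*u₀ + 2*q₀ ≤ c
  lt : c < 2*q₀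
  fan₁ : IsFan T' (-X / 2) (-2*u₀ - 2*q₀) (-2*u₀ - 2*q₀ + 2*q₀ - (-2*u₀ + 2*q₀))
    (fun x t => branchPoints fun l => r l (min x 0) t) fun x t => r 1 (min x 0) t
  fan₂ : IsFan T' (-X / 2) (-2*u₀ + 2*q₀) c
    (fun x t => branchPoints fun l => r l (min x 0) t) f
  fan₃ : IsFan T' (-X / 2) c (2*q₀) (fun x t => branchPoints fun l => r l (min x 0) t) h
  cfg : ∀ x, ∀ t ∈ Ioo 0 T', (branchPoints fun l => r l (min x 0) t) =
    oddSet [-2*u₀ - 2*q₀, r 1 (min x 0) t, -2*u₀ - 2*q₀ + 2*q₀ - (-2*u₀ + 2*q₀), -2*u₀ + 2*q₀,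
      f x t, c, h x t, 2*q₀]
  eq_mid : ∀ x, ∀ t ∈ Ioo 0 T', r 1 (min x 0) t = -2*u₀ - 2*q₀ → f x t = -2*u₀ + 2*q₀ →
    h x t = c → ∀ k, L k ≠ M k → r k (min x 0) t = M k

lemma IsFan.const (T' x₀ v : ℝ) (cfg : ℝ → ℝ → Finset ℝ) :
    IsFan T' x₀ v v cfg fun _ _ => v where
  mem _ _ _ := ⟨le_rfl, le_rfl⟩
  continuousOn := continuousOn_const
  anti _ _ := antitone_const
  left _ _ := tendsto_const_nhds
  right _ _ := tendsto_const_nhds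
  char _ _ _ hf := absurd hf.1 (lt_irrefl _)

section Sub

variable {r : Fin 10 → ℝ → ℝ → ℝ}

lemma isSubFans_inter (hu : q₀ < u₀) (hu' : u₀ < 2 * q₀) (hX : 0 < X) (hT' : T' ≤ T)
    (h : IsJumpSolution T X (interLeft q₀ u₀) (interMid q₀ u₀) (interRight q₀ u₀) r)
    (hmid : ∀ t ∈ Ioo 0 T', ∀ k, r k 0 t = interMid q₀ u₀ k) :
    ∃ c f h, IsSubFans q₀ u₀ X T' (interLeft q₀ u₀) (interMid q₀ u₀) r c f h := by
  have hd := isSymmetricData_inter hu hu'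
  have eb : -2*u₀ - 2*q₀ + 2*q₀ - (-2*u₀ + 2*q₀) = -2*q₀ := by ring
  refine ⟨2*u₀ - 2*q₀, fun x t => r 4 (min x 0) t, fun x t => r 6 (min x 0) t,
    ⟨by linarith, by linarith, ?_, h.isFan_of_eq hd hX hT' hmid (k := 4)
      (by simp [interMid]) (by simp [interLeft]),
      h.isFan_of_eq hd hX hT' hmid (k := 6)
      (by simp [interMid]) (by simp [interLeft]), fun x t ht => ?_, ?_⟩⟩
  · rw [eb]
    exact h.isFan_of_eq hd hX hT' hmid (k := 1)
      (by simp [interMid]) (by simp [interLeft])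
  · have e0 : r 0 (min x 0) t = -2*u₀ - 2*q₀ := h.eq_of_eq hT' hmid (k := 0)
      (by simp [interLeft]) (by simp [interMid]) x ht
    have e2 : r 2 (min x 0) t = -2*q₀ := h.eq_of_eq hT' hmid (k := 2)
      (by simp [interLeft]) (by simp [interMid]) x ht
    have e3 : r 3 (min x 0) t = -2*u₀ + 2*q₀ := h.eq_of_eq hT' hmid (k := 3)
      (by simp [interLeft]) (by simp [interMid]) x ht
    have e5 : r 5 (min x 0) t = 2*u₀ - 2*q₀ := h.eq_of_eq hT' hmid (k := 5)
      (by simp [interLeft]) (by simp [interMid]) x ht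
    have e7 : r 7 (min x 0) t = 2*q₀ := h.eq_of_eq hT' hmid (k := 7)
      (by simp [interLeft]) (by simp [interMid]) x ht
    have e8 : r 8 (min x 0) t = 2*u₀ + 2*q₀ := h.eq_of_eq hT' hmid (k := 8)
      (by simp [interLeft]) (by simp [interMid]) x ht
    have e9 : r 9 (min x 0) t = 2*u₀ + 2*q₀ := h.eq_of_eq hT' hmid (k := 9)
      (by simp [interLeft]) (by simp [interMid]) x ht
    rw [branchPoints_eq_oddSet, eb]
    change oddSet [r 0 (min x 0) t, r 1 (min x 0) t, r 2 (min x 0) t, r 3 (min x 0) t,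
      r 4 (min x 0) t, r 5 (min x 0) t, r 6 (min x 0) t, r 7 (min x 0) t, r 8 (min x 0) t,
      r 9 (min x 0) t] = _
    rw [e0, e2, e3, e5, e7, e8, e9]
    exact oddSet_append_cancel [_, _, _, _, _, _, _, _] _ []
  · intro x t ht h1 h2 h3 k hk
    fin_cases k
    all_goals first
      | (simp [interLeft, interMid] at hk; done)
      | simpa [interMid] using h1
      | simpa [interMid] using h2
      | simpa [interMid] using h3

lemma isSubFans_sub (hu : 0 < u₀) (hu' : u₀ ≤ q₀) (hX : 0 < X) (hT' : T' ≤ T)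
    (h : IsJumpSolution T X (subLeft q₀ u₀) (subMid q₀ u₀) (subRight q₀ u₀) r)
    (hmid : ∀ t ∈ Ioo 0 T', ∀ k, r k 0 t = subMid q₀ u₀ k) :
    ∃ c f h, IsSubFans q₀ u₀ X T' (subLeft q₀ u₀) (subMid q₀ u₀) r c f h := by
  have hd := isSymmetricData_sub hu hu'
  have eb : -2*u₀ - 2*q₀ + 2*q₀ - (-2*u₀ + 2*q₀) = -2*q₀ := by ring
  refine ⟨-2*u₀ + 2*q₀, fun _ _ => -2*u₀ + 2*q₀, fun x t => r 6 (min x 0) t,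
    ⟨le_rfl, by linarith, ?_, IsFan.const _ _ _ _,
      h.isFan_of_eq hd hX hT' hmid (k := 6)
      (by simp [subMid]) (by simp [subLeft]), fun x t ht => ?_, ?_⟩⟩
  · rw [eb]
    exact h.isFan_of_eq hd hX hT' hmid (k := 1)
      (by simp [subMid]) (by simp [subLeft])
  · have e0 : r 0 (min x 0) t = -2*u₀ - 2*q₀ := h.eq_of_eq hT' hmid (k := 0)
      (by simp [subLeft]) (by simp [subMid]) x ht
    have e2 : r 2 (min x 0) t = -2*q₀ := h.eq_of_eq hT' hmid (k := 2)
      (by simp [subLeft]) (by simp [subMid]) x ht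
    have e3 : r 3 (min x 0) t = 2*u₀ - 2*q₀ := h.eq_of_eq hT' hmid (k := 3)
      (by simp [subLeft]) (by simp [subMid]) x ht
    have e4 : r 4 (min x 0) t = 2*u₀ - 2*q₀ := h.eq_of_eq hT' hmid (k := 4)
      (by simp [subLeft]) (by simp [subMid]) x ht
    have e5 : r 5 (min x 0) t = -2*u₀ + 2*q₀ := h.eq_of_eq hT' hmid (k := 5)
      (by simp [subLeft]) (by simp [subMid]) x ht
    have e7 : r 7 (min x 0) t = 2*q₀ := h.eq_of_eq hT' hmid (k := 7)
      (by simp [subLeft]) (by simp [subMid]) x ht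
    have e8 : r 8 (min x 0) t = 2*u₀ + 2*q₀ := h.eq_of_eq hT' hmid (k := 8)
      (by simp [subLeft]) (by simp [subMid]) x ht
    have e9 : r 9 (min x 0) t = 2*u₀ + 2*q₀ := h.eq_of_eq hT' hmid (k := 9)
      (by simp [subLeft]) (by simp [subMid]) x ht
    rw [branchPoints_eq_oddSet, eb]
    change oddSet [r 0 (min x 0) t, r 1 (min x 0) t, r 2 (min x 0) t, r 3 (min x 0) t,
      r 4 (min x 0) t, r 5 (min x 0) t, r 6 (min x 0) t, r 7 (min x 0) t, r 8 (min x 0) t,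
      r 9 (min x 0) t] = _
    rw [e0, e2, e3, e4, e5, e7, e8, e9]
    exact ((oddSet_append_cancel [_, _, _, _, _, _, _, _] _ []).trans
      (oddSet_append_cancel [_, _, _] _ [_, _, _])).trans
      (oddSet_append_cancel [_, _, _] _ [_, _, _]).symm
  · intro x t ht h1 h2 h3 k hk
    fin_cases k
    all_goals first
      | (simp [subLeft, subMid] at hk; done)
      | simpa [subMid] using h1
      | simpa [subMid] using h3

variable {L M R : Fin 10 → ℝ}

lemma IsSubFans.structure (hq : 0 < q₀) (hu : 0 < u₀) (hu' : u₀ < 2 * q₀) {c : ℝ}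
    {f h : ℝ → ℝ → ℝ} (hs : IsSubFans q₀ u₀ X T' L M r c f h) {t : ℝ} (ht : t ∈ Ioo 0 T') (x : ℝ) :
    (h x t < 2*q₀ ↔ leftLine u₀ X (-sOuter q₀ u₀) t < x) ∧
    (-2*u₀ + 2*q₀ < f x t ∨ c < h x t ↔ x < leftLine u₀ X (-sInner q₀ u₀) t) ∧
    (c < h x t → f x t = c) ∧
    (r 1 (min x 0) t < -2*u₀ - 2*q₀ + 2*q₀ - (-2*u₀ + 2*q₀) ↔
      leftLine u₀ X (sInner q₀ u₀) t < x) ∧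
    (-2*u₀ - 2*q₀ < r 1 (min x 0) t ↔ x < leftLine u₀ X (sOuter q₀ u₀) t) := by
  have key := sub_jump (A := -2*u₀ - 2*q₀) (κ := -2*u₀ + 2*q₀) (D := 2*q₀) (by linarith)
    (by linarith) hs.le hs.lt hs.fan₁ hs.fan₂ hs.fan₃ hs.cfg ht x
  rw [harmonic_speed hq hu, soliton_speed] at key
  convert key using 4 <;> rw [leftLine] <;> ring_nf

lemma sub_eq_mid (hq : 0 < q₀) (hu : 0 < u₀) (hu' : u₀ < 2 * q₀) (hX : 0 < X)
    (hd : IsSymmetricData L M R)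
    (hF : ∀ r T', T' ≤ T → IsJumpSolution T X L M R r →
      (∀ t ∈ Ioo 0 T', ∀ k, r k 0 t = M k) → ∃ c f h, IsSubFans q₀ u₀ X T' L M r c f h)
    (h : IsJumpSolution T X L M R r) :
    ∀ t ∈ Ioo 0 (min T (interactionTime q₀ u₀ X)), ∀ k, r k 0 t = M k := by
  refine IsJumpSolution.eq_mid hX (min_le_left _ _) hd.left_eq hd.mid_eq hd.type
    (fun k hk l hl he => ?_) (fun r h τ hτ hmid => ?_) h
  · rcases hd.disjoint hl with h1 | h1
    · exact le_antisymm (he ▸ h1) (hd.mid_le l)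
    · exact absurd (le_antisymm (he ▸ h1) (hd.mid_le k)) hk
  · have hS := sOuter_gt hq hu
    have hτX := lt_interactionTime hq hu (hτ.2.trans_le (min_le_right _ _))
    obtain ⟨a, ha1, ha2⟩ := exists_between (show leftLine u₀ X (sOuter q₀ u₀) τ < 0 by
      rw [leftLine]; linarith)
    refine ⟨a, ha2, fun t ht k hk => ?_⟩
    obtain ⟨c, f, g, hs⟩ := hF r τ (hτ.2.le.trans (min_le_left _ _)) h hmid
    obtain ⟨h1, h2, h3, h4, h5⟩ := hs.structure hq hu hu' ht a
    have hlt : leftLine u₀ X (sOuter q₀ u₀) t < a := by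
      rw [leftLine] at ha1 ⊢
      nlinarith [ht.2]
    have hlt' : leftLine u₀ X (sInner q₀ u₀) t < a := by
      rw [leftLine] at hlt ⊢
      have : sInner q₀ u₀ < sOuter q₀ u₀ := by rw [sInner]; linarith
      nlinarith [ht.1]
    have hlt'' : ¬ a < leftLine u₀ X (-sInner q₀ u₀) t := fun hlt => by
      rw [leftLine] at hlt hlt'
      have : 0 < sInner q₀ u₀ := by rw [sInner]; linarith
      nlinarith [ht.1]
    have e1 : r 1 (min a 0) t = -2*u₀ - 2*q₀ :=
      le_antisymm (not_lt.1 fun h => hlt.not_gt (h5.1 h)) (hs.fan₁.mem a t ht).1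
    have e2 := mt h2.1 hlt''
    push Not at e2
    have := hs.eq_mid a t ht e1 (le_antisymm e2.1 (hs.fan₂.mem a t ht).1)
      (le_antisymm e2.2 (hs.fan₃.mem a t ht).1) k hk
    rwa [min_eq_left ha2.le] at this

theorem sub_regions (hq : 0 < q₀) (hu : 0 < u₀) (hu' : u₀ < 2 * q₀) (hX : 0 < X)
    (hd : IsSymmetricData L M R)
    (hF : ∀ r T', T' ≤ T → IsJumpSolution T X L M R r →
      (∀ t ∈ Ioo 0 T', ∀ k, r k 0 t = M k) → ∃ c f h, IsSubFans q₀ u₀ X T' L M r c f h)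
    (hj : IsJumpSolution T X L M R r) {t : ℝ} (ht0 : 0 < t) (htT : t < T)
    (htI : t < interactionTime q₀ u₀ X) :
    genusBoundary r t = {leftLine u₀ X (-sOuter q₀ u₀) t, leftLine u₀ X (-sInner q₀ u₀) t,
      leftLine u₀ X (sInner q₀ u₀) t, leftLine u₀ X (sOuter q₀ u₀) t,
      rightLine u₀ X (-sOuter q₀ u₀) t, rightLine u₀ X (-sInner q₀ u₀) t,
      rightLine u₀ X (sInner q₀ u₀) t, rightLine u₀ X (sOuter q₀ u₀) t} ∧
    genusRegion r 1 t =
      Ioo (leftLine u₀ X (-sOuter q₀ u₀) t) (leftLine u₀ X (-sInner q₀ u₀) t) ∪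
      Ioo (leftLine u₀ X (sInner q₀ u₀) t) (leftLine u₀ X (sOuter q₀ u₀) t) ∪
      (Ioo (rightLine u₀ X (-sOuter q₀ u₀) t) (rightLine u₀ X (-sInner q₀ u₀) t) ∪
      Ioo (rightLine u₀ X (sInner q₀ u₀) t) (rightLine u₀ X (sOuter q₀ u₀) t)) ∧
    genusRegion r 0 t = (genusRegion r 1 t)ᶜ := by
  have hS := sOuter_gt hq hu
  have htX := lt_interactionTime hq hu htI
  have hc0 : 0 < sInner q₀ u₀ := by rw [sInner]; linarith
  have hcS : sInner q₀ u₀ < sOuter q₀ u₀ := by rw [sInner]; linarith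
  have e1 := mul_pos ht0 hc0
  have e2 := mul_lt_mul_of_pos_left hcS ht0
  have ht : t ∈ Ioo 0 (min T (interactionTime q₀ u₀ X)) := ⟨ht0, lt_min htT htI⟩
  obtain ⟨h1, h0⟩ := hj.genusRegion_eq (t := t) hd
    (G := Ioo (leftLine u₀ X (-sOuter q₀ u₀) t) (leftLine u₀ X (-sInner q₀ u₀) t) ∪
      Ioo (leftLine u₀ X (sInner q₀ u₀) t) (leftLine u₀ X (sOuter q₀ u₀) t))
    (fun r h x hx => by
      obtain ⟨c, f, g, hs⟩ := hF r _ (min_le_left T (interactionTime q₀ u₀ X)) h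
        (sub_eq_mid hq hu hu' hX hd hF h)
      obtain ⟨h1, h2, h3, h4, h5⟩ := hs.structure hq hu hu' ht x
      have hcfg := hs.cfg x t ht
      have := card_sub (by linarith) (by linarith) hs.le hs.lt (hs.fan₁.mem x t ht)
        (hs.fan₂.mem x t ht) (hs.fan₃.mem x t ht) h1 h2 h3 h4 h5
        (by rw [leftLine, leftLine]; linarith)
      rw [← hcfg] at this
      simpa only [min_eq_left hx] using this)
    (fun x hx => by
      change x < 0
      rcases hx with hx | hx <;>
      · have := hx.2
        rw [leftLine] at this
        linarith)
  have e : {x | -x ∈ Ioo (leftLine u₀ X (-sOuter q₀ u₀) t) (leftLine u₀ X (-sInner q₀ u₀) t) ∪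
      Ioo (leftLine u₀ X (sInner q₀ u₀) t) (leftLine u₀ X (sOuter q₀ u₀) t)} =
      Ioo (rightLine u₀ X (-sOuter q₀ u₀) t) (rightLine u₀ X (-sInner q₀ u₀) t) ∪
      Ioo (rightLine u₀ X (sInner q₀ u₀) t) (rightLine u₀ X (sOuter q₀ u₀) t) := by
    ext x
    simp only [mem_ofPred_eq, mem_union, mem_Ioo, leftLine, rightLine]
    constructor <;> rintro (⟨h1, h2⟩ | ⟨h1, h2⟩)
    · right; constructor <;> linarith
    · left; constructor <;> linarith
    · right; constructor <;> linarith
    · left; constructor <;> linarith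
  rw [e] at h1
  refine ⟨?_, h1, h0⟩
  rw [genusBoundary, h0, h1]
  exact boundary_four (by rw [leftLine, leftLine]; linarith) (by rw [leftLine, leftLine]; linarith)
    (by rw [leftLine, leftLine]; linarith) (by rw [leftLine, rightLine]; linarith)
    (by rw [rightLine, rightLine]; linarith) (by rw [rightLine, rightLine]; linarith)
    (by rw [rightLine, rightLine]; linarith)

theorem subcritical_regions (hq : 0 < q₀) (hu : 0 < u₀) (hu' : u₀ < 2 * q₀) (hX : 0 < X)
    (h : IsWhithamSolution T (subcriticalData q₀ u₀ X) r) {t : ℝ} (ht0 : 0 < t) (htT : t < T)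
    (htI : t < interactionTime q₀ u₀ X) :
    genusBoundary r t = {leftLine u₀ X (-sOuter q₀ u₀) t, leftLine u₀ X (-sInner q₀ u₀) t,
      leftLine u₀ X (sInner q₀ u₀) t, leftLine u₀ X (sOuter q₀ u₀) t,
      rightLine u₀ X (-sOuter q₀ u₀) t, rightLine u₀ X (-sInner q₀ u₀) t,
      rightLine u₀ X (sInner q₀ u₀) t, rightLine u₀ X (sOuter q₀ u₀) t} ∧
    genusRegion r 1 t =
      Ioo (leftLine u₀ X (-sOuter q₀ u₀) t) (leftLine u₀ X (-sInner q₀ u₀) t) ∪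
      Ioo (leftLine u₀ X (sInner q₀ u₀) t) (leftLine u₀ X (sOuter q₀ u₀) t) ∪
      (Ioo (rightLine u₀ X (-sOuter q₀ u₀) t) (rightLine u₀ X (-sInner q₀ u₀) t) ∪
      Ioo (rightLine u₀ X (sInner q₀ u₀) t) (rightLine u₀ X (sOuter q₀ u₀) t)) ∧
    genusRegion r 0 t = (genusRegion r 1 t)ᶜ := by
  rcases le_or_gt u₀ q₀ with hle | hlt
  · rw [subcriticalData, if_pos hle] at h
    exact sub_regions (L := subLeft q₀ u₀) (M := subMid q₀ u₀) (R := subRight q₀ u₀) hq hu hu' hX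
      (isSymmetricData_sub hu hle)
      (fun r T' hT' hr hmid => isSubFans_sub hu hle hX hT' hr hmid)
      (IsWhithamSolution.isJumpSolution hX h) ht0 htT htI
  · rw [subcriticalData, if_neg hlt.not_ge] at h
    exact sub_regions (L := interLeft q₀ u₀) (M := interMid q₀ u₀) (R := interRight q₀ u₀) hq hu
      hu' hX (isSymmetricData_inter hlt hu')
      (fun r T' hT' hr hmid => isSubFans_inter hlt hu' hX hT' hr hmid)
      (IsWhithamSolution.isJumpSolution hX h) ht0 htT htI

end Sub

end NLSWhitham
end

theorem mainTheorem7 (q₀ u₀ X T : ℝ) (hq : 0 < q₀) (hu : 0 < u₀) (hX : 0 < X) :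
    -- two super-critical jumps
    (2 * q₀ < u₀ → ∀ r : Fin 6 → ℝ → ℝ → ℝ,
      NLSWhitham.IsWhithamSolution T (NLSWhitham.superData q₀ u₀ X) r →
      ∀ t : ℝ, 0 < t → t < T → t < NLSWhitham.interactionTime q₀ u₀ X →
        let l := fun s => NLSWhitham.leftLine u₀ X s t
        let r' := fun s => NLSWhitham.rightLine u₀ X s t
        let s := NLSWhitham.sOuter q₀ u₀
        NLSWhitham.genusBoundary r t = {l (-s), l s, r' (-s), r' s} ∧
        NLSWhitham.genusRegion r 1 t = Set.Ioo (l (-s)) (l s) ∪ Set.Ioo (r' (-s)) (r' s) ∧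
        NLSWhitham.genusRegion r 0 t = (NLSWhitham.genusRegion r 1 t)ᶜ) ∧
    -- two sub-critical jumps
    (u₀ < 2 * q₀ → ∀ r : Fin 10 → ℝ → ℝ → ℝ,
      NLSWhitham.IsWhithamSolution T (NLSWhitham.subcriticalData q₀ u₀ X) r →
      ∀ t : ℝ, 0 < t → t < T → t < NLSWhitham.interactionTime q₀ u₀ X →
        let l := fun s => NLSWhitham.leftLine u₀ X s t
        let r' := fun s => NLSWhitham.rightLine u₀ X s t
        let s := NLSWhitham.sOuter q₀ u₀
        let c := NLSWhitham.sInner q₀ u₀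
        NLSWhitham.genusBoundary r t =
          {l (-s), l (-c), l c, l s, r' (-s), r' (-c), r' c, r' s} ∧
        NLSWhitham.genusRegion r 1 t =
          Set.Ioo (l (-s)) (l (-c)) ∪ Set.Ioo (l c) (l s) ∪
            (Set.Ioo (r' (-s)) (r' (-c)) ∪ Set.Ioo (r' c) (r' s)) ∧
        NLSWhitham.genusRegion r 0 t = (NLSWhitham.genusRegion r 1 t)ᶜ) := by
  exact ⟨fun h r hr t ht0 htT htI => NLSWhitham.super_regions hq h hX hr ht0 htT htI,
    fun h r hr t ht0 htT htI => NLSWhitham.subcritical_regions hq hu h hX hr ht0 htT htI⟩
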